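/- \textbf{Setting.} Let $\mathcal A$ be a set of particles with a real symmetric interaction matrix $\mathcal L=(L(\alpha,\beta))_{\alpha,\beta\in\mathcal A}$, and let $\mathcal C$ be a finite set of channels. A channel $\sigma\in\mathcal C$ is a sequence $\sigma(0),\sigma(1),\dots$ of particles, all particles $\sigma(k)$ ($\sigma\in\mathcal C$, $k\ge0$) being distinct. For $k\ge1$, $L(\sigma(k),\beta)\ne0$ only if $\beta\in\{\sigma(k-1),\sigma(k),\sigma(k+1)\}$, and the central part $\mathcal A_1=\mathcal A\setminus\{\sigma(k):\sigma\in\mathcal C,\ k\ge1\}$ is finite. Put $\mathfrak a_\sigma(k)=L(\sigma(k),\sigma(k))$ for $k\ge 1$ and $\mathfrak b_\sigma(k)=-L(\sigma(k),\sigma(k+1))$ for $k\ge 0$, and assume $\mathfrak b_\sigma(k)>0$. Assume that there are $a_\sigma\in\mathbb R$, $b_\sigma>0$ and $\epsilon>0$ with $\sum_{k\ge1}(1+\epsilon)^k\{|\mathfrak a_\sigma(k)-a_\sigma|+|\mathfrak b_\sigma(k)-b_\sigma|\}<\infty$ for every $\sigma$, that $\bigcup_\sigma(a_\sigma-2b_\sigma,a_\sigma+2b_\sigma)$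 is (non-empty and) connected, and that $\bigcup_\sigma[a_\sigma-2b_\sigma,a_\sigma+2b_\sigma]=[a-2b,a+2b]$. Let $\mathbb D$ be the open unit disc, $\lambda(\omega)=a-b(\omega+\omega^{-1})$ and $\lambda_\sigma(\theta)=a_\sigma-b_\sigma(\theta+\theta^{-1})$. For $\omega\in\overline{\mathbb D}\setminus\{0\}$ let $\theta_\sigma(\omega)\in\overline{\mathbb D}$ be the solution of $\lambda_\sigma(\theta_\sigma(\omega))=\lambda(\omega)$ that lies in $\mathbb D$ for $\omega\in\mathbb D$, extended continuously to $|\omega|=1$. Let $e_\sigma(k,\theta)$ be the Jost solution, i.e. the solution of $$-\mathfrak b_\sigma(k-1)x(k-1)+\mathfrak a_\sigma(k)x(k)-\mathfrak b_\sigma(k)x(k+1)=\lambda\,x(k),\qquad k\ge1,$$ with $\lambda=\lambda_\sigma(\theta)$ and $e_\sigma(k,\theta)=\theta^k(1+o(1))$ as $k\to\infty$, and let $p_\sigma(k,\omega)$ be its solution with $\lambda=\lambda(\omega)$, $p_\sigma(0,\omega)=1$, $p_\sigma(1,\omega)=0$. Let $r(\alpha,\beta;\lambda)$ be the entries of $(\mathcal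 L_1-\lambda I)^{-1}$, where $\mathcal L_1$ is the truncation of $\mathcal L$ to $\mathcal A_1$, and put $\mathcal R(\lambda)=(r(\sigma(0),\nu(0);\lambda))_{\sigma,\nu\in\mathcal C}$. With the diagonal matrices $\mathcal E(k,\omega)=\mathrm{diag}\{e_\sigma(k,\theta_\sigma(\omega))\}$, $P(k,\omega)=\mathrm{diag}\{p_\sigma(k,\omega)\}$, $B=\mathrm{diag}\{b_\sigma\}$, $B(0)=\mathrm{diag}\{\mathfrak b_\sigma(0)\}$, $D(\omega)=\mathrm{diag}\{\theta_\sigma(\omega)^{-1}-\theta_\sigma(\omega)\}$ put $$T(\omega)=\mathcal E(0,\omega)-\mathcal R(\lambda(\omega))B(0)\mathcal E(1,\omega),\qquad U(k,\omega)=[-P(k,\omega)+\mathcal E(k,\omega)T(\omega)^{-1}]\,B\,B(0)^{-1}D(\omega)\mathcal E(1,\omega)^{-1}.$$ Let $\Omega$ be the set of non-zero poles of the functions $U(k,\cdot)$ in $\overline{\mathbb D}$; a point of the unit circle is a pole if some entry of some $U(k,\cdot)$ continues from $\mathbb D$ to a function meromorphic near that point with a pole there. For $\hat\omega\in\overline{\mathbb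 D}\setminus\{0\}$ write $T(\omega)^{-1}=(\tau_{\sigma\nu}(\omega))$, $$h_{\sigma\nu}(\omega)=-\frac{b_\nu}{\mathfrak b_\nu(0)}\,\frac{\theta_\nu(\hat\omega)-\theta_\nu(\hat\omega)^{-1}}{e_\nu(1,\theta_\nu(\omega))}\,(\omega-\hat\omega)\,\tau_{\sigma\nu}(\omega),\qquad h_{\sigma\nu}(\hat\omega)=\lim_{\omega\to\hat\omega}h_{\sigma\nu}(\omega),$$ and let $\mathfrak m(\hat\omega)=(m_{\sigma\nu}(\hat\omega))_{\sigma,\nu\in\mathcal C}$, where $m_{\sigma\nu}(\hat\omega)=h_{\sigma\nu}(\hat\omega)$ if $e_\nu(1,\theta_\nu(\hat\omega))\neq0$, and otherwise $$m_{\sigma\nu}(\hat\omega)=h_{\sigma\nu}(\hat\omega)+\delta_{\sigma\nu}\frac{b_\nu}{\mathfrak b_\nu(0)}\,\frac{\theta_\nu(\hat\omega)-\theta_\nu(\hat\omega)^{-1}}{e_\nu(0)\dot e_\nu(1)-e_\nu(1)\dot e_\nu(0)},$$ with $e_\nu(k)=e_\nu(k,\theta_\nu(\hat\omega))$ and $\dot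 e_\nu(k)=\frac{d}{d\omega}e_\nu(k,\theta_\nu(\omega))|_{\omega=\hat\omega}$. Here and below, limits $\omega\to\hat\omega$ are taken over $\omega\in\mathbb D\setminus\{\hat\omega\}$, and the residue at an at most simple pole is $\mathrm{Res}_{\hat\omega}f=\lim_{\omega\to\hat\omega}(\omega-\hat\omega)f(\omega)$. \textbf{Lemma.} Let $\hat\omega\in\overline{\mathbb D}\setminus\{0,1,-1\}$; in particular $\hat\omega$ may be any point of $\Omega\setminus\{1,-1\}$. Then all the limits $h_{\sigma\nu}(\hat\omega)$ exist, and: (1) $\mathrm{Res}_{\hat\omega}U(k,\cdot)$ exists and equals $\mathcal E(k,\hat\omega)\,\mathfrak m(\hat\omega)$ for all $k=0,1,2,\dots$ (2) For each $\nu\in\mathcal C$ there is $\phi^\nu=\phi^\nu(\cdot,\hat\omega)\in\ell^2(\mathcal A)$ with $\mathcal L\phi^\nu=\lambda(\hat\omega)\phi^\nu$, $$\phi^\nu(\sigma(k))=e_\sigma(k,\theta_\sigma(\hat\omega))\,m_{\sigma\nu}(\hat\omega)\quad(\sigma\in\mathcal C,\ k\ge0),$$ and, for $\alpha\in\mathcal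 A_1$, $$\phi^\nu(\alpha)=\lim_{\omega\to\hat\omega}(\omega-\hat\omega)\sum_{\gamma\in\mathcal C}r(\alpha,\gamma(0);\lambda(\omega))\,\mathfrak b_\gamma(0)\,u_{\gamma\nu}(1,\omega),$$ where $u_{\gamma\nu}$ are the entries of $U$. If $\hat\omega\in\Omega$, then $\phi^\nu\ne0$ for some $\nu$, so that $\lambda(\hat\omega)$ is an eigenvalue of $\mathcal L$. (3) For each $\nu\in\mathcal C$, $$\|\phi^\nu\|^2=-\frac{b_\nu(1-\theta_\nu(\hat\omega)^{-2})}{b\,(1-\overline{\hat\omega}^{\,-2})}\,\theta_\nu(\hat\omega)\,m_{\nu\nu}(\hat\omega),$$ and this normalization is unique: if $\phi^\nu\neq0$ and $c\in\mathbb C\setminus\{0\}$ are such that the formula also holds with $c\,\phi^\nu$ and $c\,m_{\nu\nu}(\hat\omega)$ in place of $\phi^\nu$ and $m_{\nu\nu}(\hat\omega)$, then $c=1$. -/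

import Mathlib

open Filter Topology Metric

noncomputable section

/-- A web-like system of particles: a finite central part with finitely many semi-infinite chains
(channels) attached to it.  `A` is the set of all particles, `C` the set of channels, `L` the real
symmetric interaction matrix and `pt σ k` the `k`-th particle of the channel `σ`; `pt σ 0` is its
attachment point, which belongs to the central part.  The coefficients of each channel converge
exponentially fast to their limits `aInf σ`, `bInf σ`, and the intervals
`[aInf σ - 2 bInf σ, aInf σ + 2 bInf σ]` fill the interval `[a - 2b, a + 2b]`. -/
structure WebSystem (A C : Type*) where
  L : A → A → ℝ
  L_symm : ∀ α β, L α β = L β α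
  pt : C → ℕ → A
  pt_injective : Function.Injective fun p : C × ℕ => pt p.1 p.2
  /-- For `p ≥ 1` the particle `pt σ p` interacts only with itself (external field) and with its
  two neighbours in the channel. -/
  interact : ∀ σ k β, L (pt σ (k + 1)) β ≠ 0 →
    β = pt σ k ∨ β = pt σ (k + 1) ∨ β = pt σ (k + 2)
  /-- The central part, all particles other than `pt σ k` with `k ≥ 1`, is finite. -/
  finite_central : {α : A | ∀ σ k, α ≠ pt σ (k + 1)}.Finite
  offDiag_neg : ∀ σ k, L (pt σ k) (pt σ (k + 1)) < 0
  aInf : C → ℝ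
  bInf : C → ℝ
  bInf_pos : ∀ σ, 0 < bInf σ
  decay : ∃ ε > (0 : ℝ), ∀ σ, Summable fun k : ℕ => (1 + ε) ^ (k + 1) *
    (|L (pt σ (k + 1)) (pt σ (k + 1)) - aInf σ| +
      |-L (pt σ (k + 1)) (pt σ (k + 2)) - bInf σ|)
  a : ℝ
  b : ℝ
  connected : IsConnected (⋃ σ, Set.Ioo (aInf σ - 2 * bInf σ) (aInf σ + 2 * bInf σ))
  union_eq : (⋃ σ, Set.Icc (aInf σ - 2 * bInf σ) (aInf σ + 2 * bInf σ)) =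
    Set.Icc (a - 2 * b) (a + 2 * b)

namespace WebSystem

variable {A C : Type*} (S : WebSystem A C)

/-- The diagonal channel coefficients `𝔞_σ(k) = L(σ(k), σ(k))` (used for `k ≥ 1`). -/
def diagCoeff (σ : C) (k : ℕ) : ℝ := S.L (S.pt σ k) (S.pt σ k)

/-- The off-diagonal channel coefficients `𝔟_σ(k) = -L(σ(k), σ(k+1))`, `k ≥ 0`. -/
def offCoeff (σ : C) (k : ℕ) : ℝ := -S.L (S.pt σ k) (S.pt σ (k + 1))

/-- The action of the matrix `L` on functions on the particles; every row of `L` has finite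
support, so the sum is finite. -/
def apply (ξ : A → ℂ) (α : A) : ℂ := ∑ᶠ β, (S.L α β : ℂ) * ξ β

/-- The central part of the system. -/
def central : Set A := {α : A | ∀ σ k, α ≠ S.pt σ (k + 1)}

instance : Fintype S.central := S.finite_central.fintype

theorem pt_zero_mem_central (σ : C) : S.pt σ 0 ∈ S.central := by
  intro ν k h
  have h2 := S.pt_injective (a₁ := (σ, 0)) (a₂ := (ν, k + 1)) h
  simp at h2

/-- The attachment point of a channel, as an element of the central part. -/
def attach (σ : C) : S.central := ⟨S.pt σ 0, S.pt_zero_mem_central σ⟩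

open Classical in
/-- The resolvent `r(α, β; z)` of the truncation of `L` to the central part. -/
def centralResolvent (z : ℂ) : Matrix S.central S.central ℂ :=
  (Matrix.of (fun α β : S.central => (S.L α β : ℂ)) - z • (1 : Matrix S.central S.central ℂ))⁻¹

/-- `λ(ω) = a - b (ω + ω⁻¹)`. -/
def lam (ω : ℂ) : ℂ := S.a - S.b * (ω + ω⁻¹)

/-- `λ_σ(θ) = a_σ - b_σ (θ + θ⁻¹)`. -/
def chanLam (σ : C) (θ : ℂ) : ℂ := S.aInf σ - S.bInf σ * (θ + θ⁻¹)

/-- `θ` is the value at `ω` of `θ_σ = λ_σ⁻¹ ∘ λ`, the branch into the unit disc, continuous up to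
the boundary.  If `0 < |ω| < 1` the last condition is automatic.  If `|ω| = 1` and `λ(ω)` is an
interior point of `[a_σ - 2 b_σ, a_σ + 2 b_σ]`, it selects the boundary value from inside the disc
among the two conjugate unimodular roots. -/
def IsTheta (σ : C) (ω θ : ℂ) : Prop :=
  θ ≠ 0 ∧ ‖θ‖ ≤ 1 ∧ S.chanLam σ θ = S.lam ω ∧ 0 ≤ θ.im * ω.im

/-- The function `θ_σ(ω)`, for `0 < |ω| ≤ 1`. -/
def theta (σ : C) (ω : ℂ) : ℂ := Classical.epsilon (S.IsTheta σ ω)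

/-- `x` is the Jost solution of the channel `σ` at `θ`: it solves the channel equation with spectral
parameter `λ_σ(θ)`, and `x(k) = θ^k (1 + o(1))`. -/
def IsJost (σ : C) (θ : ℂ) (x : ℕ → ℂ) : Prop :=
  (∀ k, -(S.offCoeff σ k : ℂ) * x k + (S.diagCoeff σ (k + 1) : ℂ) * x (k + 1)
      - (S.offCoeff σ (k + 1) : ℂ) * x (k + 2) = S.chanLam σ θ * x (k + 1)) ∧
    Tendsto (fun k => x k / θ ^ k) atTop (𝓝 1)

/-- The Jost solution `e_σ(k, θ)`, for `0 < |θ| ≤ 1`. -/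
def jost (σ : C) (θ : ℂ) : ℕ → ℂ := Classical.epsilon (S.IsJost σ θ)

/-- `e_σ(k, θ_σ(ω))`. -/
def e (σ : C) (k : ℕ) (ω : ℂ) : ℂ := S.jost σ (S.theta σ ω) k

/-- The solution `p_σ(k, ω)` of the channel equation with spectral parameter `λ(ω)` and
`p_σ(0, ω) = 1`, `p_σ(1, ω) = 0`. -/
def p (σ : C) (ω : ℂ) : ℕ → ℂ
  | 0 => 1
  | 1 => 0
  | k + 2 => (((S.diagCoeff σ (k + 1) : ℂ) - S.lam ω) * p σ ω (k + 1)
      - (S.offCoeff σ k : ℂ) * p σ ω k) / (S.offCoeff σ (k + 1) : ℂ)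

/-- The filter of points of the open unit disc, other than `z`, that tend to `z`. -/
def discNhds (z : ℂ) : Filter ℂ := 𝓝[ball 0 1 \ {z}] z

variable [Fintype C] [DecidableEq C]

/-- The diagonal matrix `𝓔(k, ω)` of Jost solutions. -/
def E (k : ℕ) (ω : ℂ) : Matrix C C ℂ := Matrix.diagonal fun σ => S.e σ k ω

/-- The diagonal matrix `P(k, ω)`. -/
def P (k : ℕ) (ω : ℂ) : Matrix C C ℂ := Matrix.diagonal fun σ => S.p σ ω k

/-- `B = diag(b_σ)`. -/
def B : Matrix C C ℂ := Matrix.diagonal fun σ => (S.bInf σ : ℂ)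

/-- `B(0) = diag(𝔟_σ(0))`. -/
def B0 : Matrix C C ℂ := Matrix.diagonal fun σ => (S.offCoeff σ 0 : ℂ)

/-- `D(ω) = diag(θ_σ(ω)⁻¹ - θ_σ(ω))`. -/
def D (ω : ℂ) : Matrix C C ℂ := Matrix.diagonal fun σ => (S.theta σ ω)⁻¹ - S.theta σ ω

/-- `𝓡(z) = (r(σ(0), ν(0); z))`. -/
def R (z : ℂ) : Matrix C C ℂ := (S.centralResolvent z).submatrix S.attach S.attach

/-- `T(ω) = 𝓔(0, ω) - 𝓡(λ(ω)) B(0) 𝓔(1, ω)`. -/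
def T (ω : ℂ) : Matrix C C ℂ := S.E 0 ω - S.R (S.lam ω) * S.B0 * S.E 1 ω

/-- `U(k, ω) = (-P(k, ω) + 𝓔(k, ω) T(ω)⁻¹) B B(0)⁻¹ D(ω) 𝓔(1, ω)⁻¹`. -/
def U (k : ℕ) (ω : ℂ) : Matrix C C ℂ :=
  (-S.P k ω + S.E k ω * (S.T ω)⁻¹) * S.B * (S.B0)⁻¹ * S.D ω * (S.E 1 ω)⁻¹

/-- The prolongation to the central part of the `ν`-th column of `U(·, ω)`. -/
def centralColumn (ν : C) (ω : ℂ) (α : S.central) : ℂ :=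
  ∑ γ, S.centralResolvent (S.lam ω) α (S.attach γ) * (S.offCoeff γ 0 : ℂ) * S.U 1 ω γ ν

/-- The set `Ω` of the nonzero poles of the functions `U(k, ·)` in the closed unit disc: some
entry continues from the disc to a function meromorphic at the point, with a pole there. -/
def Omega : Set ℂ :=
  {z | ‖z‖ ≤ 1 ∧ z ≠ 0 ∧ ∃ (k : ℕ) (σ ν : C) (f : ℂ → ℂ), MeromorphicAt f z ∧
    meromorphicOrderAt f z < 0 ∧ ∀ᶠ ω in discNhds z, S.U k ω σ ν = f ω}

/-- The functions `h_{σν}(ω)` attached to the point `z`. -/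
def h (z : ℂ) (σ ν : C) (ω : ℂ) : ℂ :=
  -((S.bInf ν : ℂ) / (S.offCoeff ν 0 : ℂ)) *
    ((S.theta ν z - (S.theta ν z)⁻¹) / S.e ν 1 ω) * (ω - z) * (S.T ω)⁻¹ σ ν

/-- The derivative of `e_σ(k, θ_σ(ω))` with respect to `ω`, on the closed unit disc. -/
def eDot (σ : C) (k : ℕ) (z : ℂ) : ℂ := derivWithin (S.e σ k) (closedBall 0 1) z

open Classical in
/-- The diagonal term that is added to `h_{νν}(z)` when `e_ν(1, θ_ν(z)) = 0`; its denominator is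
the Wronskian of `e_ν` and its derivative at `k = 0`. -/
def correction (z : ℂ) (σ ν : C) : ℂ :=
  if σ = ν ∧ S.e ν 1 z = 0 then
    (S.bInf ν : ℂ) / (S.offCoeff ν 0 : ℂ) * ((S.theta ν z - (S.theta ν z)⁻¹) /
      (S.e ν 0 z * S.eDot ν 1 z - S.e ν 1 z * S.eDot ν 0 z))
  else 0

/-- `m` is the matrix `m(z)`: its entries are `h_{σν}(z) = lim h_{σν}(ω)`, with the additional
diagonal term in the columns for which `e_ν(1, θ_ν(z)) = 0`. -/
def IsCoeffMatrix (z : ℂ) (m : Matrix C C ℂ) : Prop :=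
  ∀ σ ν, ∃ l, Tendsto (S.h z σ ν) (discNhds z) (𝓝 l) ∧ m σ ν = l + S.correction z σ ν

end WebSystem

end

namespace WebSystem

/-! ### The channel equation, and Jost solutions up to the unit circle. -/

section

variable {A C : Type*} (S : WebSystem A C)

/-! The proof uses compactness and Green's formula; analyticity of `U` is never needed. Fix an index
`K ≥ 1` such that no Jost solution vanishes from `K` on, uniformly in `θ` (`exists_jost_ne_zero`).
For `ω` in the disc near `z`, the column `ν` of `U` solves the equation on the channels and, because
T T⁻¹ = 1, extends to the central part. Beyond `K` it is replaced by a multiple of the Jost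
solution. This gives an outgoing function `g` with (L - λ(ω)) g = κ δ_β, where β = ν(K) and κ = b_ν
(θ_ν⁻¹ - θ_ν) / e_ν(K) (`IsRegular.exists_outgoing`).

Consider any limit y of (ω - z) g. It is outgoing and solves L y = λ(z) y. Conservation of flux
excludes the open channels (`IsOutgoing.eq_zero_or_im_eq_zero`), and a separate argument excludes
channels whose band has an edge at λ(z), where Jost solutions do not decay (`limit_closed`). So y is
an eigenvector decaying along the channels. Pairing with any such eigenvector w, Green's formula
gives ⟨y, w⟩ = -κ₀ conj(w(β)) / λ'(z), where λ'(z) ≠ 0 because z ≠ ±1 (`limit_boundState`).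

This one identity has three uses. With κ₀ = 0 it makes a normalized limit orthogonal to itself,
hence zero, which proves the bound |ω - z| |g| ≤ c |κ| (`apriori`). Two limits have the same
pairings, so their difference is orthogonal to itself and the residue exists (`exists_residue`).
With w = y it is the normalization formula.

On each channel the residue is a multiple of the Jost solution, and the multiples form the matrix m.
Comparing `U` at `K` with T⁻¹ identifies m with the limits of h, up to the contribution of -P, which
survives only where e_ν(1) has a zero (`exists_tendsto_h`). These zeros are simple
(`exists_hasDerivWithinAt_e_one`). -/

theorem offCoeff_pos (σ : C) (k : ℕ) : 0 < S.offCoeff σ k := neg_pos.2 (S.offDiag_neg σ k)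

theorem offCoeff_ne_zero (σ : C) (k : ℕ) : (S.offCoeff σ k : ℂ) ≠ 0 :=
  Complex.ofReal_ne_zero.2 (S.offCoeff_pos σ k).ne'

/-- `x` solves the channel equation with spectral parameter `μ`. -/
def IsChanSol (σ : C) (μ : ℂ) (x : ℕ → ℂ) : Prop :=
  ∀ k, -(S.offCoeff σ k : ℂ) * x k + (S.diagCoeff σ (k + 1) : ℂ) * x (k + 1)
      - (S.offCoeff σ (k + 1) : ℂ) * x (k + 2) = μ * x (k + 1)

variable {S}

namespace IsChanSol

variable {σ : C} {μ μ' : ℂ} {x y : ℕ → ℂ}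

theorem sub (hx : S.IsChanSol σ μ x) (hy : S.IsChanSol σ μ y) :
    S.IsChanSol σ μ fun k => x k - y k := fun k => by
  linear_combination hx k - hy k

theorem mul_const (hx : S.IsChanSol σ μ x) (c : ℂ) : S.IsChanSol σ μ fun k => x k * c :=
  fun k => by linear_combination c * hx k

theorem conj (hx : S.IsChanSol σ μ x) :
    S.IsChanSol σ (starRingEnd ℂ μ) fun k => starRingEnd ℂ (x k) := fun k => by
  simpa using congrArg (starRingEnd ℂ) (hx k)

theorem tendsto {ι : Type*} {l : Filter ι} [l.NeBot] {μ : ι → ℂ} {x : ι → ℕ → ℂ} {μ₀ : ℂ}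
    {y : ℕ → ℂ} (hx : ∀ᶠ i in l, S.IsChanSol σ (μ i) (x i)) (hμ : Tendsto μ l (𝓝 μ₀))
    (h : ∀ k, Tendsto (fun i => x i k) l (𝓝 (y k))) : S.IsChanSol σ μ₀ y := fun k => by
  refine tendsto_nhds_unique_of_eventuallyEq
    ((((h k).const_mul _).add ((h (k + 1)).const_mul _)).sub ((h (k + 2)).const_mul _))
    (hμ.mul (h (k + 1))) ?_
  filter_upwards [hx] with i hi using hi k

theorem eq_zero_of_two (hx : S.IsChanSol σ μ x) {K : ℕ} (h0 : x K = 0) (h1 : x (K + 1) = 0) :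
    x = 0 := by
  have up : ∀ n, x (K + n) = 0 ∧ x (K + n + 1) = 0 := by
    intro n
    induction n with
    | zero => exact ⟨h0, h1⟩
    | succ n ih =>
      refine ⟨ih.2, ?_⟩
      have := hx (K + n)
      rw [ih.1, ih.2] at this
      have h2 : (S.offCoeff σ (K + n + 1) : ℂ) * x (K + n + 2) = 0 := by linear_combination -this
      exact (mul_eq_zero.1 h2).resolve_left (S.offCoeff_ne_zero _ _)
  have down : ∀ n, n ≤ K → x (K - n) = 0 ∧ x (K - n + 1) = 0 := by
    intro n
    induction n with
    | zero => exact fun _ => ⟨h0, h1⟩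
    | succ n ih =>
      intro hn
      obtain ⟨i0, i1⟩ := ih (by omega)
      obtain ⟨m, hm⟩ : ∃ m, K - n = m + 1 := ⟨K - n - 1, by omega⟩
      have hm' : K - (n + 1) = m := by omega
      rw [hm] at i0 i1
      rw [hm']
      refine ⟨?_, i0⟩
      have := hx m
      rw [i0, i1] at this
      have h2 : (S.offCoeff σ m : ℂ) * x m = 0 := by linear_combination -this
      exact (mul_eq_zero.1 h2).resolve_left (S.offCoeff_ne_zero _ _)
  funext k
  rcases le_total k K with h | h
  · have := (down (K - k) (by omega)).1
    rwa [show K - (K - k) = k by omega] at this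
  · have := (up (k - K)).1
    rwa [show K + (k - K) = k by omega] at this

theorem ext_two (hx : S.IsChanSol σ μ x) (hy : S.IsChanSol σ μ y) {K : ℕ} (h0 : x K = y K)
    (h1 : x (K + 1) = y (K + 1)) : x = y := by
  have := (hx.sub hy).eq_zero_of_two (K := K) (by simp [h0]) (by simp [h1])
  funext k
  exact sub_eq_zero.1 (congrFun this k)

end IsChanSol

theorem exists_chanSol (σ : C) (μ : ℂ) (M : ℕ) (u v : ℂ) :
    ∃ x, S.IsChanSol σ μ x ∧ x M = u ∧ x (M + 1) = v := by
  induction M generalizing u v with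
  | zero =>
    let F : ℕ → ℂ × ℂ := fun n => Nat.rec (u, v) (fun k q =>
      (q.2, ((S.diagCoeff σ (k + 1) - μ) * q.2 - S.offCoeff σ k * q.1)
        / S.offCoeff σ (k + 1))) n
    refine ⟨fun k => (F k).1, fun k => ?_, rfl, rfl⟩
    have h := S.offCoeff_ne_zero σ (k + 1)
    change -(S.offCoeff σ k : ℂ) * (F k).1 + (S.diagCoeff σ (k + 1) : ℂ) * (F k).2
      - (S.offCoeff σ (k + 1) : ℂ) * (((S.diagCoeff σ (k + 1) - μ) * (F k).2
        - S.offCoeff σ k * (F k).1) / S.offCoeff σ (k + 1)) = μ * (F k).2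
    field_simp
    ring
  | succ M ih =>
    obtain ⟨x, hx, h0, h1⟩ := ih
      (((S.diagCoeff σ (M + 1) - μ) * u - S.offCoeff σ (M + 1) * v) / S.offCoeff σ M) u
    refine ⟨x, hx, h1, ?_⟩
    have := hx M
    have h := S.offCoeff_ne_zero σ (M + 1)
    have h' := S.offCoeff_ne_zero σ M
    rw [h0, h1] at this
    field_simp at this
    refine mul_left_cancel₀ h ?_
    linear_combination -this

variable (S)

/-- Here `ρ` is the square root of (1 + ε)⁻¹. Writing the decay as `ρ ^ (2 * k)` leaves one factor
`ρ ^ k` to weight the differences in `exists_chanSol_bound` and another one to sum over. -/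
theorem coeff_bounds (σ : C) : ∃ c ρ β : ℝ, 0 ≤ c ∧ 0 < ρ ∧ ρ < 1 ∧ 0 ≤ β ∧
    (∀ k, |S.offCoeff σ k - S.bInf σ| ≤ c * ρ ^ (2 * k)) ∧
    (∀ k, |S.diagCoeff σ (k + 1) - S.aInf σ| ≤ c * ρ ^ (2 * k)) ∧
    ∀ k, (S.offCoeff σ k)⁻¹ ≤ β := by
  obtain ⟨ε, hε, hs⟩ := S.decay
  replace hs := hs σ
  set T := ∑' k : ℕ, (1 + ε) ^ (k + 1) *
    (|L S (S.pt σ (k + 1)) (S.pt σ (k + 1)) - S.aInf σ| +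
      |-S.L (S.pt σ (k + 1)) (S.pt σ (k + 2)) - S.bInf σ|) with hT
  have hle : ∀ k : ℕ, |S.diagCoeff σ (k + 1) - S.aInf σ| + |S.offCoeff σ (k + 1) - S.bInf σ|
      ≤ T * (1 + ε)⁻¹ ^ (k + 1) := by
    intro k
    have h1 := hs.le_tsum k (fun j _ => by positivity)
    rw [inv_pow, ← div_eq_mul_inv, le_div_iff₀ (by positivity), mul_comm]
    exact h1
  have hT0 : 0 ≤ T := tsum_nonneg fun k => by positivity
  have hr0 : 0 < (1 + ε)⁻¹ := by positivity
  have hr1 : (1 + ε)⁻¹ < 1 := inv_lt_one_of_one_lt₀ (by linarith)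
  set r := (1 + ε)⁻¹
  have hpow : ∀ k, √r ^ (2 * k) = r ^ k := fun k => by rw [pow_mul, Real.sq_sqrt hr0.le]
  have hrk : ∀ k, T * r ^ (k + 1) ≤ T * r ^ k := fun k => by
    gcongr T * ?_
    exact pow_le_pow_of_le_one hr0.le hr1.le (Nat.le_succ k)
  have hoff : ∀ k, |S.offCoeff σ k - S.bInf σ| ≤ (T + |S.offCoeff σ 0 - S.bInf σ|) * r ^ k := by
    intro k
    have h0 := abs_nonneg (S.offCoeff σ 0 - S.bInf σ)
    cases k with
    | zero => simp; linarith
    | succ k =>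
      have := hle k
      have h2 := abs_nonneg (S.diagCoeff σ (k + 1) - S.aInf σ)
      have h3 : 0 ≤ |S.offCoeff σ 0 - S.bInf σ| * r ^ (k + 1) := by positivity
      rw [add_mul]; linarith
  have hlim : Tendsto (fun k => S.offCoeff σ k) atTop (𝓝 (S.bInf σ)) := by
    rw [tendsto_iff_norm_sub_tendsto_zero]
    refine squeeze_zero (fun _ => norm_nonneg _) hoff ?_
    simpa using (tendsto_pow_atTop_nhds_zero_of_lt_one hr0.le hr1).const_mul
      (T + |S.offCoeff σ 0 - S.bInf σ|)
  obtain ⟨β, hβ⟩ := (hlim.inv₀ (S.bInf_pos σ).ne').bddAbove_range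
  refine ⟨T + |S.offCoeff σ 0 - S.bInf σ|, √r, β, by positivity, Real.sqrt_pos.2 hr0,
    by rw [Real.sqrt_lt' one_pos]; simpa using hr1, ?_, fun k => by rw [hpow]; exact hoff k,
    fun k => ?_, fun k => hβ ⟨k, rfl⟩⟩
  · exact (inv_nonneg.2 (S.offCoeff_pos σ 0).le).trans (hβ ⟨0, rfl⟩)
  · rw [hpow, add_mul]
    have := hle k
    have h2 := abs_nonneg (S.offCoeff σ (k + 1) - S.bInf σ)
    have h3 : 0 ≤ |S.offCoeff σ 0 - S.bInf σ| * r ^ k := by positivity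
    linarith [hrk k]

theorem tendsto_offCoeff (σ : C) : Tendsto (fun k => S.offCoeff σ k) atTop (𝓝 (S.bInf σ)) := by
  obtain ⟨c, ρ, β, hc, h0, h1, -, h, -⟩ := S.coeff_bounds σ
  rw [tendsto_iff_norm_sub_tendsto_zero]
  refine squeeze_zero (fun _ => norm_nonneg _) h ?_
  have := (tendsto_pow_atTop_nhds_zero_of_lt_one (sq_nonneg ρ)
    (by nlinarith : ρ ^ 2 < 1)).const_mul c
  simpa [pow_mul] using this

/-- Solutions of the channel equation that coincide with `θ ^ k` at `k = M, M + 1` are close to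
`θ ^ k` for all `k ≤ M`, uniformly in `M` and `θ`. -/
theorem exists_chanSol_bound (σ : C) : ∃ c ρ : ℝ, 0 ≤ c ∧ 0 < ρ ∧ ρ < 1 ∧
    ∀ θ : ℂ, θ ≠ 0 → ‖θ‖ ≤ 1 → ∀ (M : ℕ) (x : ℕ → ℂ), S.IsChanSol σ (S.chanLam σ θ) x →
      x M = θ ^ M → x (M + 1) = θ ^ (M + 1) → ∀ k ≤ M, ‖x k - θ ^ k‖ ≤ c * ρ ^ k * ‖θ‖ ^ k := by
  obtain ⟨c, ρ, β, hc, hρ0, hρ1, hβ, hoff, hdiag, hinv⟩ := S.coeff_bounds σ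
  set c₁ : ℝ := 3 * c + β + 3 * c * β with hc₁
  have hc₁0 : 0 ≤ c₁ := by positivity
  have hρ' : 0 < 1 - ρ := by linarith
  -- `c₂` is the fixed point of c ↦ cρ + c₁, so that the exponents add up exactly in the backward
  -- induction; `c₃` plays the same role for the sum of the differences.
  set c₂ : ℝ := c₁ / (1 - ρ) with hc₂
  have hc₂0 : 0 ≤ c₂ := by positivity
  have hc₂' : c₂ * ρ + c₁ = c₂ := by rw [hc₂]; field_simp; ring
  set F := Real.exp c₂ with hF
  set c₃ : ℝ := β * F / (1 - ρ) with hc₃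
  have hc₃' : c₃ * ρ + β * F = c₃ := by rw [hc₃]; field_simp; ring
  refine ⟨c₃, ρ, by positivity, hρ0, hρ1, fun θ hθ hθ1 M x hx hM hM1 => ?_⟩
  have hθn : 0 < ‖θ‖ := norm_pos_iff.2 hθ
  -- In terms of the ratio `f`, the weighted difference `d` obeys a backward recursion with factor
  -- `θ ^ 2`, of modulus at most one, and a summable perturbation `V` built from the deviations of
  -- the coefficients. This is why the estimate is uniform up to the unit circle.
  set f : ℕ → ℂ := fun k => x k / θ ^ k with hf
  have hxf : ∀ k, x k = f k * θ ^ k := fun k => by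
    simp only [hf]; field_simp
  set d : ℕ → ℂ := fun k => S.offCoeff σ k * (f k - f (k + 1)) with hd
  have hfM : f M = 1 := by simp [hf, hM, hθ]
  have hfM1 : f (M + 1) = 1 := by simp [hf, hM1, hθ]
  have hdM : d M = 0 := by simp [hd, hfM, hfM1]
  set V : ℕ → ℂ := fun k => θ * ((S.diagCoeff σ (k + 1) - S.aInf σ : ℝ) : ℂ)
    - θ ^ 2 * ((S.offCoeff σ (k + 1) - S.bInf σ : ℝ) : ℂ)
    - ((S.offCoeff σ k - S.bInf σ : ℝ) : ℂ) with hV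
  have hrec : ∀ k, d k = θ ^ 2 * d (k + 1) + V k * f (k + 1) := by
    intro k
    have h := hx k
    rw [hxf k, hxf (k + 1), hxf (k + 2), chanLam] at h
    have h2 : θ * θ⁻¹ = 1 := mul_inv_cancel₀ hθ
    refine mul_left_cancel₀ (pow_ne_zero k hθ) ?_
    simp only [hd, hV]
    push_cast
    linear_combination (-1 : ℂ) * h + (S.bInf σ : ℂ) * θ ^ k * f (k + 1) * h2
  have hVn : ∀ k, ‖V k‖ ≤ 3 * c * ρ ^ (2 * k) := by
    intro k
    have h1 := hoff k
    have h2 : |S.offCoeff σ (k + 1) - S.bInf σ| ≤ c * ρ ^ (2 * k) := (hoff (k + 1)).trans (by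
      gcongr c * ?_
      exact pow_le_pow_of_le_one hρ0.le hρ1.le (by omega))
    have h3 := hdiag k
    have e1 : ‖θ * ((S.diagCoeff σ (k + 1) - S.aInf σ : ℝ) : ℂ)‖ ≤ c * ρ ^ (2 * k) := by
      rw [norm_mul, Complex.norm_real, Real.norm_eq_abs]
      exact (mul_le_of_le_one_left (abs_nonneg _) hθ1).trans h3
    have e2 : ‖θ ^ 2 * ((S.offCoeff σ (k + 1) - S.bInf σ : ℝ) : ℂ)‖ ≤ c * ρ ^ (2 * k) := by
      rw [norm_mul, Complex.norm_real, Real.norm_eq_abs, norm_pow]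
      exact (mul_le_of_le_one_left (abs_nonneg _) (pow_le_one₀ (norm_nonneg _) hθ1)).trans h2
    have e3 : ‖((S.offCoeff σ k - S.bInf σ : ℝ) : ℂ)‖ ≤ c * ρ ^ (2 * k) := by
      rw [Complex.norm_real, Real.norm_eq_abs]; exact h1
    calc ‖V k‖ ≤ _ := (norm_sub_le _ _).trans (add_le_add_left (norm_sub_le _ _) _)
      _ ≤ _ := by linarith
  have hstep : ∀ k, ‖f k - f (k + 1)‖ ≤ β * ‖d k‖ := by
    intro k
    have : f k - f (k + 1) = ((S.offCoeff σ k)⁻¹ : ℝ) * d k := by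
      simp only [hd]; push_cast
      have := S.offCoeff_ne_zero σ k
      field_simp
    rw [this, norm_mul, Complex.norm_real, Real.norm_eq_abs,
      abs_of_pos (inv_pos.2 (S.offCoeff_pos σ k))]
    gcongr
    exact hinv k
  have hdn : ∀ k, ‖d k‖ ≤ ‖d (k + 1)‖ + 3 * c * ρ ^ (2 * k) * ‖f (k + 1)‖ := by
    intro k
    rw [hrec k]
    refine (norm_add_le _ _).trans (add_le_add ?_ ?_)
    · rw [norm_mul, norm_pow]
      exact mul_le_of_le_one_left (norm_nonneg _) (pow_le_one₀ (norm_nonneg _) hθ1)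
    · rw [norm_mul]; gcongr; exact hVn k
  -- the Gronwall estimate
  have hN : ∀ k ≤ M, ‖f k‖ + ‖d k‖ / ρ ^ k ≤ Real.exp (c₂ * ρ ^ k) := by
    intro k hk
    induction hk using Nat.decreasingInduction with
    | self =>
      rw [hfM, hdM]; simp; positivity
    | of_succ k hk ih =>
      set u := ‖f (k + 1)‖
      set w := ‖d (k + 1)‖ / ρ ^ (k + 1) with hw
      have hw' : ‖d (k + 1)‖ = ρ ^ (k + 1) * w := by rw [hw]; field_simp
      have hu0 : 0 ≤ u := norm_nonneg _
      have hw0 : 0 ≤ w := by positivity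
      have hpk : 0 < ρ ^ k := by positivity
      have hpk1 : ρ ^ k ≤ 1 := pow_le_one₀ hρ0.le hρ1.le
      have h1 : ‖d k‖ ≤ ρ ^ k * (ρ * w + 3 * c * ρ ^ k * u) := by
        refine (hdn k).trans (le_of_eq ?_)
        rw [hw']; ring
      have h2 : ‖f k‖ ≤ u + β * (ρ ^ k * (ρ * w + 3 * c * ρ ^ k * u)) := by
        have : ‖f k‖ ≤ u + ‖f k - f (k + 1)‖ := by
          calc ‖f k‖ = ‖f (k + 1) + (f k - f (k + 1))‖ := by congr 1; ring
            _ ≤ _ := norm_add_le _ _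
        refine this.trans ?_
        gcongr
        exact (hstep k).trans (by gcongr)
      have h3 : ‖d k‖ / ρ ^ k ≤ ρ * w + 3 * c * ρ ^ k * u := by
        rw [div_le_iff₀ hpk, mul_comm]; exact h1
      have h4 : ‖f k‖ + ‖d k‖ / ρ ^ k ≤ (1 + c₁ * ρ ^ k) * (u + w) := by
        have a1 : ρ * w ≤ w := mul_le_of_le_one_left hw0 hρ1.le
        have a2 : 3 * c * ρ ^ k * u ≤ 3 * c * u := by
          rw [mul_right_comm]; exact mul_le_of_le_one_right (by positivity) hpk1
        have a3 : β * (ρ ^ k * (ρ * w + 3 * c * ρ ^ k * u)) ≤ β * (ρ ^ k * (w + 3 * c * u)) := by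
          gcongr
        have a4 : 0 ≤ (3 * c + 3 * c * β) * ρ ^ k * w := by positivity
        have a5 : 0 ≤ β * ρ ^ k * u := by positivity
        rw [hc₁]
        nlinarith
      calc ‖f k‖ + ‖d k‖ / ρ ^ k ≤ (1 + c₁ * ρ ^ k) * (u + w) := h4
        _ ≤ Real.exp (c₁ * ρ ^ k) * Real.exp (c₂ * ρ ^ (k + 1)) := by
            gcongr
            rw [add_comm]; exact Real.add_one_le_exp _
        _ = Real.exp (c₂ * ρ ^ k) := by
            rw [← Real.exp_add]; congr 1
            rw [pow_succ]; linear_combination ρ ^ k * hc₂'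
  have hd' : ∀ k ≤ M, ‖f k - f (k + 1)‖ ≤ β * F * ρ ^ k := by
    intro k hk
    have h1 := hN k hk
    have h2 : ‖d k‖ / ρ ^ k ≤ F := by
      have : Real.exp (c₂ * ρ ^ k) ≤ F := Real.exp_le_exp.2
        (mul_le_of_le_one_right hc₂0 (pow_le_one₀ hρ0.le hρ1.le))
      linarith [norm_nonneg (f k)]
    rw [div_le_iff₀ (by positivity)] at h2
    refine (hstep k).trans ?_
    rw [mul_assoc]; gcongr
  have hfin : ∀ k ≤ M, ‖f k - 1‖ ≤ c₃ * ρ ^ k := by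
    intro k hk
    induction hk using Nat.decreasingInduction with
    | self => rw [hfM]; simp; positivity
    | of_succ k hk ih =>
      calc ‖f k - 1‖ = ‖(f k - f (k + 1)) + (f (k + 1) - 1)‖ := by congr 1; ring
        _ ≤ β * F * ρ ^ k + c₃ * ρ ^ (k + 1) :=
          (norm_add_le _ _).trans (add_le_add (hd' k hk.le) ih)
        _ = c₃ * ρ ^ k := by rw [pow_succ]; linear_combination ρ ^ k * hc₃'
  intro k hk
  have : x k - θ ^ k = (f k - 1) * θ ^ k := by rw [hxf]; ring
  rw [this, norm_mul, norm_pow]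
  gcongr
  exact hfin k hk

theorem exists_tendsto_of_bounded {ι : Type*} (U : Ultrafilter ι) (f : ι → ℂ) (c : ℝ)
    (h : ∀ᶠ i in (U : Filter ι), ‖f i‖ ≤ c) : ∃ l, Tendsto f U (𝓝 l) := by
  obtain ⟨l, -, hl⟩ := (isCompact_closedBall (0 : ℂ) c).ultrafilter_le_nhds (U.map f) (by
    rw [le_principal_iff]
    change ∀ᶠ i in (U : Filter ι), f i ∈ closedBall 0 c
    filter_upwards [h] with i hi
    simpa using hi)
  exact ⟨l, hl⟩

variable {S}

theorem tendsto_div_pow {c ρ : ℝ} (hρ0 : 0 < ρ) (hρ1 : ρ < 1) {θ : ℂ} (hθ : θ ≠ 0) {x : ℕ → ℂ}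
    (h : ∀ k, ‖x k - θ ^ k‖ ≤ c * ρ ^ k * ‖θ‖ ^ k) :
    Tendsto (fun k => x k / θ ^ k) atTop (𝓝 1) := by
  rw [tendsto_iff_norm_sub_tendsto_zero]
  refine squeeze_zero (fun _ => norm_nonneg _) (g := fun k => c * ρ ^ k) (fun k => ?_) ?_
  · have h1 : x k / θ ^ k - 1 = (x k - θ ^ k) / θ ^ k := by field_simp
    rw [h1, norm_div, norm_pow, div_le_iff₀ (pow_pos (norm_pos_iff.2 hθ) k)]
    exact h k
  · simpa using (tendsto_pow_atTop_nhds_zero_of_lt_one hρ0.le hρ1).const_mul c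

theorem IsJost.isChanSol {σ : C} {θ : ℂ} {x : ℕ → ℂ} (h : S.IsJost σ θ x) :
    S.IsChanSol σ (S.chanLam σ θ) x := h.1

/-- The Wronskian of two sequences at `k`, for the channel `σ`. -/
def wronskian (S : WebSystem A C) (σ : C) (x y : ℕ → ℂ) (k : ℕ) : ℂ :=
  S.offCoeff σ k * (x (k + 1) * y k - x k * y (k + 1))

theorem wronskian_succ {σ : C} {μ μ' : ℂ} {x y : ℕ → ℂ} (hx : S.IsChanSol σ μ x)
    (hy : S.IsChanSol σ μ' y) (k : ℕ) : S.wronskian σ x y (k + 1) =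
      S.wronskian σ x y k - (μ - μ') * (x (k + 1) * y (k + 1)) := by
  simp only [wronskian]
  linear_combination (-y (k + 1)) * hx k + x (k + 1) * hy k

theorem wronskian_const {σ : C} {μ : ℂ} {x y : ℕ → ℂ} (hx : S.IsChanSol σ μ x)
    (hy : S.IsChanSol σ μ y) (k : ℕ) : S.wronskian σ x y k = S.wronskian σ x y 0 := by
  induction k with
  | zero => rfl
  | succ k ih => rw [wronskian_succ hx hy, ih]; ring

/-- The Wronskian is constant and equals `θ ^ (2k + 1)` times a null sequence, so it vanishes, even
for ‖θ‖ = 1 where nothing decays. Then `y / x` is constant on a tail, and its limit is 1. -/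
theorem IsJost.unique {σ : C} {θ : ℂ} (hθ : θ ≠ 0) (hθ1 : ‖θ‖ ≤ 1) {x y : ℕ → ℂ}
    (hx : S.IsJost σ θ x) (hy : S.IsJost σ θ y) : x = y := by
  have hW : ∀ k, S.wronskian σ x y k = 0 := by
    have hc := wronskian_const hx.isChanSol hy.isChanSol
    have hf : Tendsto (fun k => (S.offCoeff σ k : ℂ) * (x (k + 1) / θ ^ (k + 1) * (y k / θ ^ k)
        - x k / θ ^ k * (y (k + 1) / θ ^ (k + 1)))) atTop (𝓝 0) := by
      have h1 := (Complex.continuous_ofReal.tendsto _).comp (S.tendsto_offCoeff σ)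
      have := h1.mul (((hx.2.comp (tendsto_add_atTop_nat 1)).mul hy.2).sub
        (hx.2.mul (hy.2.comp (tendsto_add_atTop_nat 1))))
      simpa using this
    have h0 : S.wronskian σ x y 0 = 0 := by
      refine tendsto_nhds_unique (f := fun k => S.wronskian σ x y k) (l := atTop)
        (by simp only [hc]; exact tendsto_const_nhds) ?_
      rw [tendsto_zero_iff_norm_tendsto_zero] at hf ⊢
      refine squeeze_zero (fun _ => norm_nonneg _) (fun k => ?_) hf
      have : S.wronskian σ x y k = θ ^ (k + 1) * θ ^ k * ((S.offCoeff σ k : ℂ) *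
          (x (k + 1) / θ ^ (k + 1) * (y k / θ ^ k)
            - x k / θ ^ k * (y (k + 1) / θ ^ (k + 1)))) := by
        simp only [wronskian]; field_simp
      rw [this, norm_mul _ (_ * _), norm_mul (θ ^ (k + 1)), norm_pow, norm_pow]
      exact mul_le_of_le_one_left (norm_nonneg _) (mul_le_one₀ (pow_le_one₀ (norm_nonneg _) hθ1)
        (by positivity) (pow_le_one₀ (norm_nonneg _) hθ1))
    exact fun k => (hc k).trans h0
  have hrat : Tendsto (fun k => y k / x k) atTop (𝓝 1) := by
    have := hy.2.div hx.2 one_ne_zero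
    rw [div_one] at this
    refine this.congr fun k => ?_
    simp only [Pi.div_apply]
    have := pow_ne_zero k hθ
    by_cases h : x k = 0
    · simp [h]
    · field_simp
  have hne : ∀ᶠ k in atTop, x k ≠ 0 := by
    filter_upwards [hx.2.eventually_ne one_ne_zero] with k hk h
    simp [h] at hk
  obtain ⟨N, hN⟩ := eventually_atTop.1 hne
  have hr : ∀ n, y (N + n) / x (N + n) = y N / x N := by
    intro n
    induction n with
    | zero => rfl
    | succ n ih =>
      rw [← ih]
      have h1 := hN (N + n) (by omega)
      have h2 := hN (N + n + 1) (by omega)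
      have h3 := (mul_eq_zero.1 (hW (N + n))).resolve_left (S.offCoeff_ne_zero _ _)
      rw [← add_assoc, div_eq_div_iff h2 h1]
      linear_combination -h3
  have hlim : y N / x N = 1 := by
    refine tendsto_nhds_unique (f := fun n => y (N + n) / x (N + n)) (l := atTop)
      (by simp only [hr]; exact tendsto_const_nhds) ?_
    have := hrat.comp (tendsto_add_atTop_nat N)
    refine this.congr fun n => ?_
    simp [add_comm]
  have h1 : ∀ n, x (N + n) = y (N + n) := fun n => by
    have := hr n
    rw [hlim, div_eq_one_iff_eq (hN _ (by omega))] at this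
    exact this.symm
  exact hx.isChanSol.ext_two hy.isChanSol (h1 0) (h1 1)

variable (S)

/-- Existence of the Jost solution, with an exponential estimate that is uniform in `θ`. -/
theorem exists_isJost_bound (σ : C) : ∃ c ρ : ℝ, 0 ≤ c ∧ 0 < ρ ∧ ρ < 1 ∧
    ∀ θ : ℂ, θ ≠ 0 → ‖θ‖ ≤ 1 → S.IsJost σ θ (S.jost σ θ) ∧
      ∀ k, ‖S.jost σ θ k - θ ^ k‖ ≤ c * ρ ^ k * ‖θ‖ ^ k := by
  obtain ⟨c, ρ, hc, hρ0, hρ1, H⟩ := S.exists_chanSol_bound σ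
  refine ⟨c, ρ, hc, hρ0, hρ1, fun θ hθ hθ1 => ?_⟩
  choose x hx hxM hxM1 using fun M : ℕ =>
    exists_chanSol (S := S) σ (S.chanLam σ θ) M (θ ^ M) (θ ^ (M + 1))
  -- The Jost solution is the limit, along a nonprincipal ultrafilter in `M`, of the solutions that
  -- agree with θ^k at M and M + 1. The bound at `k` holds as soon as M ≥ k.
  have hev : ∀ k, ∀ᶠ M in (hyperfilter ℕ : Filter ℕ), ‖x M k - θ ^ k‖ ≤ c * ρ ^ k * ‖θ‖ ^ k := by
    intro k
    have : ∀ᶠ M in (hyperfilter ℕ : Filter ℕ), k ≤ M :=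
      (Nat.cofinite_eq_atTop ▸ hyperfilter_le_cofinite (α := ℕ)) (eventually_ge_atTop k)
    filter_upwards [this] with M hM using H θ hθ hθ1 M _ (hx M) (hxM M) (hxM1 M) k hM
  have hlim : ∀ k, ∃ l, Tendsto (fun M => x M k) (hyperfilter ℕ) (𝓝 l) := fun k => by
    refine exists_tendsto_of_bounded _ _ (c * ρ ^ k * ‖θ‖ ^ k + ‖θ ^ k‖) ?_
    filter_upwards [hev k] with M hM
    calc ‖x M k‖ = ‖(x M k - θ ^ k) + θ ^ k‖ := by congr 1; ring
      _ ≤ _ := (norm_add_le _ _).trans (by gcongr)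
  choose y hy using hlim
  have hyb : ∀ k, ‖y k - θ ^ k‖ ≤ c * ρ ^ k * ‖θ‖ ^ k := fun k =>
    le_of_tendsto ((hy k).sub_const _).norm (hev k)
  have hyJ : S.IsJost σ θ y :=
    ⟨IsChanSol.tendsto (l := (hyperfilter ℕ : Filter ℕ)) (.of_forall hx) tendsto_const_nhds hy,
      tendsto_div_pow hρ0 hρ1 hθ hyb⟩
  have hJ : S.IsJost σ θ (S.jost σ θ) := Classical.epsilon_spec ⟨y, hyJ⟩
  exact ⟨hJ, IsJost.unique hθ hθ1 hyJ hJ ▸ hyb⟩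

variable {S}

theorem jost_isJost (σ : C) {θ : ℂ} (hθ : θ ≠ 0) (hθ1 : ‖θ‖ ≤ 1) : S.IsJost σ θ (S.jost σ θ) := by
  obtain ⟨c, ρ, -, -, -, h⟩ := S.exists_isJost_bound σ
  exact (h θ hθ hθ1).1

theorem jost_isChanSol (σ : C) {θ : ℂ} (hθ : θ ≠ 0) (hθ1 : ‖θ‖ ≤ 1) :
    S.IsChanSol σ (S.chanLam σ θ) (S.jost σ θ) := (jost_isJost σ hθ hθ1).1

theorem jost_conj (σ : C) {θ : ℂ} (hθ : θ ≠ 0) (hθ1 : ‖θ‖ ≤ 1) (k : ℕ) :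
    starRingEnd ℂ (S.jost σ θ k) = S.jost σ (starRingEnd ℂ θ) k := by
  have h := jost_isJost (S := S) σ hθ hθ1
  have h1 : S.IsJost σ (starRingEnd ℂ θ) fun k => starRingEnd ℂ (S.jost σ θ k) := by
    refine ⟨?_, ?_⟩
    · have := h.isChanSol.conj
      have e : starRingEnd ℂ (S.chanLam σ θ) = S.chanLam σ (starRingEnd ℂ θ) := by simp [chanLam]
      rw [e] at this
      exact this
    · have := (Complex.continuous_conj.tendsto _).comp h.2
      simpa [Function.comp_def] using this
  exact congrFun (IsJost.unique (by simpa using hθ) (by simpa using hθ1) h1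
    (jost_isJost σ (by simpa using hθ) (by simpa using hθ1))) k

/-- The Jost solutions depend continuously on `θ` in the closed unit disc without the origin. -/
theorem tendsto_jost {ι : Type*} {l : Filter ι} (σ : C) {θ : ι → ℂ} {θ₀ : ℂ} (hθ₀ : θ₀ ≠ 0)
    (hθ₀1 : ‖θ₀‖ ≤ 1) (hθ : ∀ᶠ i in l, θ i ≠ 0 ∧ ‖θ i‖ ≤ 1) (h : Tendsto θ l (𝓝 θ₀)) (k : ℕ) :
    Tendsto (fun i => S.jost σ (θ i) k) l (𝓝 (S.jost σ θ₀ k)) := by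
  obtain ⟨c, ρ, hc, hρ0, hρ1, H⟩ := S.exists_isJost_bound σ
  -- Along an ultrafilter every coordinate converges by boundedness. The limit inherits the
  -- estimate, hence is a Jost solution at `θ₀`, and uniqueness identifies it.
  rw [tendsto_iff_ultrafilter]
  intro U hU
  have hθU : ∀ᶠ i in (U : Filter ι), θ i ≠ 0 ∧ ‖θ i‖ ≤ 1 := hU hθ
  have hU' : Tendsto θ U (𝓝 θ₀) := h.mono_left hU
  have hlim : ∀ k, ∃ l, Tendsto (fun i => S.jost σ (θ i) k) U (𝓝 l) := fun k => by
    refine exists_tendsto_of_bounded _ _ (c * ρ ^ k + 1) ?_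
    filter_upwards [hθU] with i hi
    have h1 := (H _ hi.1 hi.2).2 k
    have h2 : ‖θ i‖ ^ k ≤ 1 := pow_le_one₀ (norm_nonneg _) hi.2
    calc ‖S.jost σ (θ i) k‖ = ‖(S.jost σ (θ i) k - θ i ^ k) + θ i ^ k‖ := by congr 1; ring
      _ ≤ c * ρ ^ k * ‖θ i‖ ^ k + ‖θ i‖ ^ k := (norm_add_le _ _).trans (by
          rw [norm_pow]; gcongr)
      _ ≤ _ := add_le_add (mul_le_of_le_one_right (by positivity) h2) h2
  choose y hy using hlim
  have hyb : ∀ k, ‖y k - θ₀ ^ k‖ ≤ c * ρ ^ k * ‖θ₀‖ ^ k := fun k => by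
    refine le_of_tendsto_of_tendsto ((hy k).sub (hU'.pow k)).norm
      ((hU'.norm.pow k).const_mul (c * ρ ^ k)) ?_
    filter_upwards [hθU] with i hi using (H _ hi.1 hi.2).2 k
  have hyJ : S.IsJost σ θ₀ y := by
    refine ⟨IsChanSol.tendsto (l := (U : Filter ι)) (hθU.mono fun i hi => jost_isChanSol σ hi.1 hi.2)
      ?_ hy, tendsto_div_pow hρ0 hρ1 hθ₀ hyb⟩
    exact ((hU'.add (hU'.inv₀ hθ₀)).const_mul _).const_sub _
  rw [← IsJost.unique hθ₀ hθ₀1 hyJ (jost_isJost σ hθ₀ hθ₀1)]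
  exact hy k

end

/-! ### The functions λ and θ_σ on the closed disc. -/

section

variable {A C : Type*} (S : WebSystem A C)

theorem b_pos : 0 < S.b := by
  obtain ⟨x, hx⟩ := S.connected.nonempty
  obtain ⟨σ, hx⟩ := Set.mem_iUnion.1 hx
  have h1 : ∀ y ∈ Set.Icc (S.aInf σ - 2 * S.bInf σ) (S.aInf σ + 2 * S.bInf σ),
      y ∈ Set.Icc (S.a - 2 * S.b) (S.a + 2 * S.b) := fun y hy => by
    rw [← S.union_eq]; exact Set.mem_iUnion.2 ⟨σ, hy⟩
  have hb := S.bInf_pos σ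
  have h2 := h1 (S.aInf σ - 2 * S.bInf σ) ⟨le_rfl, by linarith⟩
  have h3 := h1 (S.aInf σ + 2 * S.bInf σ) ⟨by linarith, le_rfl⟩
  linarith [h2.1, h3.2]

theorem band_subset (σ : C) : S.a - 2 * S.b ≤ S.aInf σ - 2 * S.bInf σ ∧
    S.aInf σ + 2 * S.bInf σ ≤ S.a + 2 * S.b := by
  have h1 : ∀ y ∈ Set.Icc (S.aInf σ - 2 * S.bInf σ) (S.aInf σ + 2 * S.bInf σ),
      y ∈ Set.Icc (S.a - 2 * S.b) (S.a + 2 * S.b) := fun y hy => by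
    rw [← S.union_eq]; exact Set.mem_iUnion.2 ⟨σ, hy⟩
  have hb := S.bInf_pos σ
  exact ⟨(h1 _ ⟨le_rfl, by linarith⟩).1, (h1 _ ⟨by linarith, le_rfl⟩).2⟩

theorem add_inv_im (ω : ℂ) : (ω + ω⁻¹).im = ω.im * (1 - (‖ω‖ ^ 2)⁻¹) := by
  rw [Complex.add_im, Complex.inv_im, Complex.normSq_eq_norm_sq]
  ring

theorem lam_im (ω : ℂ) : (S.lam ω).im = -(S.b * (ω.im * (1 - (‖ω‖ ^ 2)⁻¹))) := by
  rw [lam, ← add_inv_im]; simp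

theorem chanLam_im (σ : C) (θ : ℂ) :
    (S.chanLam σ θ).im = -(S.bInf σ * (θ.im * (1 - (‖θ‖ ^ 2)⁻¹))) := by
  rw [chanLam, ← add_inv_im]; simp

theorem one_sub_inv_norm_sq_nonpos {θ : ℂ} (hθ : θ ≠ 0) (hθ1 : ‖θ‖ ≤ 1) :
    1 - (‖θ‖ ^ 2)⁻¹ ≤ 0 := by
  have h := norm_pos_iff.2 hθ
  have : 1 ≤ (‖θ‖ ^ 2)⁻¹ := (one_le_inv₀ (by positivity)).2 (pow_le_one₀ h.le hθ1)
  linarith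

theorem one_sub_inv_norm_sq_neg {θ : ℂ} (hθ : θ ≠ 0) (hθ1 : ‖θ‖ < 1) :
    1 - (‖θ‖ ^ 2)⁻¹ < 0 := by
  have h := norm_pos_iff.2 hθ
  have : 1 < (‖θ‖ ^ 2)⁻¹ := (one_lt_inv₀ (by positivity)).2 (pow_lt_one₀ h.le hθ1 two_ne_zero)
  linarith

theorem inv_eq_conj {θ : ℂ} (h : ‖θ‖ = 1) : θ⁻¹ = starRingEnd ℂ θ := by
  rw [Complex.inv_def, Complex.normSq_eq_norm_sq, h]; simp

theorem exists_add_inv_eq (c : ℂ) : ∃ θ : ℂ, θ ≠ 0 ∧ ‖θ‖ ≤ 1 ∧ θ + θ⁻¹ = c := by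
  obtain ⟨s, hs⟩ := IsAlgClosed.exists_pow_nat_eq (c ^ 2 - 4) (n := 2) two_pos
  have hmul : (c + s) / 2 * ((c - s) / 2) = 1 := by linear_combination -hs / 4
  have h1 := left_ne_zero_of_mul_eq_one hmul
  have h2 := right_ne_zero_of_mul_eq_one hmul
  have hinv := eq_inv_of_mul_eq_one_right hmul
  rcases le_total ‖(c + s) / 2‖ 1 with h | h
  · exact ⟨_, h1, h, by rw [← hinv]; ring⟩
  · refine ⟨_, h2, ?_, ?_⟩
    · rw [hinv, norm_inv]; exact inv_le_one_of_one_le₀ h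
    · rw [hinv, inv_inv, ← hinv]; ring

variable {S}

/-- If the root in the closed disc violates the sign condition, comparing the imaginary parts of
λ_σ(θ) and λ(ω) forces ‖θ‖ = 1. Then the other root `θ⁻¹` is the conjugate of `θ` and has the right
sign. -/
theorem exists_isTheta (σ : C) {ω : ℂ} (h0 : ω ≠ 0) (h1 : ‖ω‖ ≤ 1) : ∃ θ, S.IsTheta σ ω θ := by
  have hb : (S.bInf σ : ℂ) ≠ 0 := Complex.ofReal_ne_zero.2 (S.bInf_pos σ).ne'
  obtain ⟨θ, hθ, hθ1, hc⟩ := exists_add_inv_eq ((S.aInf σ - S.lam ω) / S.bInf σ)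
  have hlam : S.chanLam σ θ = S.lam ω := by
    rw [chanLam, hc]; field_simp; ring
  by_cases hs : 0 ≤ θ.im * ω.im
  · exact ⟨θ, hθ, hθ1, hlam, hs⟩
  push Not at hs
  have him := congrArg Complex.im hlam
  rw [chanLam_im, lam_im] at him
  have hn := one_sub_inv_norm_sq_nonpos hθ hθ1
  have hnω := one_sub_inv_norm_sq_nonpos h0 h1
  have hθn : 1 - (‖θ‖ ^ 2)⁻¹ = 0 := by
    by_contra hne
    have hlt := lt_of_le_of_ne hn hne
    have e1 : S.bInf σ * ((θ.im * ω.im) * (1 - (‖θ‖ ^ 2)⁻¹)) =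
        S.b * (ω.im ^ 2 * (1 - (‖ω‖ ^ 2)⁻¹)) := by linear_combination (-ω.im) * him
    have e2 : 0 < S.bInf σ * ((θ.im * ω.im) * (1 - (‖θ‖ ^ 2)⁻¹)) :=
      mul_pos (S.bInf_pos σ) (mul_pos_of_neg_of_neg hs hlt)
    have e3 : S.b * (ω.im ^ 2 * (1 - (‖ω‖ ^ 2)⁻¹)) ≤ 0 :=
      mul_nonpos_of_nonneg_of_nonpos S.b_pos.le
        (mul_nonpos_of_nonneg_of_nonpos (sq_nonneg _) hnω)
    linarith
  have hnorm : ‖θ‖ = 1 := by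
    have : ‖θ‖ ^ 2 = 1 := by rw [← inv_inv (‖θ‖ ^ 2), show (‖θ‖ ^ 2)⁻¹ = 1 by linarith, inv_one]
    exact (pow_eq_one_iff_of_nonneg (norm_nonneg θ) two_ne_zero).1 this
  refine ⟨θ⁻¹, inv_ne_zero hθ, by simp [hnorm], ?_, ?_⟩
  · rw [← hlam, chanLam, chanLam, inv_inv, add_comm θ]
  · rw [inv_eq_conj hnorm, Complex.conj_im]; linarith

theorem theta_spec (σ : C) {ω : ℂ} (h0 : ω ≠ 0) (h1 : ‖ω‖ ≤ 1) :
    S.IsTheta σ ω (S.theta σ ω) := Classical.epsilon_spec (exists_isTheta σ h0 h1)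

/-- ‖θ‖ = 1 would place λ(ω) in the band of `σ`, hence in [a - 2b, a + 2b], with `ω` real. But |ω +
ω⁻¹| > 2 for real ω with 0 < |ω| < 1. -/
theorem IsTheta.norm_lt {σ : C} {ω θ : ℂ} (h : S.IsTheta σ ω θ) (h0 : ω ≠ 0) (h1 : ‖ω‖ < 1) :
    ‖θ‖ < 1 := by
  refine lt_of_le_of_ne h.2.1 fun hn => ?_
  have hlam := h.2.2.1
  have him := congrArg Complex.im hlam
  rw [chanLam_im, lam_im, hn] at him
  have hω : ω.im = 0 := by
    have h2 : S.b * (ω.im * (1 - (‖ω‖ ^ 2)⁻¹)) = 0 := by simp at him ⊢; tauto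
    have h3 := (mul_eq_zero.1 h2).resolve_left S.b_pos.ne'
    exact (mul_eq_zero.1 h3).resolve_right (one_sub_inv_norm_sq_neg h0 h1).ne
  obtain ⟨x, rfl⟩ : ∃ x : ℝ, ω = x := ⟨ω.re, by apply Complex.ext <;> simp [hω]⟩
  rw [Complex.norm_real, Real.norm_eq_abs] at h1
  have hx0 : x ≠ 0 := by simpa using h0
  have hre := congrArg Complex.re hlam
  have hθre : |θ.re| ≤ 1 := hn ▸ Complex.abs_re_le_norm θ
  have e1 : (S.chanLam σ θ).re = S.aInf σ - 2 * S.bInf σ * θ.re := by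
    rw [chanLam, inv_eq_conj hn, Complex.add_conj, ← Complex.ofReal_mul, ← Complex.ofReal_sub,
      Complex.ofReal_re]; ring
  have e2 : (S.lam x).re = S.a - S.b * (x + x⁻¹) := by
    rw [lam, ← Complex.ofReal_inv, ← Complex.ofReal_add, ← Complex.ofReal_mul,
      ← Complex.ofReal_sub, Complex.ofReal_re]
  rw [e1, e2] at hre
  obtain ⟨hs1, hs2⟩ := S.band_subset σ
  have hb := S.b_pos
  have hbσ := S.bInf_pos σ
  obtain ⟨t1, t2⟩ := abs_le.1 hθre
  obtain ⟨x1, x2⟩ := abs_lt.1 h1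
  have u1 : x + x⁻¹ ≤ 2 := by
    have : S.b * (x + x⁻¹) ≤ S.b * 2 := by nlinarith
    exact le_of_mul_le_mul_left this hb
  have u2 : -2 ≤ x + x⁻¹ := by
    have : S.b * (-2) ≤ S.b * (x + x⁻¹) := by nlinarith
    exact le_of_mul_le_mul_left this hb
  rcases lt_or_gt_of_ne hx0 with hx | hx
  · have : x * x⁻¹ = 1 := mul_inv_cancel₀ hx0
    have h3 : x * (x + x⁻¹) ≤ x * (-2) := mul_le_mul_of_nonpos_left u2 hx.le
    nlinarith [sq_pos_of_pos (show 0 < x + 1 by linarith)]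
  · have : x * x⁻¹ = 1 := mul_inv_cancel₀ hx0
    have h3 : x * (x + x⁻¹) ≤ x * 2 := mul_le_mul_of_nonneg_left u1 hx.le
    nlinarith [sq_pos_of_pos (show 0 < 1 - x by linarith)]

theorem norm_lt_one_of_im_eq_zero {z : ℂ} (hz : ‖z‖ ≤ 1) (hz1 : z ≠ 1) (hz2 : z ≠ -1)
    (h : z.im = 0) : ‖z‖ < 1 := by
  obtain ⟨x, rfl⟩ : ∃ x : ℝ, z = x := ⟨z.re, by apply Complex.ext <;> simp [h]⟩
  rw [Complex.norm_real, Real.norm_eq_abs] at hz ⊢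
  refine lt_of_le_of_ne hz fun hx => ?_
  rcases eq_or_eq_neg_of_abs_eq hx with rfl | rfl
  · simp at hz1
  · simp at hz2

theorem eq_or_eq_inv_of_add_inv_eq {θ θ' : ℂ} (h0 : θ ≠ 0) (h0' : θ' ≠ 0)
    (h : θ + θ⁻¹ = θ' + θ'⁻¹) : θ' = θ ∨ θ' = θ⁻¹ := by
  have : (θ' - θ) * (θ' - θ⁻¹) = 0 := by
    have e1 := mul_inv_cancel₀ h0
    have e2 := mul_inv_cancel₀ h0'
    linear_combination (-θ') * h + e1 - e2
  rcases mul_eq_zero.1 this with h | h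
  · exact .inl (sub_eq_zero.1 h)
  · exact .inr (sub_eq_zero.1 h)

/-- The only other candidate is `θ⁻¹`. For real `z` the root lies strictly inside the disc, so its
inverse lies outside. For nonreal `z` both roots would be unimodular and conjugate, and the sign
condition makes them real, hence equal. -/
theorem IsTheta.unique {σ : C} {z θ θ' : ℂ} (hz : ‖z‖ ≤ 1) (hz0 : z ≠ 0) (hz1 : z ≠ 1)
    (hz2 : z ≠ -1) (h : S.IsTheta σ z θ) (h' : S.IsTheta σ z θ') : θ' = θ := by
  have hb : (S.bInf σ : ℂ) ≠ 0 := Complex.ofReal_ne_zero.2 (S.bInf_pos σ).ne'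
  have he : θ + θ⁻¹ = θ' + θ'⁻¹ := by
    have := h.2.2.1.trans h'.2.2.1.symm
    rw [chanLam, chanLam] at this
    exact mul_left_cancel₀ hb (sub_right_injective this)
  refine (eq_or_eq_inv_of_add_inv_eq h.1 h'.1 he).elim id fun hi => ?_
  by_cases him : z.im = 0
  · have hn := h.norm_lt hz0 (norm_lt_one_of_im_eq_zero hz hz1 hz2 him)
    have : 1 < ‖θ'‖ := by
      rw [hi, norm_inv]; exact (one_lt_inv₀ (norm_pos_iff.2 h.1)).2 hn
    exact absurd h'.2.1 this.not_ge
  · have hn : ‖θ‖ = 1 := by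
      refine le_antisymm h.2.1 ?_
      have := h'.2.1
      rw [hi, norm_inv] at this
      exact (inv_le_one₀ (norm_pos_iff.2 h.1)).1 this
    rw [inv_eq_conj hn] at hi
    have h1 := h.2.2.2
    have h2 := h'.2.2.2
    rw [hi, Complex.conj_im] at h2
    have h3 : θ.im * z.im = 0 := by linarith
    have h4 := (mul_eq_zero.1 h3).resolve_right him
    rw [hi]; exact Complex.conj_eq_iff_im.2 h4

theorem tendsto_lam {ι : Type*} {l : Filter ι} {ω : ι → ℂ} {z : ℂ} (hz0 : z ≠ 0)
    (h : Tendsto ω l (𝓝 z)) : Tendsto (fun i => S.lam (ω i)) l (𝓝 (S.lam z)) :=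
  ((h.add (h.inv₀ hz0)).const_mul _).const_sub _

/-- The conditions in `IsTheta` are closed, except for θ ≠ 0. The quadratic equation cleared of
denominators rules out the limit 0, and `IsTheta.unique` identifies every ultrafilter limit. -/
theorem tendsto_theta {ι : Type*} {l : Filter ι} (σ : C) {ω : ι → ℂ} {z : ℂ} (hz : ‖z‖ ≤ 1)
    (hz0 : z ≠ 0) (hz1 : z ≠ 1) (hz2 : z ≠ -1) (hω : ∀ᶠ i in l, ω i ≠ 0 ∧ ‖ω i‖ ≤ 1)
    (h : Tendsto ω l (𝓝 z)) : Tendsto (fun i => S.theta σ (ω i)) l (𝓝 (S.theta σ z)) := by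
  rw [tendsto_iff_ultrafilter]
  intro U hU
  have hωU : ∀ᶠ i in (U : Filter ι), ω i ≠ 0 ∧ ‖ω i‖ ≤ 1 := hU hω
  have hU' : Tendsto ω U (𝓝 z) := h.mono_left hU
  have hθ : ∀ᶠ i in (U : Filter ι), S.IsTheta σ (ω i) (S.theta σ (ω i)) :=
    hωU.mono fun i hi => theta_spec σ hi.1 hi.2
  obtain ⟨θ, hl⟩ := exists_tendsto_of_bounded U (fun i => S.theta σ (ω i)) 1
    (hθ.mono fun i hi => hi.2.1)
  have hb : (S.bInf σ : ℂ) ≠ 0 := Complex.ofReal_ne_zero.2 (S.bInf_pos σ).ne'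
  have hlam := tendsto_lam (S := S) hz0 hU'
  have heq : (S.aInf σ - S.lam z) * θ = S.bInf σ * (θ ^ 2 + 1) := by
    refine tendsto_nhds_unique_of_eventuallyEq ((hlam.const_sub _).mul hl)
      (((hl.pow 2).add_const 1).const_mul _) ?_
    filter_upwards [hθ] with i hi
    rw [← hi.2.2.1, chanLam]
    have := mul_inv_cancel₀ hi.1
    linear_combination (S.bInf σ : ℂ) * this
  have hθ0 : θ ≠ 0 := by
    rintro rfl
    simp at heq
    exact hb heq.symm
  have : S.IsTheta σ z θ := by
    refine ⟨hθ0, le_of_tendsto hl.norm (hθ.mono fun i hi => hi.2.1), ?_, ?_⟩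
    · rw [chanLam]
      refine mul_right_cancel₀ hθ0 ?_
      have := mul_inv_cancel₀ hθ0
      linear_combination heq - (S.bInf σ : ℂ) * this
    · exact ge_of_tendsto (((Complex.continuous_im.tendsto _).comp hl).mul
        ((Complex.continuous_im.tendsto _).comp hU')) (hθ.mono fun i hi => hi.2.2.2)
  rw [← IsTheta.unique hz hz0 hz1 hz2 (theta_spec σ hz0 hz) this] at *
  exact hl

variable (S)

theorem lam_sub {ω z : ℂ} (hω : ω ≠ 0) (hz : z ≠ 0) :
    S.lam ω - S.lam z = -(S.b * (1 - (ω * z)⁻¹)) * (ω - z) := by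
  rw [lam, lam]; field_simp; ring

/-- The derivative `λ'(z)`. -/
noncomputable def lamDeriv (z : ℂ) : ℂ := -(S.b * (1 - (z ^ 2)⁻¹))

theorem lamDeriv_ne_zero {z : ℂ} (hz1 : z ≠ 1) (hz2 : z ≠ -1) : S.lamDeriv z ≠ 0 := by
  rw [lamDeriv, neg_ne_zero]
  refine mul_ne_zero (Complex.ofReal_ne_zero.2 S.b_pos.ne') fun h => ?_
  have : z ^ 2 = 1 := by rw [← inv_inv (z ^ 2), ← sub_eq_zero.1 h, inv_one]
  rcases mul_eq_zero.1 (show (z - 1) * (z + 1) = 0 by linear_combination this) with h | h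
  · exact hz1 (sub_eq_zero.1 h)
  · exact hz2 (eq_neg_of_add_eq_zero_left h)

theorem tendsto_lam_slope {ι : Type*} {l : Filter ι} {ω : ι → ℂ} {z : ℂ} (hz0 : z ≠ 0)
    (hω : ∀ᶠ i in l, ω i ≠ z) (h : Tendsto ω l (𝓝 z)) :
    Tendsto (fun i => (S.lam (ω i) - S.lam z) / (ω i - z)) l (𝓝 (S.lamDeriv z)) := by
  have h1 : Tendsto (fun i => -(S.b * (1 - (ω i * z)⁻¹))) l (𝓝 (S.lamDeriv z)) := by
    rw [lamDeriv, sq]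
    exact ((((h.mul_const z).inv₀ (mul_ne_zero hz0 hz0)).const_sub 1).const_mul _).neg
  refine h1.congr' ?_
  filter_upwards [hω, h.eventually_ne hz0] with i hi hi0
  rw [S.lam_sub hi0 hz0, mul_div_assoc, div_self (sub_ne_zero.2 hi), mul_one]

/-- If `λ(z)` is real, then `z` is real or lies on the unit circle. -/
theorem theta_real_or_norm_eq_one {σ : C} {z θ : ℂ} (h : S.IsTheta σ z θ)
    (hlam : (S.lam z).im = 0) : θ.im = 0 ∨ ‖θ‖ = 1 := by
  rw [← h.2.2.1, chanLam_im, neg_eq_zero] at hlam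
  rcases mul_eq_zero.1 ((mul_eq_zero.1 hlam).resolve_left (S.bInf_pos σ).ne') with h1 | h1
  · exact .inl h1
  · right
    by_contra hne
    exact (one_sub_inv_norm_sq_neg h.1 (lt_of_le_of_ne h.2.1 hne)).ne h1

theorem norm_lt_one_of_lam_im_ne_zero {z : ℂ} (hz : ‖z‖ ≤ 1) (hlam : (S.lam z).im ≠ 0) :
    ‖z‖ < 1 :=
  lt_of_le_of_ne hz fun h => hlam (by rw [lam_im, h]; simp)

theorem lam_im_ne_zero {z : ℂ} (hz0 : z ≠ 0) (hz : ‖z‖ < 1) (h : z.im ≠ 0) :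
    (S.lam z).im ≠ 0 := by
  rw [lam_im, neg_ne_zero]
  exact mul_ne_zero S.b_pos.ne' (mul_ne_zero h (one_sub_inv_norm_sq_neg hz0 hz).ne)

theorem discNhds_neBot {z : ℂ} (hz : ‖z‖ ≤ 1) : (discNhds z).NeBot := by
  rw [discNhds, ← mem_closure_iff_nhdsWithin_neBot]
  have h1 : ball (0 : ℂ) 1 ⊆ closure (ball 0 1 ∩ {z}ᶜ) :=
    (dense_compl_singleton z).open_subset_closure_inter isOpen_ball
  have h2 := closure_mono h1
  rw [closure_closure, closure_ball _ one_ne_zero] at h2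
  exact h2 (by simpa using hz)

theorem tendsto_id_discNhds (z : ℂ) : Tendsto id (discNhds z) (𝓝 z) :=
  tendsto_id.mono_left nhdsWithin_le_nhds

theorem eventually_discNhds {z : ℂ} (hz0 : z ≠ 0) :
    ∀ᶠ ω in discNhds z, ω ≠ 0 ∧ ‖ω‖ < 1 ∧ ω ≠ z := by
  filter_upwards [(tendsto_id_discNhds z).eventually_ne hz0, self_mem_nhdsWithin] with ω h1 h2
  exact ⟨h1, by simpa using h2.1, h2.2⟩

end

/-! ### Green's formula on the system. -/

section

variable {A C : Type*} (S : WebSystem A C)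

theorem mem_central_or (α : A) : α ∈ S.central ∨ ∃ σ k, α = S.pt σ (k + 1) := by
  by_contra! h
  exact h.1 fun σ k => h.2 σ k

theorem pt_succ_notMem_central (σ : C) (k : ℕ) : S.pt σ (k + 1) ∉ S.central :=
  fun h => h σ k rfl

theorem pt_inj {σ ν : C} {j k : ℕ} :
    S.pt σ j = S.pt ν k ↔ σ = ν ∧ j = k := by
  refine ⟨fun h => ?_, fun h => by rw [h.1, h.2]⟩
  have := S.pt_injective (a₁ := (σ, j)) (a₂ := (ν, k)) h
  simpa using this

theorem apply_pt_succ (ξ : A → ℂ) (σ : C) (k : ℕ) : S.apply ξ (S.pt σ (k + 1)) =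
    -(S.offCoeff σ k : ℂ) * ξ (S.pt σ k) + (S.diagCoeff σ (k + 1) : ℂ) * ξ (S.pt σ (k + 1))
      - (S.offCoeff σ (k + 1) : ℂ) * ξ (S.pt σ (k + 2)) := by
  classical
  rw [apply, finsum_eq_sum_of_support_subset _
    (s := {S.pt σ k, S.pt σ (k + 1), S.pt σ (k + 2)})]
  · rw [Finset.sum_insert (by simp [pt_inj]), Finset.sum_insert (by simp [pt_inj]),
      Finset.sum_singleton, S.L_symm _ (S.pt σ k)]
    simp only [offCoeff, diagCoeff]
    push_cast; ring
  · intro β hβ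
    have : S.L (S.pt σ (k + 1)) β ≠ 0 := fun h => hβ (by simp [h])
    simpa using S.interact σ k β this

theorem isChanSol_of_apply {ξ : A → ℂ} {μ : ℂ} {σ : C}
    (h : ∀ k, S.apply ξ (S.pt σ (k + 1)) = μ * ξ (S.pt σ (k + 1))) :
    S.IsChanSol σ μ fun k => ξ (S.pt σ k) := fun k => by
  rw [← h k, apply_pt_succ]

theorem L_attach_eq_zero {α : A} (hα : α ∈ S.central) {γ : C} (h : α ≠ S.pt γ 0) :
    S.L α (S.pt γ 1) = 0 := by
  by_contra h0
  rw [S.L_symm] at h0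
  rcases S.interact γ 0 α h0 with h1 | h1 | h1
  · exact h h1
  · exact hα γ 0 h1
  · exact hα γ 1 h1

theorem L_pt_eq_zero {α : A} (hα : α ∈ S.central) (γ : C) (k : ℕ) :
    S.L α (S.pt γ (k + 2)) = 0 := by
  by_contra h0
  rw [S.L_symm] at h0
  rcases S.interact γ (k + 1) α h0 with h1 | h1 | h1
  · exact hα γ k h1
  · exact hα γ (k + 1) h1
  · exact hα γ (k + 2) h1

section Fintype

variable [Fintype C]

open Classical in
theorem apply_central (ξ : A → ℂ) (α : S.central) : S.apply ξ α =
    ∑ β : S.central, (S.L α β : ℂ) * ξ β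
      - ∑ γ, if α = S.attach γ then (S.offCoeff γ 0 : ℂ) * ξ (S.pt γ 1) else 0 := by
  have hinj : Function.Injective fun γ => S.pt γ 1 := fun γ γ' h => (S.pt_inj.1 h).1
  have hdisj : Disjoint ((Finset.univ : Finset S.central).map (Function.Embedding.subtype _))
      (Finset.univ.map ⟨_, hinj⟩) := by
    rw [Finset.disjoint_left]
    intro β h1 h2
    simp only [Finset.mem_map, Finset.mem_univ, true_and, Function.Embedding.subtype_apply,
      Function.Embedding.coeFn_mk] at h1 h2
    obtain ⟨β', rfl⟩ := h1
    obtain ⟨γ, h⟩ := h2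
    exact β'.2 γ 0 h.symm
  rw [apply, finsum_eq_sum_of_support_subset _ (s := Finset.disjUnion _ _ hdisj)]
  · rw [Finset.sum_disjUnion, Finset.sum_map, Finset.sum_map, sub_eq_add_neg,
      ← Finset.sum_neg_distrib]
    congr 1
    refine Finset.sum_congr rfl fun γ _ => ?_
    split_ifs with h
    · rw [h]; simp [offCoeff, attach]
    · have : (α : A) ≠ S.pt γ 0 := fun h' => h (Subtype.ext h')
      simp [S.L_attach_eq_zero α.2 this]
  · intro β hβ
    have h0 : S.L α β ≠ 0 := fun h => hβ (by simp [h])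
    rcases S.mem_central_or β with h | ⟨σ, k, rfl⟩
    · simp [h]
    · cases k with
      | zero => simp
      | succ k => exact absurd (S.L_pt_eq_zero α.2 σ k) h0

/-- Green's formula on the finite part of the system up to the `M`-th particle of each channel. -/
theorem green (x y : A → ℂ) (M : ℕ) :
    ∑ α : S.central, (S.apply x α * y α - x α * S.apply y α) +
      ∑ σ, ∑ k ∈ Finset.range M, (S.apply x (S.pt σ (k + 1)) * y (S.pt σ (k + 1))
        - x (S.pt σ (k + 1)) * S.apply y (S.pt σ (k + 1))) =
    -∑ σ, S.wronskian σ (fun k => x (S.pt σ k)) (fun k => y (S.pt σ k)) M := by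
  classical
  -- On a channel the integrand is a difference of consecutive Wronskians. In the central part the
  -- double sum cancels by symmetry of `L` and leaves the Wronskians at 0, which cancel the lower
  -- ends.
  have hch : ∀ σ, ∑ k ∈ Finset.range M, (S.apply x (S.pt σ (k + 1)) * y (S.pt σ (k + 1))
        - x (S.pt σ (k + 1)) * S.apply y (S.pt σ (k + 1))) =
      S.wronskian σ (fun k => x (S.pt σ k)) (fun k => y (S.pt σ k)) 0 -
        S.wronskian σ (fun k => x (S.pt σ k)) (fun k => y (S.pt σ k)) M := by
    intro σ
    rw [← neg_sub, ← Finset.sum_range_sub, ← Finset.sum_neg_distrib]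
    refine Finset.sum_congr rfl fun k _ => ?_
    rw [apply_pt_succ, apply_pt_succ, wronskian, wronskian]
    ring
  have hc : ∑ α : S.central, (S.apply x α * y α - x α * S.apply y α) =
      -∑ σ, S.wronskian σ (fun k => x (S.pt σ k)) (fun k => y (S.pt σ k)) 0 := by
    have e1 : ∀ α : S.central, S.apply x α * y α - x α * S.apply y α =
        (∑ β : S.central, (S.L α β : ℂ) * (x β * y α)
          - ∑ β : S.central, (S.L α β : ℂ) * (x α * y β)) -
        ∑ γ, if α = S.attach γ then (S.offCoeff γ 0 : ℂ) * (x (S.pt γ 1) * y (S.pt γ 0)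
          - x (S.pt γ 0) * y (S.pt γ 1)) else 0 := by
      intro α
      rw [apply_central, apply_central, sub_mul, mul_sub, Finset.sum_mul, Finset.sum_mul,
        Finset.mul_sum, Finset.mul_sum]
      have : ∀ a b c d a' b' c' : ℂ, a = a' → c = c' → b - d = b' → a - b - (c - d) = a' - c' - b' := by
        intros; subst_vars; ring
      refine this _ _ _ _ _ _ _ ?_ ?_ ?_
      · exact Finset.sum_congr rfl fun β _ => by ring
      · exact Finset.sum_congr rfl fun β _ => by ring
      · rw [← Finset.sum_sub_distrib]
        refine Finset.sum_congr rfl fun γ _ => ?_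
        split_ifs with h
        · rw [h]; simp only [attach]; ring
        · ring
    rw [Finset.sum_congr rfl fun α _ => e1 α, Finset.sum_sub_distrib, Finset.sum_sub_distrib,
      Finset.sum_comm (f := fun (α : S.central) (γ : C) => if α = S.attach γ then _ else _)]
    have e2 : ∑ α : S.central, ∑ β : S.central, (S.L α β : ℂ) * (x β * y α) =
        ∑ α : S.central, ∑ β : S.central, (S.L α β : ℂ) * (x α * y β) := by
      rw [Finset.sum_comm]
      refine Finset.sum_congr rfl fun α _ => Finset.sum_congr rfl fun β _ => ?_
      rw [S.L_symm]
    rw [e2, sub_self, zero_sub]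
    simp [wronskian]
  rw [hc, Finset.sum_congr rfl fun σ _ => hch σ, Finset.sum_sub_distrib]
  ring

/-- A function on the particles is summable as soon as it is summable along each channel. -/
theorem hasSum_particles {E : Type*} [AddCommGroup E] [TopologicalSpace E] [IsTopologicalAddGroup E]
    {f : A → E} {s : C → E} (hf : ∀ σ, HasSum (fun k => f (S.pt σ (k + 1))) (s σ)) :
    HasSum f (∑ α : S.central, f α + ∑ σ, s σ) := by
  classical
  have h1 : HasSum (S.central.indicator f) (∑ α : S.central, f α) := by
    have h := hasSum_fintype fun α : S.central => f α
    exact (hasSum_subtype_iff_indicator (f := f) (s := S.central)).1 h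
  have h2 : ∀ σ, HasSum ((Set.range fun k => S.pt σ (k + 1)).indicator f) (s σ) := fun σ => by
    have hinj : Function.Injective fun k => S.pt σ (k + 1) := fun j k h => by
      simpa [pt_inj] using h
    refine (hinj.hasSum_iff fun α hα => Set.indicator_of_notMem hα f).1 ((hf σ).congr_fun ?_)
    intro k
    simp
  have h3 := h1.add (hasSum_sum fun σ (_ : σ ∈ Finset.univ) => h2 σ)
  refine h3.congr_fun ?_
  intro α
  rcases S.mem_central_or α with h | ⟨σ, k, rfl⟩
  · rw [Set.indicator_of_mem h, Finset.sum_eq_zero, add_zero]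
    intro σ _
    refine Set.indicator_of_notMem ?_ f
    rintro ⟨k, rfl⟩
    exact S.pt_succ_notMem_central σ k h
  · rw [Set.indicator_of_notMem (S.pt_succ_notMem_central σ k), zero_add,
      Finset.sum_eq_single σ, Set.indicator_of_mem (Set.mem_range_self (f := fun k => S.pt σ (k + 1)) k)]
    · intro ν _ hν
      refine Set.indicator_of_notMem ?_ f
      rintro ⟨j, hj⟩
      exact hν (S.pt_inj.1 hj).1
    · simp

/-- Green's formula for decaying functions on the whole system. -/
theorem green_tsum [DecidableEq A] {x y : A → ℂ} {μ μ' κ : ℂ} {β : A}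
    (hx : ∀ α, S.apply x α = μ * x α + if α = β then κ else 0)
    (hy : ∀ α, S.apply y α = μ' * y α)
    (hsum : ∀ σ, Summable fun k => x (S.pt σ (k + 1)) * y (S.pt σ (k + 1)))
    (hW : ∀ σ, Tendsto (S.wronskian σ (fun k => x (S.pt σ k)) fun k => y (S.pt σ k)) atTop (𝓝 0)) :
    (μ - μ') * ∑' α, x α * y α + κ * y β = 0 := by
  set f : A → ℂ := fun α => (μ - μ') * (x α * y α) + (if α = β then κ else 0) * y α with hf
  have hfa : ∀ α, f α = S.apply x α * y α - x α * S.apply y α := fun α => by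
    rw [hx, hy, hf]; ring
  have hs : ∀ σ, Summable fun k => f (S.pt σ (k + 1)) := fun σ => by
    refine ((hsum σ).mul_left (μ - μ')).add ?_
    refine summable_of_hasFiniteSupport ?_
    have : Set.Subsingleton {k | S.pt σ (k + 1) = β} := fun j hj k hk => by
      have := hj.trans hk.symm
      simpa [pt_inj] using this
    refine this.finite.subset fun k hk => ?_
    by_contra h
    exact hk (by simp [show ¬ S.pt σ (k + 1) = β from h])
  have h1 := S.hasSum_particles fun σ => (hs σ).hasSum
  -- The total is the limit of the finite Green sums, that is, of minus the sum of the Wronskians at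
  -- `M`, and these tend to 0.
  have h2 : ∑ α : S.central, f α + ∑ σ, ∑' k, f (S.pt σ (k + 1)) = 0 := by
    refine tendsto_nhds_unique (f := fun M => ∑ α : S.central, f α +
      ∑ σ, ∑ k ∈ Finset.range M, f (S.pt σ (k + 1))) (l := atTop) ?_ ?_
    · exact (tendsto_finsetSum _ fun σ _ => (hs σ).hasSum.tendsto_sum_nat).const_add _
    · simp only [hfa, S.green]
      simpa using (tendsto_finsetSum Finset.univ fun σ _ => hW σ).neg
  rw [h2] at h1
  have h3 : HasSum (fun α => x α * y α) (∑' α, x α * y α) :=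
    (S.hasSum_particles fun σ => (hsum σ).hasSum).summable.hasSum
  have h4 : HasSum (fun α => (if α = β then κ else 0) * y α) (κ * y β) := by
    have := hasSum_single (f := fun α => (if α = β then κ else 0) * y α) β
      (fun α hα => by simp [hα])
    simpa using this
  exact ((h3.mul_left _).add h4).unique h1

end Fintype

/-! ### Uniform estimates for Jost solutions and their pairings. -/

section Jost

variable {S}

theorem exists_norm_jost_le (σ : C) : ∃ c : ℝ, 0 ≤ c ∧ ∀ θ : ℂ, θ ≠ 0 → ‖θ‖ ≤ 1 → ∀ k,
    ‖S.jost σ θ k‖ ≤ c * ‖θ‖ ^ k := by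
  obtain ⟨c, ρ, hc, hρ0, hρ1, H⟩ := S.exists_isJost_bound σ
  refine ⟨c + 1, by positivity, fun θ hθ hθ1 k => ?_⟩
  have h1 := (H θ hθ hθ1).2 k
  have h2 : c * ρ ^ k ≤ c := mul_le_of_le_one_right hc (pow_le_one₀ hρ0.le hρ1.le)
  calc ‖S.jost σ θ k‖ = ‖(S.jost σ θ k - θ ^ k) + θ ^ k‖ := by congr 1; ring
    _ ≤ c * ρ ^ k * ‖θ‖ ^ k + ‖θ‖ ^ k := (norm_add_le _ _).trans (by rw [norm_pow]; gcongr)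
    _ ≤ (c + 1) * ‖θ‖ ^ k := by rw [add_mul, one_mul]; gcongr

/-- The relative error `c * ρ ^ k` does not depend on `θ`, so one index serves all `θ` and all
channels. Cuts and divisions take place at this index, because the Jost solutions may vanish at 0 or
1. -/
theorem exists_jost_ne_zero [Finite C] : ∃ K, 1 ≤ K ∧ ∀ (σ : C) (θ : ℂ), θ ≠ 0 → ‖θ‖ ≤ 1 →
    ∀ k, K ≤ k → S.jost σ θ k ≠ 0 := by
  have h1 : ∀ σ : C, ∀ᶠ K in atTop, ∀ θ : ℂ, θ ≠ 0 → ‖θ‖ ≤ 1 → ∀ k, K ≤ k → S.jost σ θ k ≠ 0 := by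
    intro σ
    obtain ⟨c, ρ, hc, hρ0, hρ1, H⟩ := S.exists_isJost_bound σ
    have h0 : Tendsto (fun k => c * ρ ^ k) atTop (𝓝 0) := by
      simpa using (tendsto_pow_atTop_nhds_zero_of_lt_one hρ0.le hρ1).const_mul c
    obtain ⟨N, hN⟩ := eventually_atTop.1 (h0.eventually_lt_const one_pos)
    filter_upwards [eventually_ge_atTop N] with K hK θ hθ hθ1 k hk h
    have h2 := (H θ hθ hθ1).2 k
    rw [h, zero_sub, norm_neg, norm_pow] at h2
    have h3 := hN k (hK.trans hk)
    have h4 : 0 < ‖θ‖ ^ k := pow_pos (norm_pos_iff.2 hθ) k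
    nlinarith
  obtain ⟨K, hK⟩ := ((eventually_all.2 h1).and (eventually_ge_atTop 1)).exists
  exact ⟨K, hK.2, hK.1⟩

theorem tendsto_tsum_jost_mul {ι : Type*} {l : Filter ι} (σ : C) {θ : ι → ℂ} {θ₀ : ℂ}
    (hθ₀ : θ₀ ≠ 0) (hθ₀1 : ‖θ₀‖ < 1) (h : Tendsto θ l (𝓝 θ₀)) {y : ℕ → ℂ} {c : ℝ}
    (hy : ∀ k, ‖y k‖ ≤ c) (N : ℕ) :
    Tendsto (fun i => ∑' k, S.jost σ (θ i) (k + N) * y k) l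
      (𝓝 (∑' k, S.jost σ θ₀ (k + N) * y k)) := by
  obtain ⟨c₀, hc₀, H⟩ := exists_norm_jost_le (S := S) σ
  have hc : 0 ≤ c := (norm_nonneg _).trans (hy 0)
  obtain ⟨r, hr, hr1⟩ := exists_between hθ₀1
  have hr0 : 0 ≤ r := (norm_nonneg _).trans hr.le
  have hev := (h.norm.eventually_lt_const hr).and (h.eventually_ne hθ₀)
  refine tendsto_tsum_of_dominated_convergence (bound := fun k => c₀ * c * r ^ k)
    ((summable_geometric_of_lt_one hr0 hr1).mul_left _) (fun k => ?_) ?_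
  · exact (tendsto_jost σ hθ₀ hθ₀1.le (hev.mono fun i hi => ⟨hi.2, (hi.1.trans hr1).le⟩) h
      _).mul_const _
  · filter_upwards [hev] with i hi k
    rw [norm_mul, mul_right_comm]
    gcongr
    · refine (H _ hi.2 (hi.1.trans hr1).le _).trans ?_
      gcongr
      exact (pow_le_pow_of_le_one (norm_nonneg _) (hi.1.trans hr1).le (Nat.le_add_right k N)).trans
        (pow_le_pow_left₀ (norm_nonneg _) hi.1.le k)
    · exact hy k

/-- At a threshold `s = ±1` the tails of the pairing of Jost solutions diverge like
`(1 - θ s)⁻¹`. -/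
theorem tendsto_threshold_tsum {ι : Type*} {l : Filter ι} (σ : C) {θ : ι → ℂ} {s : ℂ}
    (hs : s ^ 2 = 1) (hθ : ∀ᶠ i in l, θ i ≠ 0 ∧ ‖θ i‖ < 1) (h : Tendsto θ l (𝓝 s)) (N : ℕ) :
    Tendsto (fun i => (1 - θ i * s) * ∑' k, S.jost σ (θ i) (k + N) * S.jost σ s (k + N)) l
      (𝓝 1) := by
  obtain ⟨c, ρ, hc, hρ0, hρ1, H⟩ := S.exists_isJost_bound σ
  have hsn : ‖s‖ = 1 := by
    have := congrArg norm hs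
    rw [norm_pow, norm_one] at this
    exact (pow_eq_one_iff_of_nonneg (norm_nonneg s) two_ne_zero).1 this
  have hs0 : s ≠ 0 := norm_pos_iff.1 (by rw [hsn]; exact one_pos)
  have hq : Tendsto (fun i => θ i * s) l (𝓝 1) := by
    have := h.mul_const s
    rwa [← sq, hs] at this
  have hgeo : Summable fun k => (c * (c + 1) + c) * ρ ^ k :=
    (summable_geometric_of_lt_one hρ0.le hρ1).mul_left _
  set B := ∑' k, (c * (c + 1) + c) * ρ ^ k
  -- Replacing the product of Jost solutions by `(θ s) ^ k` costs O(ρ^k) uniformly in `θ`, so the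
  -- geometric series carries all of the divergence.
  have hrem : ∀ i, θ i ≠ 0 → ‖θ i‖ < 1 → ∀ k,
      ‖S.jost σ (θ i) (k + N) * S.jost σ s (k + N) - (θ i * s) ^ (k + N)‖ ≤
        (c * (c + 1) + c) * ρ ^ k := by
    intro i h0 h1 k
    have e1 := (H _ h0 h1.le).2 (k + N)
    have e2 := (H s hs0 hsn.le).2 (k + N)
    rw [hsn, one_pow, mul_one] at e2
    have hp : ρ ^ (k + N) ≤ ρ ^ k := pow_le_pow_of_le_one hρ0.le hρ1.le (by omega)
    have hp1 : ρ ^ (k + N) ≤ 1 := pow_le_one₀ hρ0.le hρ1.le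
    have hp0 : 0 < ρ ^ (k + N) := by positivity
    have ht : ‖θ i‖ ^ (k + N) ≤ 1 := pow_le_one₀ (norm_nonneg _) h1.le
    have e1' : ‖S.jost σ (θ i) (k + N) - θ i ^ (k + N)‖ ≤ c * ρ ^ (k + N) :=
      e1.trans (mul_le_of_le_one_right (by positivity) ht)
    have e3 : ‖S.jost σ s (k + N)‖ ≤ c + 1 := by
      calc ‖S.jost σ s (k + N)‖ = ‖(S.jost σ s (k + N) - s ^ (k + N)) + s ^ (k + N)‖ := by
            congr 1; ring
        _ ≤ c * ρ ^ (k + N) + 1 := (norm_add_le _ _).trans (by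
            rw [norm_pow, hsn, one_pow]; gcongr)
        _ ≤ c + 1 := by gcongr; exact mul_le_of_le_one_right hc hp1
    calc ‖S.jost σ (θ i) (k + N) * S.jost σ s (k + N) - (θ i * s) ^ (k + N)‖
        = ‖(S.jost σ (θ i) (k + N) - θ i ^ (k + N)) * S.jost σ s (k + N) +
          θ i ^ (k + N) * (S.jost σ s (k + N) - s ^ (k + N))‖ := by rw [mul_pow]; congr 1; ring
      _ ≤ c * ρ ^ (k + N) * (c + 1) + 1 * (c * ρ ^ (k + N)) := by
        refine (norm_add_le _ _).trans (add_le_add ?_ ?_)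
        · rw [norm_mul]; gcongr
        · rw [norm_mul, norm_pow]; gcongr
      _ = (c * (c + 1) + c) * ρ ^ (k + N) := by ring
      _ ≤ _ := by gcongr
  have heq : ∀ᶠ i in l, (1 - θ i * s) * ∑' k, S.jost σ (θ i) (k + N) * S.jost σ s (k + N) =
      (θ i * s) ^ N + (1 - θ i * s) *
        ∑' k, (S.jost σ (θ i) (k + N) * S.jost σ s (k + N) - (θ i * s) ^ (k + N)) := by
    filter_upwards [hθ] with i hi
    have hq1 : ‖θ i * s‖ < 1 := by rw [norm_mul, hsn, mul_one]; exact hi.2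
    have hg : HasSum (fun k => (θ i * s) ^ (k + N)) ((1 - θ i * s)⁻¹ * (θ i * s) ^ N) := by
      simpa only [pow_add] using (hasSum_geometric_of_norm_lt_one hq1).mul_right _
    have hr : Summable fun k =>
        S.jost σ (θ i) (k + N) * S.jost σ s (k + N) - (θ i * s) ^ (k + N) :=
      Summable.of_norm_bounded hgeo (hrem i hi.1 hi.2)
    have hadd := (hr.hasSum.add hg).tsum_eq
    simp only [sub_add_cancel] at hadd
    have hne : 1 - θ i * s ≠ 0 := fun h0 => by
      rw [← sub_eq_zero.1 h0] at hq1; simp at hq1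
    rw [hadd, mul_add, mul_inv_cancel_left₀ hne]; ring
  refine Tendsto.congr' (heq.mono fun i hi => hi.symm) ?_
  have h2 : Tendsto (fun i => (1 - θ i * s) *
      ∑' k, (S.jost σ (θ i) (k + N) * S.jost σ s (k + N) - (θ i * s) ^ (k + N))) l (𝓝 0) := by
    have h3 : Tendsto (fun i => 1 - θ i * s) l (𝓝 0) := by simpa using hq.const_sub 1
    refine h3.zero_mul_isBoundedUnder_le (isBoundedUnder_of_eventually_le (a := B) ?_)
    filter_upwards [hθ] with i hi
    exact tsum_of_norm_bounded hgeo.hasSum (hrem i hi.1 hi.2)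
  simpa using (hq.pow N).add h2

end Jost

end

/-! ### Outgoing solutions and conservation of flux. -/

section

variable {A C : Type*} {S : WebSystem A C}

theorem e_isChanSol (σ : C) {ω : ℂ} (h0 : ω ≠ 0) (h1 : ‖ω‖ ≤ 1) :
    S.IsChanSol σ (S.lam ω) fun k => S.e σ k ω := by
  have h := theta_spec (S := S) σ h0 h1
  rw [← h.2.2.1]
  exact jost_isChanSol σ h.1 h.2.1

theorem tendsto_e {ι : Type*} {l : Filter ι} (σ : C) {ω : ι → ℂ} {z : ℂ} (hz : ‖z‖ ≤ 1)
    (hz0 : z ≠ 0) (hz1 : z ≠ 1) (hz2 : z ≠ -1) (hω : ∀ᶠ i in l, ω i ≠ 0 ∧ ‖ω i‖ ≤ 1)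
    (h : Tendsto ω l (𝓝 z)) (k : ℕ) : Tendsto (fun i => S.e σ k (ω i)) l (𝓝 (S.e σ k z)) := by
  have hs := theta_spec (S := S) σ hz0 hz
  refine tendsto_jost σ hs.1 hs.2.1 (hω.mono fun i hi => ?_)
    (tendsto_theta σ hz hz0 hz1 hz2 hω h) k
  have := theta_spec (S := S) σ hi.1 hi.2
  exact ⟨this.1, this.2.1⟩

theorem conj_e_of_im_eq_zero (σ : C) {z : ℂ} (hz0 : z ≠ 0) (hz : ‖z‖ ≤ 1)
    (h : (S.theta σ z).im = 0) (k : ℕ) : starRingEnd ℂ (S.e σ k z) = S.e σ k z := by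
  have hs := theta_spec (S := S) σ hz0 hz
  rw [e, jost_conj σ hs.1 hs.2.1, Complex.conj_eq_iff_im.2 h]

/-- This is the flux carried by a Jost solution. For real `θ` the solution is real and both sides
vanish; for ‖θ‖ = 1 the Wronskian is constant in `k` and is read off from the asymptotics. -/
theorem wronskian_e_conj (σ : C) {z : ℂ} (hz0 : z ≠ 0) (hz : ‖z‖ ≤ 1) (hlam : (S.lam z).im = 0)
    (k : ℕ) : S.wronskian σ (fun k => S.e σ k z) (fun k => starRingEnd ℂ (S.e σ k z)) k =
      S.bInf σ * (S.theta σ z - starRingEnd ℂ (S.theta σ z)) := by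
  have hs := theta_spec (S := S) σ hz0 hz
  rcases S.theta_real_or_norm_eq_one hs hlam with h | h
  · rw [Complex.conj_eq_iff_im.2 h, sub_self, mul_zero, wronskian]
    simp only [conj_e_of_im_eq_zero σ hz0 hz h]
    ring
  · have hsol := e_isChanSol (S := S) σ hz0 hz
    have hsol' := hsol.conj
    rw [Complex.conj_eq_iff_im.2 hlam] at hsol'
    rw [wronskian_const hsol hsol']
    refine tendsto_nhds_unique (f := fun k => S.wronskian σ (fun k => S.e σ k z)
      (fun k => starRingEnd ℂ (S.e σ k z)) k) (l := atTop)
      (by simp only [wronskian_const hsol hsol']; exact tendsto_const_nhds) ?_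
    set θ := S.theta σ z
    have hJ : Tendsto (fun k => S.e σ k z / θ ^ k) atTop (𝓝 1) := (jost_isJost σ hs.1 hs.2.1).2
    have hJ' := hJ.comp (tendsto_add_atTop_nat 1)
    have hc := (Complex.continuous_conj.tendsto _).comp hJ
    have hc' := (Complex.continuous_conj.tendsto _).comp hJ'
    have hb := (Complex.continuous_ofReal.tendsto _).comp (S.tendsto_offCoeff σ)
    have := hb.mul (((hJ'.mul hc).const_mul θ).sub ((hJ.mul hc').const_mul (starRingEnd ℂ θ)))
    simp only [map_one, mul_one] at this
    refine this.congr fun k => ?_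
    have h1 : θ * starRingEnd ℂ θ = 1 := by
      rw [Complex.mul_conj, Complex.normSq_eq_norm_sq, h]; simp
    have h2 : θ ^ k * starRingEnd ℂ θ ^ k = 1 := by rw [← mul_pow, h1, one_pow]
    have hθ := hs.1
    have hθ' : starRingEnd ℂ θ ≠ 0 := by simpa using hθ
    have h3 : (θ ^ k)⁻¹ = starRingEnd ℂ θ ^ k := (eq_inv_of_mul_eq_one_right h2).symm
    have h4 : (starRingEnd ℂ θ ^ k)⁻¹ = θ ^ k := by rw [← h3, inv_inv]
    simp only [Function.comp_apply, wronskian, map_div₀, map_pow]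
    simp only [div_eq_mul_inv, pow_succ, mul_inv, h3, h4]
    have h5 : θ * θ⁻¹ = 1 := mul_inv_cancel₀ hθ
    have h6 : starRingEnd ℂ θ * (starRingEnd ℂ θ)⁻¹ = 1 := mul_inv_cancel₀ hθ'
    linear_combination (S.offCoeff σ k : ℂ) *
      ((S.e σ (k + 1) z * starRingEnd ℂ (S.e σ k z)) * (θ * θ⁻¹ * h2 + h5)
        - (S.e σ k z * starRingEnd ℂ (S.e σ (k + 1) z)) *
          (starRingEnd ℂ θ * (starRingEnd ℂ θ)⁻¹ * h2 + h6))

theorem apply_conj (x : A → ℂ) (α : A) :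
    S.apply (fun α => starRingEnd ℂ (x α)) α = starRingEnd ℂ (S.apply x α) := by
  have := (starAddEquiv : ℂ ≃+ ℂ).map_finsum fun β => (S.L α β : ℂ) * x β
  simp only [starAddEquiv_apply, star_mul', RCLike.star_def, Complex.conj_ofReal] at this
  exact this.symm

variable (S) in
/-- From the `K`-th particle on, `g` is on each channel a multiple of the Jost solution. -/
def IsOutgoing (K : ℕ) (ω : ℂ) (g : A → ℂ) : Prop :=
  ∀ σ k, K ≤ k → g (S.pt σ k) * S.e σ K ω = g (S.pt σ K) * S.e σ k ω

variable (S) in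
/-- The Jost solutions do not vanish from `K` on. -/
def JostNonvanishing (K : ℕ) : Prop :=
  ∀ (σ : C) (θ : ℂ), θ ≠ 0 → ‖θ‖ ≤ 1 → ∀ k, K ≤ k → S.jost σ θ k ≠ 0

variable {K : ℕ}

theorem JostNonvanishing.e_ne_zero (hK : S.JostNonvanishing K) (σ : C) {ω : ℂ} (h0 : ω ≠ 0)
    (h1 : ‖ω‖ ≤ 1) {k : ℕ} (hk : K ≤ k) : S.e σ k ω ≠ 0 := by
  have h := theta_spec (S := S) σ h0 h1
  exact hK σ _ h.1 h.2.1 k hk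

theorem IsOutgoing.eq_div {ω : ℂ} {g : A → ℂ} (hK : S.JostNonvanishing K)
    (hg : S.IsOutgoing K ω g) (h0 : ω ≠ 0) (h1 : ‖ω‖ ≤ 1) (σ : C) {k : ℕ} (hk : K ≤ k) :
    g (S.pt σ k) = g (S.pt σ K) / S.e σ K ω * S.e σ k ω := by
  have := hK.e_ne_zero σ h0 h1 le_rfl
  have h := hg σ k hk
  field_simp
  exact h

theorem IsOutgoing.exists_bound {ω : ℂ} {g : A → ℂ} (hK : S.JostNonvanishing K)
    (hg : S.IsOutgoing K ω g) (h0 : ω ≠ 0) (h1 : ‖ω‖ ≤ 1) (σ : C) :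
    ∃ c : ℝ, 0 ≤ c ∧ ∀ k, ‖g (S.pt σ k)‖ ≤ c * ‖S.theta σ ω‖ ^ k := by
  have hs := theta_spec (S := S) σ h0 h1
  have hθ := norm_pos_iff.2 hs.1
  obtain ⟨c₀, hc₀, H⟩ := exists_norm_jost_le (S := S) σ
  have hn : 0 ≤ ∑ k ∈ Finset.range K, ‖g (S.pt σ k)‖ / ‖S.theta σ ω‖ ^ k :=
    Finset.sum_nonneg fun k _ => by positivity
  refine ⟨∑ k ∈ Finset.range K, ‖g (S.pt σ k)‖ / ‖S.theta σ ω‖ ^ k +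
    ‖g (S.pt σ K) / S.e σ K ω‖ * c₀, by positivity, fun k => ?_⟩
  rcases lt_or_ge k K with hk | hk
  · have := Finset.single_le_sum (f := fun k => ‖g (S.pt σ k)‖ / ‖S.theta σ ω‖ ^ k)
      (fun k _ => by positivity) (Finset.mem_range.2 hk)
    rw [← div_le_iff₀ (by positivity)]
    refine this.trans (le_add_of_nonneg_right (by positivity))
  · rw [hg.eq_div hK h0 h1 σ hk, norm_mul, add_mul, mul_assoc _ c₀]
    refine le_add_of_nonneg_of_le (by positivity) ?_
    gcongr
    exact H _ hs.1 hs.2.1 k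

theorem summable_mul_of_geometric {r c c' : ℝ} (hr0 : 0 ≤ r) (hr1 : r < 1) {x y : ℕ → ℂ}
    (hx : ∀ k, ‖x k‖ ≤ c * r ^ k) (hy : ∀ k, ‖y k‖ ≤ c') :
    Summable fun k => x (k + 1) * y (k + 1) := by
  refine Summable.of_norm_bounded (g := fun k => c * r ^ (k + 1) * c') ?_ fun k => ?_
  · have := (summable_nat_add_iff 1).2 (summable_geometric_of_lt_one hr0 hr1)
    exact (this.mul_left c).mul_right c'
  · rw [norm_mul]
    exact mul_le_mul (hx _) (hy _) (norm_nonneg _) ((norm_nonneg _).trans (hx _))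

theorem tendsto_wronskian_zero {σ : C} {r c c' : ℝ} (hr0 : 0 ≤ r) (hr1 : r < 1) {x y : ℕ → ℂ}
    (hx : ∀ k, ‖x k‖ ≤ c * r ^ k) (hy : ∀ k, ‖y k‖ ≤ c') :
    Tendsto (S.wronskian σ x y) atTop (𝓝 0) := by
  have hgeo : Tendsto (fun k => c * r ^ k * c') atTop (𝓝 0) := by
    simpa using ((tendsto_pow_atTop_nhds_zero_of_lt_one hr0 hr1).const_mul c).mul_const c'
  have h1 : Tendsto (fun k => x (k + 1) * y k) atTop (𝓝 0) := by
    refine squeeze_zero_norm (fun k => ?_) (hgeo.comp (tendsto_add_atTop_nat 1))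
    rw [norm_mul]
    exact mul_le_mul (hx _) (hy _) (norm_nonneg _) ((norm_nonneg _).trans (hx _))
  have h2 : Tendsto (fun k => x k * y (k + 1)) atTop (𝓝 0) := by
    refine squeeze_zero_norm (fun k => ?_) hgeo
    rw [norm_mul]
    exact mul_le_mul (hx _) (hy _) (norm_nonneg _) ((norm_nonneg _).trans (hx _))
  have hb := (Complex.continuous_ofReal.tendsto _).comp (S.tendsto_offCoeff σ)
  have := hb.mul (h1.sub h2)
  rw [sub_self, mul_zero] at this
  exact this

theorem tsum_mul_conj (x : A → ℂ) :
    ∑' α, x α * starRingEnd ℂ (x α) = ((∑' α, ‖x α‖ ^ 2 : ℝ) : ℂ) := by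
  rw [Complex.ofReal_tsum]
  refine tsum_congr fun α => ?_
  rw [Complex.mul_conj, Complex.normSq_eq_norm_sq]

theorem summable_norm_sq {x : A → ℂ} (h : Summable fun α => x α * starRingEnd ℂ (x α)) :
    Summable fun α => ‖x α‖ ^ 2 := by
  refine Complex.summable_ofReal.1 (h.congr fun α => ?_)
  rw [Complex.mul_conj, Complex.normSq_eq_norm_sq]

theorem eq_zero_of_tsum_mul_conj {x : A → ℂ} (h : Summable fun α => x α * starRingEnd ℂ (x α))
    (h0 : ∑' α, x α * starRingEnd ℂ (x α) = 0) : x = 0 := by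
  rw [tsum_mul_conj, Complex.ofReal_eq_zero] at h0
  have h1 := (summable_norm_sq h).hasSum
  rw [h0, hasSum_zero_iff_of_nonneg fun α => sq_nonneg _] at h1
  funext α
  simpa using congrFun h1 α

variable [Fintype C]

/-- Conservation of flux: an outgoing solution at a real spectral parameter vanishes on the open
channels. -/
theorem IsOutgoing.eq_zero_or_im_eq_zero {z : ℂ} (hz : ‖z‖ ≤ 1) (hz0 : z ≠ 0) (hz1 : z ≠ 1)
    (hz2 : z ≠ -1) (hK : S.JostNonvanishing K) (hlam : (S.lam z).im = 0) {y : A → ℂ}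
    (hy : ∀ α, S.apply y α = S.lam z * y α) (hout : S.IsOutgoing K z y) (σ : C) :
    y (S.pt σ K) = 0 ∨ (S.theta σ z).im = 0 := by
  have hg := S.green y (fun α => starRingEnd ℂ (y α)) K
  have hc : ∀ α, S.apply y α * starRingEnd ℂ (y α)
      - y α * S.apply (fun α => starRingEnd ℂ (y α)) α = 0 := fun α => by
    rw [apply_conj, hy, map_mul, Complex.conj_eq_iff_im.2 hlam]; ring
  simp only [hc, Finset.sum_const_zero, add_zero] at hg
  set v : C → ℂ := fun σ => y (S.pt σ K) / S.e σ K z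
  have hv : ∀ σ k, K ≤ k → y (S.pt σ k) = v σ * S.e σ k z := fun σ k hk =>
    hout.eq_div hK hz0 hz σ hk
  -- Each channel carries a flux proportional to Im θ_σ(z), and `hg` says that the fluxes add up to
  -- zero.
  have hW : ∀ σ, S.wronskian σ (fun k => y (S.pt σ k)) (fun k => starRingEnd ℂ (y (S.pt σ k))) K =
      ((‖v σ‖ ^ 2 * S.bInf σ * (2 * (S.theta σ z).im) : ℝ) : ℂ) * Complex.I := by
    intro σ
    have h1 := wronskian_e_conj (S := S) σ hz0 hz hlam K
    rw [Complex.sub_conj] at h1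
    rw [wronskian] at h1 ⊢
    rw [hv σ K le_rfl, hv σ (K + 1) (by omega)]
    have h2 : v σ * starRingEnd ℂ (v σ) = ((‖v σ‖ ^ 2 : ℝ) : ℂ) := by
      rw [Complex.mul_conj, Complex.normSq_eq_norm_sq]
    rw [Complex.ofReal_mul, Complex.ofReal_mul, ← h2]
    simp only [map_mul]
    linear_combination (v σ * starRingEnd ℂ (v σ)) * h1
  simp only [hW] at hg
  rw [← Finset.sum_mul, ← Complex.ofReal_sum, eq_comm, neg_eq_zero,
    mul_eq_zero, Complex.ofReal_eq_zero] at hg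
  replace hg := hg.resolve_right Complex.I_ne_zero
  -- For real `z` every θ_σ(z) is real. Otherwise, multiplying by `z.im` makes all fluxes
  -- nonnegative, by the sign condition in `IsTheta`, so each of them vanishes.
  by_cases hzi : z.im = 0
  · right
    have hzn := norm_lt_one_of_im_eq_zero hz hz1 hz2 hzi
    have hs := theta_spec (S := S) σ hz0 hz
    exact (S.theta_real_or_norm_eq_one hs hlam).resolve_right (hs.norm_lt hz0 hzn).ne
  · have hg' : ∑ σ, ‖v σ‖ ^ 2 * S.bInf σ * (2 * ((S.theta σ z).im * z.im)) = 0 := by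
      have := congrArg (· * z.im) hg
      simp only [zero_mul, Finset.sum_mul] at this
      rw [← this]
      exact Finset.sum_congr rfl fun σ _ => by ring
    have hnn : ∀ σ ∈ Finset.univ, 0 ≤ ‖v σ‖ ^ 2 * S.bInf σ * (2 * ((S.theta σ z).im * z.im)) := by
      intro σ _
      have h1 := (theta_spec (S := S) σ hz0 hz).2.2.2
      have h2 := S.bInf_pos σ
      positivity
    have h0 := (Finset.sum_eq_zero_iff_of_nonneg hnn).1 hg' σ (Finset.mem_univ _)
    rcases mul_eq_zero.1 h0 with h | h
    · left
      rcases mul_eq_zero.1 h with h | h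
      · rw [hv σ K le_rfl, norm_eq_zero.1 (pow_eq_zero_iff two_ne_zero |>.1 h), zero_mul]
      · exact absurd h (S.bInf_pos σ).ne'
    · right
      rcases mul_eq_zero.1 h with h | h
      · norm_num at h
      · exact (mul_eq_zero.1 h).resolve_right hzi

/-- A nonreal λ(z) forces ‖z‖ < 1, so outgoing solutions decay. Pairing `y` with its conjugate gives
(λ - conj λ) ‖y‖² = 0. -/
theorem IsOutgoing.eq_zero_of_lam_im_ne_zero {z : ℂ} (hz : ‖z‖ ≤ 1) (hz0 : z ≠ 0)
    (hK : S.JostNonvanishing K) (hlam : (S.lam z).im ≠ 0) {y : A → ℂ}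
    (hy : ∀ α, S.apply y α = S.lam z * y α) (hout : S.IsOutgoing K z y) : y = 0 := by
  classical
  have hzn := S.norm_lt_one_of_lam_im_ne_zero hz hlam
  have hy' : ∀ α, S.apply (fun α => starRingEnd ℂ (y α)) α =
      starRingEnd ℂ (S.lam z) * starRingEnd ℂ (y α) := fun α => by rw [apply_conj, hy, map_mul]
  have hb : ∀ σ, ∃ c c' r : ℝ, 0 ≤ r ∧ r < 1 ∧ (∀ k, ‖y (S.pt σ k)‖ ≤ c * r ^ k) ∧
      ∀ k, ‖starRingEnd ℂ (y (S.pt σ k))‖ ≤ c' := fun σ => by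
    obtain ⟨c, hc, h⟩ := hout.exists_bound hK hz0 hz σ
    have hn := (theta_spec (S := S) σ hz0 hz).norm_lt hz0 hzn
    refine ⟨c, c, _, norm_nonneg _, hn, h, fun k => ?_⟩
    rw [RCLike.norm_conj]
    exact (h k).trans (mul_le_of_le_one_right hc (pow_le_one₀ (norm_nonneg _) hn.le))
  have hsum : ∀ σ, Summable fun k =>
      y (S.pt σ (k + 1)) * starRingEnd ℂ (y (S.pt σ (k + 1))) := fun σ => by
    obtain ⟨c, c', r, h0, h1, h2, h3⟩ := hb σ
    exact summable_mul_of_geometric (x := fun k => y (S.pt σ k))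
      (y := fun k => starRingEnd ℂ (y (S.pt σ k))) h0 h1 h2 h3
  have hall := (S.hasSum_particles (f := fun α => y α * starRingEnd ℂ (y α))
    fun σ => (hsum σ).hasSum).summable
  obtain h | ⟨⟨β⟩⟩ := isEmpty_or_nonempty A
  · exact Subsingleton.elim _ _
  have h := S.green_tsum (κ := 0) (β := β) (by simpa using hy) hy' hsum fun σ => by
    obtain ⟨c, c', r, h0, h1, h2, h3⟩ := hb σ
    exact tendsto_wronskian_zero h0 h1 h2 h3
  rw [zero_mul, add_zero, Complex.sub_conj] at h
  refine eq_zero_of_tsum_mul_conj hall ((mul_eq_zero.1 h).resolve_left ?_)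
  simpa using hlam

end

/-! ### Channels with a band edge at λ(z). -/

section

variable {A C : Type*} {S : WebSystem A C}

/-- The point s = ±1 is critical for λ_σ, and λ_σ(θ) - λ_σ(s) = -b_σ (1 - θs)² / θ exactly. -/
theorem threshold_sq {σ : C} {ω z θ s : ℂ} (hs : s ^ 2 = 1) (hθ0 : θ ≠ 0)
    (hθ : S.chanLam σ θ = S.lam ω) (hsz : S.chanLam σ s = S.lam z) :
    (1 - θ * s) ^ 2 * (S.bInf σ * s) = -(θ * s) * (S.lam ω - S.lam z) := by
  have hs0 : s ≠ 0 := fun h => by simp [h] at hs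
  rw [← hθ, ← hsz, chanLam, chanLam]
  have h1 : s⁻¹ = s := inv_eq_of_mul_eq_one_right (by rw [← sq, hs])
  have h2 : θ * θ⁻¹ = 1 := mul_inv_cancel₀ hθ0
  rw [h1]
  linear_combination (S.bInf σ * s * θ ^ 2) * hs - S.bInf σ * s * h2

/-- Two channels with a threshold at `λ(z)`: the ratio of `1 - θ_τ s_τ` and `1 - θ_σ s_σ` stays
bounded, and its real part is asymptotically nonnegative. -/
theorem threshold_ratio {ι : Type*} {l : Filter ι} {σ τ : C} {ω : ι → ℂ} {z : ℂ} (hz : ‖z‖ ≤ 1)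
    (hz0 : z ≠ 0) (hz1 : z ≠ 1) (hz2 : z ≠ -1)
    (hω : ∀ᶠ i in l, ω i ≠ 0 ∧ ‖ω i‖ < 1 ∧ ω i ≠ z) (h : Tendsto ω l (𝓝 z))
    (hσ : S.theta σ z ^ 2 = 1) (hτ : S.theta τ z ^ 2 = 1) :
    (l.IsBoundedUnder (· ≤ ·) fun i => ‖(1 - S.theta τ (ω i) * S.theta τ z) /
      (1 - S.theta σ (ω i) * S.theta σ z)‖) ∧
    ∀ ε > 0, ∀ᶠ i in l, -ε ≤ ((1 - S.theta τ (ω i) * S.theta τ z) /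
      (1 - S.theta σ (ω i) * S.theta σ z)).re := by
  have hω' : ∀ᶠ i in l, ω i ≠ 0 ∧ ‖ω i‖ ≤ 1 := hω.mono fun i hi => ⟨hi.1, hi.2.1.le⟩
  have hsσ := theta_spec (S := S) σ hz0 hz
  have hsτ := theta_spec (S := S) τ hz0 hz
  have hbσ := S.bInf_pos σ
  have hbτ := S.bInf_pos τ
  have hbσ' : (S.bInf σ : ℂ) ≠ 0 := Complex.ofReal_ne_zero.2 hbσ.ne'
  have hbτ' : (S.bInf τ : ℂ) ≠ 0 := Complex.ofReal_ne_zero.2 hbτ.ne'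
  set R : ι → ℂ := fun i => (1 - S.theta τ (ω i) * S.theta τ z) /
      (1 - S.theta σ (ω i) * S.theta σ z) with hR
  have hpm : ∀ s : ℂ, s ^ 2 = 1 → s = 1 ∨ s = -1 := fun s hs => by
    rcases mul_eq_zero.1 (show (s - 1) * (s + 1) = 0 by linear_combination hs) with h | h
    · exact .inl (sub_eq_zero.1 h)
    · exact .inr (eq_neg_of_add_eq_zero_left h)
  have hnorm : ∀ s : ℂ, s ^ 2 = 1 → ‖s‖ = 1 := fun s hs => by
    rcases hpm s hs with rfl | rfl <;> simp
  have hqne : ∀ ν : C, S.theta ν z ^ 2 = 1 → ∀ᶠ i in l,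
      0 < (1 - S.theta ν (ω i) * S.theta ν z).re := fun ν hν => by
    filter_upwards [hω] with i hi
    have h1 := (theta_spec (S := S) ν hi.1 hi.2.1.le).norm_lt hi.1 hi.2.1
    have h2 : ‖S.theta ν (ω i) * S.theta ν z‖ < 1 := by
      rw [norm_mul, hnorm _ hν, mul_one]; exact h1
    rw [Complex.sub_re, Complex.one_re]
    linarith [(Complex.abs_re_le_norm (S.theta ν (ω i) * S.theta ν z)), le_abs_self
      (S.theta ν (ω i) * S.theta ν z).re]
  have hq : ∀ ν : C, S.theta ν z ^ 2 = 1 →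
      Tendsto (fun i => S.theta ν (ω i) * S.theta ν z) l (𝓝 1) := fun ν hν => by
    have := (tendsto_theta (S := S) ν hz hz0 hz1 hz2 hω' h).mul_const (S.theta ν z)
    rwa [← sq, hν] at this
  have hzi : z.im ≠ 0 := fun hzi => by
    have := hsσ.norm_lt hz0 (norm_lt_one_of_im_eq_zero hz hz1 hz2 hzi)
    rw [hnorm _ hσ] at this
    exact lt_irrefl _ this
  have hlamne : ∀ᶠ i in l, S.lam (ω i) - S.lam z ≠ 0 := by
    have h1 := (tendsto_lam_slope (S := S) hz0 (hω.mono fun i hi => hi.2.2) h).eventually_ne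
      (S.lamDeriv_ne_zero hz1 hz2)
    filter_upwards [h1] with i hi h0
    simp [h0] at hi
  -- By `threshold_sq` numerator and denominator squared are both proportional to λ(ω) - λ(z), so
  -- only the square of the ratio has an evident limit; the sign of the root is settled afterwards.
  have hR2 : Tendsto (fun i => R i ^ 2) l (𝓝 (S.bInf σ * S.theta σ z / (S.bInf τ * S.theta τ z))) := by
    have h1 := ((hq τ hτ).div (hq σ hσ) one_ne_zero).mul_const
      (S.bInf σ * S.theta σ z / (S.bInf τ * S.theta τ z))
    rw [div_one, one_mul] at h1
    refine h1.congr' ?_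
    filter_upwards [hω, hqne σ hσ, hlamne] with i hi hqσ hne
    have e1 := threshold_sq hσ (theta_spec (S := S) σ hi.1 hi.2.1.le).1
      (theta_spec (S := S) σ hi.1 hi.2.1.le).2.2.1 hsσ.2.2.1
    have e2 := threshold_sq hτ (theta_spec (S := S) τ hi.1 hi.2.1.le).1
      (theta_spec (S := S) τ hi.1 hi.2.1.le).2.2.1 hsτ.2.2.1
    have hθσ := (theta_spec (S := S) σ hi.1 hi.2.1.le).1
    have n1 : 1 - S.theta σ (ω i) * S.theta σ z ≠ 0 := fun h0 => by simp [h0] at hqσ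
    have n2 := hsσ.1
    have n3 := hsτ.1
    simp only [Pi.div_apply, hR]
    rw [div_pow, div_mul_div_comm, div_eq_div_iff (by positivity) (by positivity)]
    refine mul_right_cancel₀ hne ?_
    linear_combination (S.theta τ (ω i) * S.theta τ z) * (S.lam (ω i) - S.lam z) * e1 -
      (S.theta σ (ω i) * S.theta σ z) * (S.lam (ω i) - S.lam z) * e2
  have hbdd : l.IsBoundedUnder (· ≤ ·) fun i => ‖R i‖ := by
    have h1 := hR2.norm
    have h2 : ∀ᶠ i in l, ‖R i ^ 2‖ ≤
        ‖S.bInf σ * S.theta σ z / (S.bInf τ * S.theta τ z)‖ + 1 :=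
      h1.eventually_le_const (lt_add_one _)
    refine isBoundedUnder_of_eventually_le
      (a := ‖S.bInf σ * S.theta σ z / (S.bInf τ * S.theta τ z)‖ + 1 + 1) ?_
    filter_upwards [h2] with i hi
    rw [norm_pow] at hi
    nlinarith [norm_nonneg (R i), sq_nonneg (‖R i‖ - 1)]
  refine ⟨hbdd, fun ε hε => ?_⟩
  -- At edges of the same kind, the imaginary parts of θ_σ(ω) and θ_τ(ω) do not have opposite signs
  -- and the real parts of 1 - θs are positive, so the ratio has nonnegative real part. At edges of
  -- opposite kinds the squared ratio tends to a negative number, so the real part tends to 0.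
  by_cases hst : S.theta σ z = S.theta τ z
  · have him : ∀ᶠ i in l, (ω i).im ≠ 0 :=
      ((Complex.continuous_im.tendsto _).comp h).eventually_ne hzi
    filter_upwards [hω, him, hqne σ hσ, hqne τ hτ] with i hi hii h1 h2
    refine le_trans (neg_nonpos.2 hε.le) ?_
    have s1 := (theta_spec (S := S) σ hi.1 hi.2.1.le).2.2.2
    have s2 := (theta_spec (S := S) τ hi.1 hi.2.1.le).2.2.2
    have s3 : 0 ≤ (S.theta σ (ω i)).im * (S.theta τ (ω i)).im := by
      have : 0 ≤ ((S.theta σ (ω i)).im * (S.theta τ (ω i)).im) * (ω i).im ^ 2 := by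
        nlinarith [mul_nonneg s1 s2]
      exact nonneg_of_mul_nonneg_left this (by positivity)
    have s4 : 0 ≤ (S.theta σ (ω i) * S.theta σ z).im * (S.theta τ (ω i) * S.theta τ z).im := by
      rw [hst]
      rcases hpm _ hτ with h | h <;> rw [h] <;> simpa using s3
    rw [Complex.div_re, ← add_div]
    refine div_nonneg ?_ (Complex.normSq_nonneg _)
    refine add_nonneg (mul_nonneg h2.le h1.le) ?_
    simp only [Complex.sub_im, Complex.one_im]
    linarith
  · have hst' : S.theta σ z = -S.theta τ z := by
      rcases hpm _ hσ with h1 | h1 <;> rcases hpm _ hτ with h2 | h2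
      · exact absurd (h1.trans h2.symm) hst
      · rw [h1, h2, neg_neg]
      · rw [h1, h2]
      · exact absurd (h1.trans h2.symm) hst
    have hlim : (S.bInf σ * S.theta σ z / (S.bInf τ * S.theta τ z) : ℂ) =
        ((-(S.bInf σ / S.bInf τ) : ℝ) : ℂ) := by
      have := hsτ.1
      rw [hst']; push_cast; field_simp
    rw [hlim] at hR2
    have h1 : Tendsto (fun i => (R i).re ^ 2) l (𝓝 0) := by
      have h2 := (hR2.norm.add ((Complex.continuous_re.tendsto _).comp hR2)).div_const 2
      have h3 : (‖((-(S.bInf σ / S.bInf τ) : ℝ) : ℂ)‖ +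
          ((-(S.bInf σ / S.bInf τ) : ℝ) : ℂ).re) / 2 = 0 := by
        rw [Complex.norm_real, Complex.ofReal_re, Real.norm_eq_abs, abs_neg,
          abs_of_pos (by positivity)]
        ring
      rw [h3] at h2
      refine h2.congr fun i => ?_
      have h4 := Complex.sq_norm_sub_sq_re (R i)
      rw [norm_pow, Function.comp_apply, sq (R i), Complex.mul_re]
      linarith
    have h2 := h1.eventually_lt_const (show (0 : ℝ) < ε ^ 2 by positivity)
    filter_upwards [h2] with i hi
    exact (abs_le.1 (sq_le_sq₀ (abs_nonneg _) hε.le |>.1 (by rw [sq_abs]; exact hi.le))).1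

end

/-! ### Limits of outgoing solutions are bound states. -/

section

variable {A C : Type*} {S : WebSystem A C} {K : ℕ}

variable (S) in
/-- The function `w` is an eigenvector with eigenvalue `λ(z)` that decays along the channels. -/
structure IsBoundState (K : ℕ) (z : ℂ) (w : A → ℂ) : Prop where
  outgoing : S.IsOutgoing K z w
  apply_eq : ∀ α, S.apply w α = S.lam z * w α
  closed : ∀ σ, w (S.pt σ K) = 0 ∨ ‖S.theta σ z‖ < 1

theorem IsOutgoing.eq_zero_of_le {z : ℂ} {w : A → ℂ} (hK : S.JostNonvanishing K)
    (hw : S.IsOutgoing K z w) (hz0 : z ≠ 0) (hz : ‖z‖ ≤ 1) {σ : C} (h : w (S.pt σ K) = 0)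
    {k : ℕ} (hk : K ≤ k) : w (S.pt σ k) = 0 := by
  rw [hw.eq_div hK hz0 hz σ hk, h, zero_div, zero_mul]

theorem IsBoundState.exists_bound {z : ℂ} {w : A → ℂ} (hK : S.JostNonvanishing K)
    (hw : S.IsBoundState K z w) (hz0 : z ≠ 0) (hz : ‖z‖ ≤ 1) (σ : C) :
    ∃ c r : ℝ, 0 ≤ c ∧ 0 ≤ r ∧ r < 1 ∧ ∀ k, ‖w (S.pt σ k)‖ ≤ c * r ^ k := by
  rcases hw.closed σ with h | h
  -- The values vanish from `K` on, so any ratio below 1 would do; 1/2 is arbitrary.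
  · have hn : 0 ≤ ∑ k ∈ Finset.range K, ‖w (S.pt σ k)‖ / (1 / 2) ^ k :=
      Finset.sum_nonneg fun k _ => by positivity
    refine ⟨_, 1 / 2, hn, by norm_num, by norm_num, fun k => ?_⟩
    rcases lt_or_ge k K with hk | hk
    · rw [← div_le_iff₀ (by positivity)]
      exact Finset.single_le_sum (f := fun k => ‖w (S.pt σ k)‖ / (1 / 2) ^ k)
        (fun k _ => by positivity) (Finset.mem_range.2 hk)
    · rw [hw.outgoing.eq_zero_of_le hK hz0 hz h hk, norm_zero]
      positivity
  · obtain ⟨c, hc, H⟩ := hw.outgoing.exists_bound hK hz0 hz σ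
    exact ⟨c, _, hc, norm_nonneg _, h, H⟩

theorem bounded_of_geometric {c r : ℝ} (hc : 0 ≤ c) (hr0 : 0 ≤ r) (hr1 : r ≤ 1) {x : ℕ → ℂ}
    (h : ∀ k, ‖x k‖ ≤ c * r ^ k) (k : ℕ) : ‖starRingEnd ℂ (x k)‖ ≤ c := by
  rw [RCLike.norm_conj]
  exact (h k).trans (mul_le_of_le_one_right hc (pow_le_one₀ hr0 hr1))

theorem IsBoundState.summable_channel {z : ℂ} {w x : A → ℂ} (hK : S.JostNonvanishing K)
    (hw : S.IsBoundState K z w) (hx : S.IsBoundState K z x) (hz0 : z ≠ 0) (hz : ‖z‖ ≤ 1)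
    (σ : C) : Summable fun k => w (S.pt σ (k + 1)) * starRingEnd ℂ (x (S.pt σ (k + 1))) := by
  obtain ⟨c, r, hc, hr0, hr1, h⟩ := hw.exists_bound hK hz0 hz σ
  obtain ⟨c', r', hc', hr0', hr1', h'⟩ := hx.exists_bound hK hz0 hz σ
  exact summable_mul_of_geometric (x := fun k => w (S.pt σ k))
    (y := fun k => starRingEnd ℂ (x (S.pt σ k))) hr0 hr1 h (bounded_of_geometric hc' hr0' hr1'.le h')

section

variable {ι : Type*} {l : Filter ι} {ω : ι → ℂ} {z : ℂ} {G : ι → A → ℂ} {y : A → ℂ}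

/-- Only `G` has to decay, and it does because ‖θ_σ(ω)‖ < 1 in the open disc. The function `w` is
merely bounded, which allows open and threshold channels at `z`. -/
theorem summable_outgoing_channel {ω z : ℂ} (hω0 : ω ≠ 0) (hω : ‖ω‖ < 1) (hz0 : z ≠ 0)
    (hz : ‖z‖ ≤ 1) (hK : S.JostNonvanishing K) {G w : A → ℂ} (hG : S.IsOutgoing K ω G)
    (hw : S.IsOutgoing K z w) (σ : C) :
    (Summable fun k => G (S.pt σ (k + 1)) * starRingEnd ℂ (w (S.pt σ (k + 1)))) ∧
    Tendsto (S.wronskian σ (fun k => G (S.pt σ k)) fun k => starRingEnd ℂ (w (S.pt σ k)))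
      atTop (𝓝 0) := by
  obtain ⟨c, hc, H⟩ := hG.exists_bound hK hω0 hω.le σ
  obtain ⟨c', hc', H'⟩ := hw.exists_bound hK hz0 hz σ
  have h1 := (theta_spec (S := S) σ hω0 hω.le).norm_lt hω0 hω
  have h2 := (theta_spec (S := S) σ hz0 hz).2.1
  exact ⟨summable_mul_of_geometric (x := fun k => G (S.pt σ k))
      (y := fun k => starRingEnd ℂ (w (S.pt σ k))) (norm_nonneg _) h1 H
      (bounded_of_geometric hc' (norm_nonneg _) h2 H'),
    tendsto_wronskian_zero (norm_nonneg _) h1 H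
      (bounded_of_geometric hc' (norm_nonneg _) h2 H')⟩

theorem tendsto_tail_closed (hz : ‖z‖ ≤ 1) (hz0 : z ≠ 0) (hz1 : z ≠ 1) (hz2 : z ≠ -1)
    (hω : ∀ᶠ i in l, ω i ≠ 0 ∧ ‖ω i‖ < 1 ∧ ω i ≠ z) (h : Tendsto ω l (𝓝 z)) {σ : C}
    (hσ : ‖S.theta σ z‖ < 1) (N : ℕ) :
    Tendsto (fun i => ∑' k, S.e σ (k + N) (ω i) * starRingEnd ℂ (S.e σ (k + N) z)) l
      (𝓝 (∑' k, S.e σ (k + N) z * starRingEnd ℂ (S.e σ (k + N) z))) := by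
  have hs := theta_spec (S := S) σ hz0 hz
  obtain ⟨c, hc, H⟩ := exists_norm_jost_le (S := S) σ
  refine tendsto_tsum_jost_mul σ hs.1 hσ (tendsto_theta σ hz hz0 hz1 hz2
    (hω.mono fun i hi => ⟨hi.1, hi.2.1.le⟩) h) (c := c) (fun k => ?_) N
  exact bounded_of_geometric hc (norm_nonneg _) hs.2.1 (H _ hs.1 hs.2.1) (k + N)

theorem tendsto_coef (hz : ‖z‖ ≤ 1) (hz0 : z ≠ 0) (hz1 : z ≠ 1) (hz2 : z ≠ -1)
    (hK : S.JostNonvanishing K)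
    (hω : ∀ᶠ i in l, ω i ≠ 0 ∧ ‖ω i‖ < 1 ∧ ω i ≠ z) (h : Tendsto ω l (𝓝 z))
    (hy : ∀ α, Tendsto (fun i => G i α) l (𝓝 (y α))) (w : A → ℂ) (σ : C) :
    Tendsto (fun i => (G i (S.pt σ K) / S.e σ K (ω i)) *
        starRingEnd ℂ (w (S.pt σ K) / S.e σ K z)) l
      (𝓝 ((y (S.pt σ K) / S.e σ K z) * starRingEnd ℂ (w (S.pt σ K) / S.e σ K z))) :=
  ((hy _).div (tendsto_e σ hz hz0 hz1 hz2 (hω.mono fun _ hi => ⟨hi.1, hi.2.1.le⟩) h K)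
    (hK.e_ne_zero σ hz0 hz le_rfl)).mul_const _

/-- Either the channel is closed and the Jost pairing converges, or the coefficient of a possibly
divergent tail is identically zero. -/
theorem tendsto_tail (hz : ‖z‖ ≤ 1) (hz0 : z ≠ 0) (hz1 : z ≠ 1) (hz2 : z ≠ -1)
    (hK : S.JostNonvanishing K)
    (hω : ∀ᶠ i in l, ω i ≠ 0 ∧ ‖ω i‖ < 1 ∧ ω i ≠ z) (h : Tendsto ω l (𝓝 z))
    (hy : ∀ α, Tendsto (fun i => G i α) l (𝓝 (y α))) {w : A → ℂ} {σ : C}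
    (hw : w (S.pt σ K) = 0 ∨ ‖S.theta σ z‖ < 1) :
    Tendsto (fun i => (G i (S.pt σ K) / S.e σ K (ω i)) *
        starRingEnd ℂ (w (S.pt σ K) / S.e σ K z) *
          ∑' k, S.e σ (k + (K + 1)) (ω i) * starRingEnd ℂ (S.e σ (k + (K + 1)) z)) l
      (𝓝 ((y (S.pt σ K) / S.e σ K z) * starRingEnd ℂ (w (S.pt σ K) / S.e σ K z) *
          ∑' k, S.e σ (k + (K + 1)) z * starRingEnd ℂ (S.e σ (k + (K + 1)) z))) := by
  rcases hw with h0 | h0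
  · simp [h0, tendsto_const_nhds]
  · exact (tendsto_coef hz hz0 hz1 hz2 hK hω h hy w σ).mul
      (tendsto_tail_closed hz hz0 hz1 hz2 hω h h0 (K + 1))

end

variable [Fintype C]

theorem IsBoundState.summable {z : ℂ} {w x : A → ℂ} (hK : S.JostNonvanishing K)
    (hw : S.IsBoundState K z w) (hx : S.IsBoundState K z x) (hz0 : z ≠ 0) (hz : ‖z‖ ≤ 1) :
    Summable fun α => w α * starRingEnd ℂ (x α) :=
  (S.hasSum_particles (f := fun α => w α * starRingEnd ℂ (x α))
    fun σ => (hw.summable_channel hK hx hz0 hz σ).hasSum).summable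

theorem IsBoundState.sub {z : ℂ} {w x : A → ℂ} 
    (hw : S.IsBoundState K z w) (hx : S.IsBoundState K z x) :
    S.IsBoundState K z fun α => w α - x α where
  outgoing σ k hk := by linear_combination hw.outgoing σ k hk - hx.outgoing σ k hk
  apply_eq α := by
    have hw := hw.apply_eq
    have hx := hx.apply_eq
    rcases S.mem_central_or α with h | ⟨σ, k, rfl⟩
    · have h1 := hw α
      have h2 := hx α
      rw [S.apply_central _ ⟨α, h⟩] at h1 h2 ⊢
      simp only [mul_sub, Finset.sum_sub_distrib] at h1 h2 ⊢
      rw [← h1, ← h2, sub_sub_sub_comm, ← Finset.sum_sub_distrib (s := (Finset.univ : Finset C))]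
      congr 1
      refine Finset.sum_congr rfl fun γ _ => ?_
      split_ifs <;> simp
    · have h1 := hw (S.pt σ (k + 1))
      have h2 := hx (S.pt σ (k + 1))
      rw [S.apply_pt_succ] at h1 h2 ⊢
      linear_combination h1 - h2
  closed σ := by
    rcases hw.closed σ with h | h
    · rcases hx.closed σ with h' | h'
      · left; rw [h, h', sub_zero]
      · exact .inr h'
    · exact .inr h

theorem tendsto_apply {ι : Type*} {l : Filter ι} {G : ι → A → ℂ} {y : A → ℂ}
    (h : ∀ α, Tendsto (fun i => G i α) l (𝓝 (y α))) (α : A) :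
    Tendsto (fun i => S.apply (G i) α) l (𝓝 (S.apply y α)) := by
  rcases S.mem_central_or α with hα | ⟨σ, k, rfl⟩
  · have h1 : ∀ ξ, S.apply ξ α = _ := fun ξ => S.apply_central ξ ⟨α, hα⟩
    simp only [h1]
    refine (tendsto_finsetSum _ fun (β : S.central) _ => (h β).const_mul _).sub
      (tendsto_finsetSum _ fun γ _ => ?_)
    split_ifs
    · exact (h _).const_mul _
    · exact tendsto_const_nhds
  · simp only [S.apply_pt_succ]
    exact (((h _).const_mul _).add ((h _).const_mul _)).sub ((h _).const_mul _)

/-- Isolates the infinite sums: beyond `K` a channel contributes two coefficients times a pairing of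
Jost solutions that does not depend on `G` and `w`. -/
theorem tsum_outgoing {ω z : ℂ} (hω0 : ω ≠ 0) (hω : ‖ω‖ ≤ 1) (hz0 : z ≠ 0) (hz : ‖z‖ ≤ 1)
    (hK : S.JostNonvanishing K) {G w : A → ℂ} (hG : S.IsOutgoing K ω G)
    (hw : S.IsOutgoing K z w) (hsum : ∀ σ, Summable fun k =>
      G (S.pt σ (k + 1)) * starRingEnd ℂ (w (S.pt σ (k + 1)))) :
    ∑' α, G α * starRingEnd ℂ (w α) = ∑ α : S.central, G α * starRingEnd ℂ (w α) +
      ∑ σ, (∑ k ∈ Finset.range K, G (S.pt σ (k + 1)) * starRingEnd ℂ (w (S.pt σ (k + 1))) +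
        (G (S.pt σ K) / S.e σ K ω) * starRingEnd ℂ (w (S.pt σ K) / S.e σ K z) *
          ∑' k, S.e σ (k + (K + 1)) ω * starRingEnd ℂ (S.e σ (k + (K + 1)) z)) := by
  rw [(S.hasSum_particles (f := fun α => G α * starRingEnd ℂ (w α))
    fun σ => (hsum σ).hasSum).tsum_eq]
  congr 1
  refine Finset.sum_congr rfl fun σ _ => ?_
  rw [← (hsum σ).sum_add_tsum_nat_add K, ← tsum_mul_left]
  congr 1
  refine tsum_congr fun k => ?_
  rw [hG.eq_div hK hω0 hω σ (show K ≤ k + K + 1 by omega),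
    hw.eq_div hK hz0 hz σ (show K ≤ k + K + 1 by omega), map_mul, add_assoc]
  ring

variable {ι : Type*} {l : Filter ι} {ω : ι → ℂ} {z : ℂ} {G : ι → A → ℂ} {y : A → ℂ}
  {κ : ι → ℂ} {κ₀ : ℂ} {β : A}

-- Convergence of κ / (ω - z) forces κ → 0, so the source disappears in the limit. Being outgoing is
-- a cross-multiplied identity and passes to limits.
open Classical in
theorem limit_outgoing [l.NeBot] (hz : ‖z‖ ≤ 1) (hz0 : z ≠ 0) (hz1 : z ≠ 1) (hz2 : z ≠ -1)
    (hω : ∀ᶠ i in l, ω i ≠ 0 ∧ ‖ω i‖ < 1 ∧ ω i ≠ z) (h : Tendsto ω l (𝓝 z))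
    (hG : ∀ᶠ i in l, S.IsOutgoing K (ω i) (G i))
    (hs : ∀ᶠ i in l, ∀ α, S.apply (G i) α = S.lam (ω i) * G i α + if α = β then κ i else 0)
    (hκ : Tendsto (fun i => κ i / (ω i - z)) l (𝓝 κ₀))
    (hy : ∀ α, Tendsto (fun i => G i α) l (𝓝 (y α))) :
    S.IsOutgoing K z y ∧ ∀ α, S.apply y α = S.lam z * y α := by
  have hω' : ∀ᶠ i in l, ω i ≠ 0 ∧ ‖ω i‖ ≤ 1 := hω.mono fun i hi => ⟨hi.1, hi.2.1.le⟩
  refine ⟨fun σ k hk => ?_, fun α => ?_⟩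
  · refine tendsto_nhds_unique_of_eventuallyEq
      ((hy _).mul (tendsto_e σ hz hz0 hz1 hz2 hω' h K))
      ((hy _).mul (tendsto_e σ hz hz0 hz1 hz2 hω' h k)) ?_
    filter_upwards [hG] with i hi using hi σ k hk
  · have hκ0 : Tendsto κ l (𝓝 0) := by
      have h1 : Tendsto (fun i => ω i - z) l (𝓝 0) := by simpa using h.sub_const z
      have h2 := hκ.mul h1
      rw [mul_zero] at h2
      refine h2.congr' ?_
      filter_upwards [hω] with i hi
      exact div_mul_cancel₀ _ (sub_ne_zero.2 hi.2.2)
    have hκ1 : Tendsto (fun i => if α = β then κ i else 0) l (𝓝 0) := by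
      split_ifs
      · exact hκ0
      · exact tendsto_const_nhds
    refine tendsto_nhds_unique_of_eventuallyEq (tendsto_apply hy α)
      (by simpa using ((tendsto_lam hz0 h).mul (hy α)).add hκ1) ?_
    filter_upwards [hs] with i hi using hi α

-- Green's formula gives (λ(ω) - λ(z)) ⟨G, w⟩ = -κ conj(w(β)), to be divided by ω - z. Since λ(z) is
-- real, the conjugate of `w` solves the same equation. The function `w` need not be square
-- summable, which is what `limit_closed` exploits.
open Classical in
theorem tendsto_pairing (hz : ‖z‖ ≤ 1) (hz0 : z ≠ 0) (hz1 : z ≠ 1) (hz2 : z ≠ -1)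
    (hK : S.JostNonvanishing K) (hlam : (S.lam z).im = 0)
    (hω : ∀ᶠ i in l, ω i ≠ 0 ∧ ‖ω i‖ < 1 ∧ ω i ≠ z) (h : Tendsto ω l (𝓝 z))
    (hG : ∀ᶠ i in l, S.IsOutgoing K (ω i) (G i))
    (hs : ∀ᶠ i in l, ∀ α, S.apply (G i) α = S.lam (ω i) * G i α + if α = β then κ i else 0)
    (hκ : Tendsto (fun i => κ i / (ω i - z)) l (𝓝 κ₀)) {w : A → ℂ} (hw : S.IsOutgoing K z w)
    (hw' : ∀ α, S.apply w α = S.lam z * w α) :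
    Tendsto (fun i => ∑' α, G i α * starRingEnd ℂ (w α)) l
      (𝓝 (-(κ₀ * starRingEnd ℂ (w β) / S.lamDeriv z))) := by
  have h1 := tendsto_lam_slope (S := S) hz0 (hω.mono fun i hi => hi.2.2) h
  have hne := S.lamDeriv_ne_zero hz1 hz2
  refine Tendsto.congr' ?_ ((hκ.mul_const (starRingEnd ℂ (w β))).div h1 hne).neg
  filter_upwards [hω, hG, hs, h1.eventually_ne hne] with i hi hGi hsi hnei
  have hwc : ∀ α, S.apply (fun α => starRingEnd ℂ (w α)) α =
      S.lam z * starRingEnd ℂ (w α) := fun α => by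
    rw [apply_conj, hw', map_mul, Complex.conj_eq_iff_im.2 hlam]
  have hg := S.green_tsum hsi hwc
    (fun σ => (summable_outgoing_channel hi.1 hi.2.1 hz0 hz hK hGi hw σ).1)
    (fun σ => (summable_outgoing_channel hi.1 hi.2.1 hz0 hz hK hGi hw σ).2)
  have hd : ω i - z ≠ 0 := sub_ne_zero.2 hi.2.2
  have hl : S.lam (ω i) - S.lam z ≠ 0 := fun h0 => by simp [h0] at hnei
  simp only [Pi.div_apply]
  field_simp
  linear_combination -hg

/-- The limit of the pairings with a bound state. -/
theorem tendsto_pairing_boundState (hz : ‖z‖ ≤ 1) (hz0 : z ≠ 0) (hz1 : z ≠ 1) (hz2 : z ≠ -1)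
    (hK : S.JostNonvanishing K)
    (hω : ∀ᶠ i in l, ω i ≠ 0 ∧ ‖ω i‖ < 1 ∧ ω i ≠ z) (h : Tendsto ω l (𝓝 z))
    (hG : ∀ᶠ i in l, S.IsOutgoing K (ω i) (G i))
    (hy : ∀ α, Tendsto (fun i => G i α) l (𝓝 (y α))) {w : A → ℂ}
    (hyb : S.IsBoundState K z y) (hw : S.IsBoundState K z w) :
    Tendsto (fun i => ∑' α, G i α * starRingEnd ℂ (w α)) l
      (𝓝 (∑' α, y α * starRingEnd ℂ (w α))) := by
  rw [tsum_outgoing hz0 hz hz0 hz hK hyb.outgoing hw.outgoing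
    (hyb.summable_channel hK hw hz0 hz)]
  refine Tendsto.congr' (f₁ := fun i => ∑ α : S.central, G i α * starRingEnd ℂ (w α) +
      ∑ σ, (∑ k ∈ Finset.range K, G i (S.pt σ (k + 1)) * starRingEnd ℂ (w (S.pt σ (k + 1))) +
        (G i (S.pt σ K) / S.e σ K (ω i)) * starRingEnd ℂ (w (S.pt σ K) / S.e σ K z) *
          ∑' k, S.e σ (k + (K + 1)) (ω i) * starRingEnd ℂ (S.e σ (k + (K + 1)) z))) ?_ ?_
  · filter_upwards [hω, hG] with i hi hGi
    rw [tsum_outgoing hi.1 hi.2.1.le hz0 hz hK hGi hw.outgoing fun σ =>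
      (summable_outgoing_channel hi.1 hi.2.1 hz0 hz hK hGi hw.outgoing σ).1]
  · refine (tendsto_finsetSum _ fun (α : S.central) _ => (hy α).mul_const _).add
      (tendsto_finsetSum _ fun σ _ => ?_)
    exact (tendsto_finsetSum _ fun k _ => (hy _).mul_const _).add
      (tendsto_tail hz hz0 hz1 hz2 hK hω h hy (hw.closed σ))

open Classical in
/-- The limit of outgoing solutions has no threshold component. -/
theorem limit_closed [l.NeBot] (hz : ‖z‖ ≤ 1) (hz0 : z ≠ 0) (hz1 : z ≠ 1) (hz2 : z ≠ -1)
    (hK : S.JostNonvanishing K) (hlam : (S.lam z).im = 0)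
    (hω : ∀ᶠ i in l, ω i ≠ 0 ∧ ‖ω i‖ < 1 ∧ ω i ≠ z) (h : Tendsto ω l (𝓝 z))
    (hG : ∀ᶠ i in l, S.IsOutgoing K (ω i) (G i))
    (hs : ∀ᶠ i in l, ∀ α, S.apply (G i) α = S.lam (ω i) * G i α + if α = β then κ i else 0)
    (hκ : Tendsto (fun i => κ i / (ω i - z)) l (𝓝 κ₀))
    (hy : ∀ α, Tendsto (fun i => G i α) l (𝓝 (y α))) (τ : C) :
    y (S.pt τ K) = 0 ∨ ‖S.theta τ z‖ < 1 := by
  obtain ⟨hout, happ⟩ := limit_outgoing hz hz0 hz1 hz2 hω h hG hs hκ hy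
  by_contra! hτ
  obtain ⟨hτ0, hτ1⟩ := hτ
  have hω' : ∀ᶠ i in l, ω i ≠ 0 ∧ ‖ω i‖ ≤ 1 := hω.mono fun i hi => ⟨hi.1, hi.2.1.le⟩
  -- on each channel the limit vanishes, or the channel is closed, or there is a threshold
  have htri : ∀ σ, (y (S.pt σ K) = 0 ∨ ‖S.theta σ z‖ < 1) ∨
      ((S.theta σ z).im = 0 ∧ S.theta σ z ^ 2 = 1) := fun σ => by
    by_cases h0 : y (S.pt σ K) = 0 ∨ ‖S.theta σ z‖ < 1
    · exact .inl h0
    · push Not at h0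
      have him := (hout.eq_zero_or_im_eq_zero hz hz0 hz1 hz2 hK hlam happ σ).resolve_left h0.1
      have hn := le_antisymm (theta_spec (S := S) σ hz0 hz).2.1 h0.2
      refine .inr ⟨him, ?_⟩
      have h1 := inv_eq_conj hn
      rw [Complex.conj_eq_iff_im.2 him] at h1
      rw [sq]
      nth_rewrite 2 [← h1]
      exact mul_inv_cancel₀ (theta_spec (S := S) σ hz0 hz).1
  have hτs : (S.theta τ z).im = 0 ∧ S.theta τ z ^ 2 = 1 :=
    (htri τ).resolve_left (by push Not; exact ⟨hτ0, hτ1⟩)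
  set Q : ι → ℂ := fun i => ∑' α, G i α * starRingEnd ℂ (y α) with hQ
  have hQlim := tendsto_pairing hz hz0 hz1 hz2 hK hlam hω h hG hs hκ hout happ
  -- The pairing `Q` of `G` with `y` converges by Green's formula, although the tails on threshold
  -- channels diverge. After multiplication by `d`, which tends to 0, only the threshold terms can
  -- survive, and their sum must tend to 0.
  set d : ι → ℂ := fun i => 1 - S.theta τ (ω i) * S.theta τ z with hd
  have hd0 : Tendsto d l (𝓝 0) := by
    have := ((tendsto_theta (S := S) τ hz hz0 hz1 hz2 hω' h).mul_const (S.theta τ z)).const_sub 1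
    rwa [← sq, hτs.2, sub_self] at this
  set c : C → ι → ℂ := fun σ i => (G i (S.pt σ K) / S.e σ K (ω i)) *
        starRingEnd ℂ (y (S.pt σ K) / S.e σ K z) with hc
  set t : C → ι → ℂ := fun σ i =>
    ∑' k, S.e σ (k + (K + 1)) (ω i) * starRingEnd ℂ (S.e σ (k + (K + 1)) z) with ht
  have hclim : ∀ σ, Tendsto (c σ) l (𝓝 ((‖y (S.pt σ K) / S.e σ K z‖ ^ 2 : ℝ) : ℂ)) := fun σ => by
    have := tendsto_coef hz hz0 hz1 hz2 hK hω h hy y σ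
    rwa [Complex.mul_conj, Complex.normSq_eq_norm_sq] at this
  have hdec : ∀ᶠ i in l, d i * Q i = d i * (∑ α : S.central, G i α * starRingEnd ℂ (y α) +
      ∑ σ, ∑ k ∈ Finset.range K, G i (S.pt σ (k + 1)) * starRingEnd ℂ (y (S.pt σ (k + 1)))) +
      ∑ σ, d i * (c σ i * t σ i) := by
    filter_upwards [hω, hG] with i hi hGi
    rw [hQ]
    simp only
    rw [tsum_outgoing hi.1 hi.2.1.le hz0 hz hK hGi hout fun σ =>
      (summable_outgoing_channel hi.1 hi.2.1 hz0 hz hK hGi hout σ).1, Finset.sum_add_distrib,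
      ← Finset.mul_sum]
    ring
  have hsum0 : Tendsto (fun i => ∑ σ, d i * (c σ i * t σ i)) l (𝓝 0) := by
    have h1 := hd0.mul hQlim
    have h2 := hd0.mul (((tendsto_finsetSum (Finset.univ : Finset S.central) fun α _ =>
      (hy α).mul_const (starRingEnd ℂ (y α)))).add (tendsto_finsetSum (Finset.univ : Finset C)
        fun σ _ => tendsto_finsetSum (Finset.range K) fun k _ =>
        (hy (S.pt σ (k + 1))).mul_const (starRingEnd ℂ (y (S.pt σ (k + 1))))))
    have h3 := h1.sub h2
    rw [zero_mul, zero_mul, sub_zero] at h3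
    refine h3.congr' ?_
    filter_upwards [hdec] with i hi
    change d i * Q i - _ = _
    rw [hi]; ring
  -- the threshold terms
  have hthr : ∀ σ, (S.theta σ z).im = 0 → S.theta σ z ^ 2 = 1 →
      Tendsto (fun i => c σ i * ((1 - S.theta σ (ω i) * S.theta σ z) * t σ i)) l
        (𝓝 ((‖y (S.pt σ K) / S.e σ K z‖ ^ 2 : ℝ) : ℂ)) := by
    intro σ him hsq
    have h1 := tendsto_threshold_tsum (S := S) σ hsq (hω.mono fun i hi =>
      ⟨(theta_spec (S := S) σ hi.1 hi.2.1.le).1,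
        (theta_spec (S := S) σ hi.1 hi.2.1.le).norm_lt hi.1 hi.2.1⟩)
      (tendsto_theta (S := S) σ hz hz0 hz1 hz2 hω' h) (K + 1)
    have h2 := (hclim σ).mul h1
    rw [mul_one] at h2
    refine h2.congr fun i => ?_
    simp only [ht, conj_e_of_im_eq_zero σ hz0 hz him]
    rfl
  -- No cancellation is possible: on a threshold channel the term behaves like |coefficient|² times
  -- the ratio of `threshold_ratio`, whose real part is asymptotically nonnegative, and the other
  -- terms tend to 0.
  have hlow : ∀ σ, ∀ ε > 0, ∀ᶠ i in l, -ε ≤ (d i * (c σ i * t σ i)).re := by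
    intro σ ε hε
    rcases htri σ with h0 | ⟨him, hsq⟩
    · have h1 := hd0.mul (tendsto_tail hz hz0 hz1 hz2 hK hω h hy h0)
      rw [zero_mul] at h1
      have h2 := (Complex.continuous_re.tendsto _).comp h1
      exact h2.eventually_const_le (by simpa using hε)
    · obtain ⟨hb, hre⟩ := threshold_ratio (S := S) (σ := σ) (τ := τ) hz hz0 hz1 hz2 hω h hsq hτs.2
      set R : ι → ℂ := fun i => (1 - S.theta τ (ω i) * S.theta τ z) /
        (1 - S.theta σ (ω i) * S.theta σ z) with hR
      set c₀ := ‖y (S.pt σ K) / S.e σ K z‖ ^ 2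
      have hc₀ : 0 ≤ c₀ := sq_nonneg _
      have h1 : Tendsto (fun i => (c σ i * ((1 - S.theta σ (ω i) * S.theta σ z) * t σ i) - c₀) *
          R i) l (𝓝 0) := by
        refine Tendsto.zero_mul_isBoundedUnder_le ?_ hb
        have h7 := (hthr σ him hsq).sub_const (c₀ : ℂ)
        rwa [sub_self] at h7
      have h2 := ((Complex.continuous_re.tendsto _).comp h1).eventually_const_le
        (show -(ε / 2) < (0 : ℂ).re by simpa using hε)
      filter_upwards [h2, hre (ε / (2 * (c₀ + 1))) (by positivity), hω] with i h3 h4 hi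
      have hne : 1 - S.theta σ (ω i) * S.theta σ z ≠ 0 := fun h0 => by
        have e1 := (theta_spec (S := S) σ hi.1 hi.2.1.le).norm_lt hi.1 hi.2.1
        have e2 := (theta_spec (S := S) σ hz0 hz).2.1
        have e3 := congrArg norm (sub_eq_zero.1 h0)
        rw [norm_one, norm_mul] at e3
        nlinarith [norm_nonneg (S.theta σ (ω i)), norm_nonneg (S.theta σ z)]
      have heq : d i * (c σ i * t σ i) =
          (c σ i * ((1 - S.theta σ (ω i) * S.theta σ z) * t σ i) - c₀) * R i + c₀ * R i := by
        simp only [hR, hd]; field_simp; ring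
      rw [heq, Complex.add_re, Complex.re_ofReal_mul]
      have h5 : -(ε / 2) ≤ c₀ * (R i).re := by
        have e1 : -(ε / (2 * (c₀ + 1))) ≤ (R i).re := h4
        have e2 : c₀ * (-(ε / (2 * (c₀ + 1)))) ≤ c₀ * (R i).re :=
          mul_le_mul_of_nonneg_left e1 hc₀
        have e3 : c₀ * (ε / (2 * (c₀ + 1))) ≤ ε / 2 := by
          rw [mul_div_assoc', div_le_div_iff₀ (by positivity) (by positivity)]
          nlinarith
        linarith
      have h6 : -(ε / 2) ≤ ((c σ i * ((1 - S.theta σ (ω i) * S.theta σ z) * t σ i) - c₀) *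
          R i).re := h3
      linarith
  have hτlim : Tendsto (fun i => (d i * (c τ i * t τ i)).re) l
      (𝓝 (‖y (S.pt τ K) / S.e τ K z‖ ^ 2)) := by
    have h1 := (Complex.continuous_re.tendsto _).comp (hthr τ hτs.1 hτs.2)
    rw [Complex.ofReal_re] at h1
    refine h1.congr fun i => ?_
    simp only [Function.comp_apply, hd]
    congr 1; ring
  have hpos : 0 < ‖y (S.pt τ K) / S.e τ K z‖ ^ 2 := by
    have := norm_pos_iff.2 (div_ne_zero hτ0 (hK.e_ne_zero τ hz0 hz le_rfl))
    positivity
  set p := ‖y (S.pt τ K) / S.e τ K z‖ ^ 2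
  -- The term of `τ` eventually exceeds p/2 and the others together are at least -p/4, while the
  -- total is at most p/8.
  have hn : (0 : ℝ) < 4 * (Fintype.card C + 1) := by positivity
  have e1 := hτlim.eventually_const_le (show p / 2 < p by linarith)
  have e2 := ((Complex.continuous_re.tendsto _).comp hsum0).eventually_le_const
    (show (0 : ℂ).re < p / 8 by simpa using by positivity)
  have e3 := eventually_all.2 fun σ => hlow σ (p / (4 * (Fintype.card C + 1))) (by positivity)
  obtain ⟨i, h1, h2, h3⟩ := (e1.and (e2.and e3)).exists
  have h4 : (∑ σ, d i * (c σ i * t σ i)).re ≤ p / 8 := h2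
  rw [Complex.re_sum, ← Finset.add_sum_erase _ _ (Finset.mem_univ τ)] at h4
  have h5 : -(p / 4) ≤ ∑ σ ∈ Finset.univ.erase τ, (d i * (c σ i * t σ i)).re := by
    have h6 := Finset.card_nsmul_le_sum (Finset.univ.erase τ)
      (fun σ => (d i * (c σ i * t σ i)).re) _ fun σ _ => h3 σ
    refine le_trans ?_ h6
    rw [nsmul_eq_mul, mul_neg, neg_le_neg_iff, mul_div_assoc', div_le_div_iff₀ hn (by norm_num)]
    have h7 : ((Finset.univ.erase τ).card : ℝ) ≤ Fintype.card C := by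
      exact_mod_cast Finset.card_le_univ _
    nlinarith
  linarith

open Classical in
/-- Limits of outgoing solutions near `z` are bound states, determined by their sources. -/
theorem limit_boundState [l.NeBot] (hz : ‖z‖ ≤ 1) (hz0 : z ≠ 0) (hz1 : z ≠ 1) (hz2 : z ≠ -1)
    (hK : S.JostNonvanishing K)
    (hω : ∀ᶠ i in l, ω i ≠ 0 ∧ ‖ω i‖ < 1 ∧ ω i ≠ z) (h : Tendsto ω l (𝓝 z))
    (hG : ∀ᶠ i in l, S.IsOutgoing K (ω i) (G i))
    (hs : ∀ᶠ i in l, ∀ α, S.apply (G i) α = S.lam (ω i) * G i α + if α = β then κ i else 0)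
    (hκ : Tendsto (fun i => κ i / (ω i - z)) l (𝓝 κ₀))
    (hy : ∀ α, Tendsto (fun i => G i α) l (𝓝 (y α))) :
    S.IsBoundState K z y ∧ ∀ w, S.IsBoundState K z w →
      ∑' α, y α * starRingEnd ℂ (w α) = -(κ₀ * starRingEnd ℂ (w β) / S.lamDeriv z) := by
  obtain ⟨hout, happ⟩ := limit_outgoing hz hz0 hz1 hz2 hω h hG hs hκ hy
  by_cases hlam : (S.lam z).im = 0
  · have hyb : S.IsBoundState K z y :=
      ⟨hout, happ, limit_closed hz hz0 hz1 hz2 hK hlam hω h hG hs hκ hy⟩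
    refine ⟨hyb, fun w hw => tendsto_nhds_unique
      (tendsto_pairing_boundState hz hz0 hz1 hz2 hK hω h hG hy hyb hw)
      (tendsto_pairing hz hz0 hz1 hz2 hK hlam hω h hG hs hκ hw.outgoing hw.apply_eq)⟩
  -- For nonreal λ(z) every outgoing solution is zero, and the pairing identity reads 0 = 0.
  · have h0 : ∀ w, S.IsOutgoing K z w → (∀ α, S.apply w α = S.lam z * w α) → w = 0 :=
      fun w h1 h2 => h1.eq_zero_of_lam_im_ne_zero hz hz0 hK hlam h2
    obtain rfl := h0 y hout happ
    refine ⟨⟨hout, happ, fun σ => .inl rfl⟩, fun w hw => ?_⟩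
    obtain rfl := h0 w hw.outgoing hw.apply_eq
    simp

end

/-! ### The a priori estimate and existence of residues. -/

section

variable {A C : Type*} {S : WebSystem A C} {K : ℕ}

variable (S) in
/-- The central part together with the first `K + 1` particles of each channel. -/
def finitePart (K : ℕ) : Set A := {α | α ∈ S.central ∨ ∃ σ, ∃ k ≤ K, S.pt σ k = α}

theorem IsOutgoing.smul {ω : ℂ} {g : A → ℂ} (hg : S.IsOutgoing K ω g) (c : ℂ) :
    S.IsOutgoing K ω fun α => c * g α := fun σ k hk => by
  linear_combination c * hg σ k hk

/-- From `K` on an outgoing function is its value at `K` times a quotient of Jost solutions, which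
is continuous in `ω`. Convergence on a finite set of particles therefore suffices, and compactness
in finite dimension applies. -/
theorem exists_limit {ι : Type*} {l : Filter ι} {ω : ι → ℂ} {z : ℂ} {G : ι → A → ℂ} (hz : ‖z‖ ≤ 1)
    (hz0 : z ≠ 0) (hz1 : z ≠ 1) (hz2 : z ≠ -1) (hK : S.JostNonvanishing K)
    (hω : ∀ᶠ i in l, ω i ≠ 0 ∧ ‖ω i‖ < 1 ∧ ω i ≠ z) (h : Tendsto ω l (𝓝 z))
    (hG : ∀ᶠ i in l, S.IsOutgoing K (ω i) (G i))
    (hF : ∀ α ∈ S.finitePart K, ∃ a, Tendsto (fun i => G i α) l (𝓝 a)) :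
    ∃ y : A → ℂ, ∀ α, Tendsto (fun i => G i α) l (𝓝 (y α)) := by
  have hω' : ∀ᶠ i in l, ω i ≠ 0 ∧ ‖ω i‖ ≤ 1 := hω.mono fun i hi => ⟨hi.1, hi.2.1.le⟩
  suffices ∀ α, ∃ a, Tendsto (fun i => G i α) l (𝓝 a) by
    choose y hy using this
    exact ⟨y, hy⟩
  intro α
  by_cases hα : α ∈ S.finitePart K
  · exact hF α hα
  rcases S.mem_central_or α with h1 | ⟨σ, k, rfl⟩
  · exact absurd (.inl h1) hα
  have hk : K ≤ k + 1 := by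
    by_contra hk
    exact hα (.inr ⟨σ, k + 1, by omega, rfl⟩)
  obtain ⟨a, ha⟩ := hF (S.pt σ K) (.inr ⟨σ, K, le_rfl, rfl⟩)
  refine ⟨_, Tendsto.congr' ?_ ((ha.div (tendsto_e σ hz hz0 hz1 hz2 hω' h K)
    (hK.e_ne_zero σ hz0 hz le_rfl)).mul (tendsto_e (S := S) σ hz hz0 hz1 hz2 hω' h (k + 1)))⟩
  filter_upwards [hω', hG] with i hi hGi
  exact (hGi.eq_div hK hi.1 hi.2 σ hk).symm

theorem solution_smul {g : A → ℂ} {μ κ : ℂ} {p : A → Prop} [DecidablePred p]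
    (hg : ∀ α, S.apply g α = μ * g α + if p α then κ else 0) (c : ℂ) (α : A) :
    S.apply (fun α => c * g α) α = μ * (c * g α) + if p α then c * κ else 0 := by
  have h : S.apply (fun α => c * g α) α = c * S.apply g α := by
    rw [apply, apply, mul_finsum]
    exact finsum_congr fun β => by ring
  rw [h, hg]; split_ifs <;> ring

variable [Fintype C]

theorem finite_finitePart (K : ℕ) : (S.finitePart K).Finite := by
  have h1 : (⋃ σ : C, ⋃ k ∈ Set.Iic K, {S.pt σ k}).Finite :=
    Set.finite_iUnion fun σ => (Set.finite_Iic K).biUnion fun k _ => Set.finite_singleton _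
  refine (S.finite_central.union h1).subset ?_
  rintro α (h | ⟨σ, k, hk, rfl⟩)
  · exact .inl h
  · exact .inr (by simp; exact ⟨σ, k, hk, rfl⟩)

noncomputable instance : Fintype (S.finitePart K) := (finite_finitePart K).fintype

open Classical in
/-- A priori estimate for outgoing solutions with a source at `β`, near `z`. -/
theorem apriori (hK : S.JostNonvanishing K) {z : ℂ} (hz : ‖z‖ ≤ 1)
    (hz0 : z ≠ 0) (hz1 : z ≠ 1) (hz2 : z ≠ -1) (β : A) :
    ∃ c : ℝ, 0 ≤ c ∧ ∀ᶠ ω in discNhds z, ∀ (g : A → ℂ) (κ : ℂ), S.IsOutgoing K ω g →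
      (∀ α, S.apply g α = S.lam ω * g α + if α = β then κ else 0) →
      ∀ α ∈ S.finitePart K, ‖ω - z‖ * ‖g α‖ ≤ c * ‖κ‖ := by
  by_contra! hcon
  have hex : ∀ n : ℕ, ∃ (ω : ℂ) (g : A → ℂ) (κ : ℂ) (α : A), (ω ≠ 0 ∧ ‖ω‖ < 1 ∧ ω ≠ z) ∧
      ‖ω - z‖ < 1 / ((n : ℝ) + 1) ∧ S.IsOutgoing K ω g ∧
      (∀ α, S.apply g α = S.lam ω * g α + if α = β then κ else 0) ∧ α ∈ S.finitePart K ∧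
      ((n : ℝ) + 1) * ‖κ‖ < ‖ω - z‖ * ‖g α‖ := by
    intro n
    have h1 : ∀ᶠ ω in discNhds z, ‖ω - z‖ < 1 / ((n : ℝ) + 1) := by
      have := (tendsto_id_discNhds z).eventually (ball_mem_nhds z (ε := 1 / ((n : ℝ) + 1))
        (by positivity))
      filter_upwards [this] with ω hω
      rwa [dist_eq_norm] at hω
    obtain ⟨ω, ⟨g, κ, hg, hs, α, hα, hlt⟩, h2, h3⟩ :=
      ((hcon (n + 1) (by positivity)).and_eventually ((eventually_discNhds hz0).and h1)).exists
    exact ⟨ω, g, κ, α, h2, h3, hg, hs, hα, hlt⟩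
  choose ω g κ α hω hωn hg hs hα hlt using hex
  have hωz : Tendsto ω atTop (𝓝 z) := by
    rw [tendsto_iff_norm_sub_tendsto_zero]
    exact squeeze_zero (fun _ => norm_nonneg _) (fun n => (hωn n).le)
      tendsto_one_div_add_atTop_nhds_zero_nat
  -- Dividing by the supremum on the finite part keeps the limit nonzero, while the negated estimate
  -- makes the rescaled sources o(ω - z).
  set N : ℕ → ℝ := fun n => ‖fun α : S.finitePart K => g n α‖ with hN
  have hle : ∀ n, ‖g n (α n)‖ ≤ N n := fun n =>
    norm_le_pi_norm (fun α : S.finitePart K => g n α) ⟨α n, hα n⟩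
  have hNpos : ∀ n, 0 < N n := fun n => by
    refine lt_of_lt_of_le ?_ (hle n)
    have h1 : 0 < ‖ω n - z‖ * ‖g n (α n)‖ := lt_of_le_of_lt (by positivity) (hlt n)
    exact pos_of_mul_pos_right h1 (norm_nonneg _)
  set G : ℕ → A → ℂ := fun n α => ((N n)⁻¹ : ℝ) * g n α with hG
  have hx : ∀ n, (fun α : S.finitePart K => G n α) ∈ sphere (0 : S.finitePart K → ℂ) 1 := by
    intro n
    have : (fun α : S.finitePart K => G n α) =
        ((N n)⁻¹ : ℝ) • fun α : S.finitePart K => g n α := by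
      funext α; simp [hG]
    rw [mem_sphere_zero_iff_norm, this, norm_smul, Real.norm_eq_abs,
      abs_of_pos (inv_pos.2 (hNpos n))]
    exact inv_mul_cancel₀ (hNpos n).ne'
  obtain ⟨a, ha, φ, hφ, hlim⟩ := (isCompact_sphere _ _).tendsto_subseq hx
  have hφ' := hφ.tendsto_atTop
  have hω'' : ∀ᶠ i in atTop, (ω ∘ φ) i ≠ 0 ∧ ‖(ω ∘ φ) i‖ < 1 ∧ (ω ∘ φ) i ≠ z :=
    .of_forall fun i => hω (φ i)
  have hGo : ∀ᶠ i in atTop, S.IsOutgoing K ((ω ∘ φ) i) ((G ∘ φ) i) :=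
    .of_forall fun i => (hg (φ i)).smul _
  obtain ⟨y, hy⟩ := exists_limit hz hz0 hz1 hz2 hK hω'' (hωz.comp hφ') hGo fun α hα =>
    ⟨a ⟨α, hα⟩, (tendsto_pi_nhds.1 hlim) ⟨α, hα⟩⟩
  have hya : ∀ α : S.finitePart K, y α = a α := fun α =>
    tendsto_nhds_unique (hy α) ((tendsto_pi_nhds.1 hlim) α)
  have hκ : Tendsto (fun n => (((N n)⁻¹ : ℝ) * κ n) / (ω n - z)) atTop (𝓝 0) := by
    refine squeeze_zero_norm (fun n => ?_) tendsto_one_div_add_atTop_nhds_zero_nat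
    have h1 : 0 < ‖ω n - z‖ := norm_pos_iff.2 (sub_ne_zero.2 (hω n).2.2)
    have h2 : ((n : ℝ) + 1) * ‖κ n‖ ≤ ‖ω n - z‖ * N n :=
      (hlt n).le.trans (by gcongr; exact hle n)
    rw [norm_div, norm_mul, Complex.norm_real, Real.norm_eq_abs,
      abs_of_pos (inv_pos.2 (hNpos n)), inv_mul_eq_div, div_div,
      div_le_div_iff₀ (mul_pos (hNpos n) h1) (by positivity)]
    linarith
  obtain ⟨hb, hpair⟩ := limit_boundState (β := β) hz hz0 hz1 hz2 hK hω'' (hωz.comp hφ') hGo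
    (.of_forall fun i => solution_smul (hs (φ i)) _) (hκ.comp hφ') hy
  -- The limiting source coefficient is 0, so `y` is orthogonal to itself.
  have h0 := hpair y hb
  rw [zero_mul, zero_div, neg_zero] at h0
  have hy0 := eq_zero_of_tsum_mul_conj (hb.summable hK hb hz0 hz) h0
  have ha0 : a = 0 := by
    funext α
    rw [← hya, hy0]; rfl
  rw [ha0] at ha
  simp at ha

open Classical in
/-- The residue at `z` of a family of outgoing solutions with a fixed source. -/
theorem exists_residue (hK : S.JostNonvanishing K) {z : ℂ} (hz : ‖z‖ ≤ 1)
    (hz0 : z ≠ 0) (hz1 : z ≠ 1) (hz2 : z ≠ -1) {β : A} {g : ℂ → A → ℂ} {κ : ℂ → ℂ} {κ₀ : ℂ}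
    (hg : ∀ᶠ ω in discNhds z, S.IsOutgoing K ω (g ω))
    (hs : ∀ᶠ ω in discNhds z, ∀ α,
      S.apply (g ω) α = S.lam ω * g ω α + if α = β then κ ω else 0)
    (hκ : Tendsto κ (discNhds z) (𝓝 κ₀)) :
    ∃ φ, (∀ α, Tendsto (fun ω => (ω - z) * g ω α) (discNhds z) (𝓝 (φ α))) ∧
      S.IsBoundState K z φ ∧
      ∑' α, φ α * starRingEnd ℂ (φ α) = -(κ₀ * starRingEnd ℂ (φ β) / S.lamDeriv z) := by
  have hne := discNhds_neBot hz
  have hω := eventually_discNhds hz0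
  have hid := tendsto_id_discNhds z
  obtain ⟨c, hc, hap⟩ := apriori hK hz hz0 hz1 hz2 β
  set G : ℂ → A → ℂ := fun ω α => (ω - z) * g ω α with hG
  have hGo : ∀ᶠ ω in discNhds z, S.IsOutgoing K (id ω) (G ω) := hg.mono fun ω h => h.smul _
  have hGs : ∀ᶠ ω in discNhds z, ∀ α,
      S.apply (G ω) α = S.lam (id ω) * G ω α + if α = β then (ω - z) * κ ω else 0 :=
    hs.mono fun ω h => solution_smul h _
  have hκ' : Tendsto (fun ω => (ω - z) * κ ω / (id ω - z)) (discNhds z) (𝓝 κ₀) := by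
    refine hκ.congr' ?_
    filter_upwards [hω] with ω h
    rw [id, mul_div_cancel_left₀ _ (sub_ne_zero.2 h.2.2)]
  set x : ℂ → S.finitePart K → ℂ := fun ω α => G ω α with hx
  have hxb : ∀ᶠ ω in discNhds z, x ω ∈ closedBall (0 : S.finitePart K → ℂ) (c * (‖κ₀‖ + 1)) := by
    filter_upwards [hap, hg, hs, hκ.norm.eventually_le_const (lt_add_one _)] with ω h1 h2 h3 h4
    rw [mem_closedBall_zero_iff, pi_norm_le_iff_of_nonneg (by positivity)]
    intro α
    rw [hx, norm_mul]
    exact (h1 _ _ h2 h3 α α.2).trans (by gcongr)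
  -- Every cluster point extends to a bound state, whose pairings with all bound states are
  -- prescribed by the source alone.
  have key : ∀ U : Ultrafilter ℂ, (U : Filter ℂ) ≤ discNhds z → ∀ a, Tendsto x U (𝓝 a) →
      ∃ y : A → ℂ, (∀ α : S.finitePart K, y α = a α) ∧
        (∀ α, Tendsto (fun ω => G ω α) U (𝓝 (y α))) ∧ S.IsBoundState K z y ∧
        ∀ w, S.IsBoundState K z w →
          ∑' α, y α * starRingEnd ℂ (w α) = -(κ₀ * starRingEnd ℂ (w β) / S.lamDeriv z) := by
    intro U hU a ha
    obtain ⟨y, hy⟩ := exists_limit hz hz0 hz1 hz2 hK (hU hω) (hid.mono_left hU) (hU hGo)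
      fun α hα => ⟨a ⟨α, hα⟩, (tendsto_pi_nhds.1 ha) ⟨α, hα⟩⟩
    exact ⟨y, fun α => tendsto_nhds_unique (hy α) ((tendsto_pi_nhds.1 ha) α), hy,
      limit_boundState hz hz0 hz1 hz2 hK (hU hω) (hid.mono_left hU) (hU hGo) (hU hGs)
        (hκ'.mono_left hU) hy⟩
  obtain ⟨a, -, ha⟩ := (isCompact_closedBall (0 : S.finitePart K → ℂ)
    (c * (‖κ₀‖ + 1))).exists_mapClusterPt (le_principal_iff.2 (mem_map.2 hxb))
  obtain ⟨U, hU, hUa⟩ := mapClusterPt_iff_ultrafilter.1 ha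
  obtain ⟨y, hya, -, hyb, hyp⟩ := key U hU a hUa
  have hlim : Tendsto x (discNhds z) (𝓝 a) := by
    refine (isCompact_closedBall _ _).tendsto_nhds_of_unique_mapClusterPt hxb fun a' _ ha' => ?_
    obtain ⟨V, hV, hVa⟩ := mapClusterPt_iff_ultrafilter.1 ha'
    obtain ⟨y', hya', -, hyb', hyp'⟩ := key V hV a' hVa
    -- The difference of two cluster points is a bound state orthogonal to all bound states, itself
    -- included.
    have hd := hyb'.sub hyb
    have h1 := hd.summable hK hd hz0 hz
    have h2 : ∑' α, (y' α - y α) * starRingEnd ℂ (y' α - y α) = 0 := by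
      have e1 := hyp _ hd
      have e2 := hyp' _ hd
      have e3 := (hyb'.summable hK hd hz0 hz).tsum_sub (hyb.summable hK hd hz0 hz)
      rw [e1, e2, sub_self] at e3
      rw [← e3]
      exact tsum_congr fun α => by ring
    have h3 := eq_zero_of_tsum_mul_conj h1 h2
    funext α
    rw [← hya, ← hya']
    exact sub_eq_zero.1 (congrFun h3 α)
  obtain ⟨φ, hφ⟩ := exists_limit hz hz0 hz1 hz2 hK hω hid hGo
    fun α hα => ⟨a ⟨α, hα⟩, (tendsto_pi_nhds.1 hlim) ⟨α, hα⟩⟩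
  obtain ⟨hb, hp⟩ := limit_boundState hz hz0 hz1 hz2 hK hω hid hGo hGs hκ' hφ
  exact ⟨φ, hφ, hb, hp φ hb⟩

end

/-! ### Zeros of e_σ(1), and cutting a solution at `K`. -/

section

variable {A C : Type*} {S : WebSystem A C}

theorem wronskian_eq_sum {σ : C} {μ μ' : ℂ} {x y : ℕ → ℂ} (hx : S.IsChanSol σ μ x)
    (hy : S.IsChanSol σ μ' y) (M : ℕ) : S.wronskian σ x y M = S.wronskian σ x y 0 -
      (μ - μ') * ∑ k ∈ Finset.range M, x (k + 1) * y (k + 1) := by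
  induction M with
  | zero => simp
  | succ M ih => rw [wronskian_succ hx hy, ih, Finset.sum_range_succ]; ring

theorem wronskian_zero_eq_tsum {σ : C} {μ μ' : ℂ} {x y : ℕ → ℂ} (hx : S.IsChanSol σ μ x)
    (hy : S.IsChanSol σ μ' y) (hs : Summable fun k => x (k + 1) * y (k + 1))
    (hW : Tendsto (S.wronskian σ x y) atTop (𝓝 0)) :
    S.wronskian σ x y 0 = (μ - μ') * ∑' k, x (k + 1) * y (k + 1) := by
  have h1 := (hs.hasSum.tendsto_sum_nat.const_mul (μ - μ')).const_sub (S.wronskian σ x y 0)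
  have h2 := tendsto_nhds_unique (hW.congr (wronskian_eq_sum hx hy)) h1
  linear_combination -h2

theorem exists_norm_e_le (σ : C) {ω : ℂ} (h0 : ω ≠ 0) (h1 : ‖ω‖ ≤ 1) : ∃ c : ℝ, 0 ≤ c ∧
    ∀ k, ‖S.e σ k ω‖ ≤ c * ‖S.theta σ ω‖ ^ k := by
  obtain ⟨c, hc, h⟩ := exists_norm_jost_le (S := S) σ
  have hs := theta_spec (S := S) σ h0 h1
  exact ⟨c, hc, h _ hs.1 hs.2.1⟩

/-- Pairing of two Jost solutions on a half-line. -/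
theorem wronskian_e_eq_tsum (σ : C) {ω z : ℂ} (h0 : ω ≠ 0) (h1 : ‖ω‖ ≤ 1)
    (hθ : ‖S.theta σ ω‖ < 1) (hz0 : z ≠ 0) (hz : ‖z‖ ≤ 1) :
    S.offCoeff σ 0 * (S.e σ 1 ω * S.e σ 0 z - S.e σ 0 ω * S.e σ 1 z) =
      (S.lam ω - S.lam z) * ∑' k, S.e σ (k + 1) ω * S.e σ (k + 1) z := by
  obtain ⟨c, hc, H⟩ := exists_norm_e_le (S := S) σ h0 h1
  obtain ⟨c', hc', H'⟩ := exists_norm_e_le (S := S) σ hz0 hz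
  have hb : ∀ k, ‖S.e σ k z‖ ≤ c' := fun k => (H' k).trans (mul_le_of_le_one_right hc'
    (pow_le_one₀ (norm_nonneg _) (theta_spec (S := S) σ hz0 hz).2.1))
  exact wronskian_zero_eq_tsum (e_isChanSol σ h0 h1) (e_isChanSol σ hz0 hz)
    (summable_mul_of_geometric (x := fun k => S.e σ k ω) (y := fun k => S.e σ k z)
      (norm_nonneg _) hθ H hb) (tendsto_wronskian_zero (norm_nonneg _) hθ H hb)

/-- The half-line Jacobi operators have no nonreal or embedded eigenvalues. -/
theorem e_one_ne_zero_of_theta_im_ne_zero [Finite C] (σ : C) {ω : ℂ} (h0 : ω ≠ 0) (h1 : ‖ω‖ ≤ 1)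
    (h : (S.theta σ ω).im ≠ 0) : S.e σ 1 ω ≠ 0 := by
  intro he
  have hs := theta_spec (S := S) σ h0 h1
  by_cases hlam : (S.lam ω).im = 0
  · have hw := wronskian_e_conj (S := S) σ h0 h1 hlam 0
    simp only [wronskian, zero_add, he, map_zero, zero_mul, mul_zero, sub_zero] at hw
    have h2 := (mul_eq_zero.1 hw.symm).resolve_left
      (Complex.ofReal_ne_zero.2 (S.bInf_pos σ).ne')
    exact h (Complex.conj_eq_iff_im.1 (sub_eq_zero.1 h2).symm)
  · have hθ : ‖S.theta σ ω‖ < 1 := lt_of_le_of_ne hs.2.1 fun hn => hlam (by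
      rw [← hs.2.2.1, chanLam_im, hn]; simp)
    obtain ⟨c, hc, H⟩ := exists_norm_e_le (S := S) σ h0 h1
    have hb := bounded_of_geometric hc (norm_nonneg _) hθ.le H
    have hsol := e_isChanSol (S := S) σ h0 h1
    have hsum := summable_mul_of_geometric (x := fun k => S.e σ k ω)
      (y := fun k => starRingEnd ℂ (S.e σ k ω)) (norm_nonneg _) hθ H hb
    have hw := wronskian_zero_eq_tsum hsol hsol.conj hsum
      (tendsto_wronskian_zero (norm_nonneg _) hθ H hb)
    simp only [wronskian, zero_add, he, map_zero, zero_mul, mul_zero, sub_zero] at hw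
    have h2 := (mul_eq_zero.1 hw.symm).resolve_left (by
      rw [Complex.sub_conj]; simpa using hlam)
    have h3 := eq_zero_of_tsum_mul_conj (x := fun k => S.e σ (k + 1) ω) hsum h2
    obtain ⟨K, hK1, hK⟩ := exists_jost_ne_zero (S := S)
    exact hK σ _ hs.1 hs.2.1 (K + 1) (by omega) (congrFun h3 K)

theorem e_zero_ne_zero (σ : C) [Finite C] {z : ℂ} (hz0 : z ≠ 0) (hz : ‖z‖ ≤ 1)
    (h : S.e σ 1 z = 0) : S.e σ 0 z ≠ 0 := by
  intro h0
  obtain ⟨K, hK1, hK⟩ := exists_jost_ne_zero (S := S)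
  have hs := theta_spec (S := S) σ hz0 hz
  have := (e_isChanSol (S := S) σ hz0 hz).eq_zero_of_two (K := 0) h0 h
  exact hK σ _ hs.1 hs.2.1 K le_rfl (congrFun this K)

/-- The zeros of `e_σ(1, θ_σ(ω))` at which the channel is closed are simple. -/
theorem exists_hasDerivWithinAt_e_one [Finite C] (σ : C) {z : ℂ} (hz : ‖z‖ ≤ 1) (hz0 : z ≠ 0)
    (hz1 : z ≠ 1) (hz2 : z ≠ -1) (hθ : ‖S.theta σ z‖ < 1) (him : (S.theta σ z).im = 0)
    (he : S.e σ 1 z = 0) : ∃ d ≠ 0, HasDerivWithinAt (S.e σ 1) d (closedBall 0 1) z := by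
  have he0 := e_zero_ne_zero σ hz0 hz he
  have hs := theta_spec (S := S) σ hz0 hz
  obtain ⟨c, hc, H⟩ := exists_norm_e_le (S := S) σ hz0 hz
  have hb : ∀ k, ‖S.e σ (k + 1) z‖ ≤ c := fun k => (H (k + 1)).trans (mul_le_of_le_one_right hc
    (pow_le_one₀ (norm_nonneg _) hθ.le))
  have hoff := S.offCoeff_ne_zero σ 0
  have hsum : Summable fun k => S.e σ (k + 1) z * starRingEnd ℂ (S.e σ (k + 1) z) :=
    summable_mul_of_geometric (x := fun k => S.e σ k z)
      (y := fun k => starRingEnd ℂ (S.e σ k z)) (norm_nonneg _) hθ H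
      (bounded_of_geometric hc (norm_nonneg _) hθ.le H)
  -- For real θ_σ(z) the Jost solution is real, so this is a sum of squares of moduli. It is the
  -- factor that makes the zero simple.
  have hq : ∑' k, S.e σ (k + 1) z * S.e σ (k + 1) z ≠ 0 := by
    intro h0
    have h3 := eq_zero_of_tsum_mul_conj (x := fun k => S.e σ (k + 1) z) hsum (by
      simp only [conj_e_of_im_eq_zero σ hz0 hz him]; exact h0)
    obtain ⟨K, hK1, hK⟩ := exists_jost_ne_zero (S := S)
    exact hK σ _ hs.1 hs.2.1 (K + 1) (by omega) (congrFun h3 K)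
  -- The identity of `wronskian_e_eq_tsum`, in which one term drops out because e_σ(1, z) = 0, is
  -- divided by ω - z.
  refine ⟨S.lamDeriv z * (∑' k, S.e σ (k + 1) z * S.e σ (k + 1) z) /
    (S.offCoeff σ 0 * S.e σ 0 z), div_ne_zero (mul_ne_zero (S.lamDeriv_ne_zero hz1 hz2) hq)
      (mul_ne_zero hoff he0), ?_⟩
  rw [hasDerivWithinAt_iff_tendsto_slope]
  have hid : Tendsto id (𝓝[closedBall 0 1 \ {z}] z) (𝓝 z) :=
    tendsto_id.mono_left nhdsWithin_le_nhds
  have hω : ∀ᶠ ω in 𝓝[closedBall 0 1 \ {z}] z, id ω ≠ 0 ∧ ‖id ω‖ ≤ 1 := by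
    filter_upwards [hid.eventually_ne hz0, self_mem_nhdsWithin] with ω h1 h2
    exact ⟨h1, by simpa using h2.1⟩
  have hne : ∀ᶠ ω in 𝓝[closedBall 0 1 \ {z}] z, id ω ≠ z := by
    filter_upwards [self_mem_nhdsWithin] with ω h2 using h2.2
  have hth := tendsto_theta (S := S) σ hz hz0 hz1 hz2 hω hid
  have h1 := ((tendsto_lam_slope (S := S) hz0 hne hid).mul
    (tendsto_tsum_jost_mul (S := S) σ hs.1 hθ hth hb 1)).div_const
      (S.offCoeff σ 0 * S.e σ 0 z)
  refine h1.congr' ?_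
  filter_upwards [hω, hne, hth.norm.eventually_lt_const hθ] with ω h2 h3 h4
  have h5 := wronskian_e_eq_tsum (S := S) σ h2.1 h2.2 h4 hz0 hz
  rw [he, mul_zero, sub_zero] at h5
  have h6 : ω - z ≠ 0 := sub_ne_zero.2 h3
  rw [slope_def_field, he, sub_zero]
  change (S.lam ω - S.lam z) / (ω - z) * (∑' k, S.e σ (k + 1) ω * S.e σ (k + 1) z) /
    (S.offCoeff σ 0 * S.e σ 0 z) = S.e σ 1 ω / (ω - z)
  simp only [id] at h5
  rw [div_mul_eq_mul_div, ← h5]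
  field_simp

/-- For real `z` a possible zero at `z` is simple, hence isolated. For nonreal `z`, points of the
disc near `z` have nonreal λ(ω), hence nonreal θ_σ(ω), and the half-line operator has no nonreal
eigenvalue. -/
theorem eventually_e_one_ne_zero [Finite C] (σ : C) {z : ℂ} (hz : ‖z‖ ≤ 1) (hz0 : z ≠ 0)
    (hz1 : z ≠ 1) (hz2 : z ≠ -1) : ∀ᶠ ω in discNhds z, S.e σ 1 ω ≠ 0 := by
  have hω := eventually_discNhds hz0
  have hid := tendsto_id_discNhds z
  by_cases him : z.im = 0
  · have hzn := norm_lt_one_of_im_eq_zero hz hz1 hz2 him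
    have hs := theta_spec (S := S) σ hz0 hz
    have hθ := hs.norm_lt hz0 hzn
    have hθi : (S.theta σ z).im = 0 :=
      (S.theta_real_or_norm_eq_one hs (by rw [lam_im, him]; simp)).resolve_right hθ.ne
    by_cases he : S.e σ 1 z = 0
    · obtain ⟨d, hd, h⟩ := exists_hasDerivWithinAt_e_one σ hz hz0 hz1 hz2 hθ hθi he
      rw [hasDerivWithinAt_iff_tendsto_slope] at h
      have h1 := h.eventually_ne hd
      have h2 : discNhds z ≤ 𝓝[closedBall 0 1 \ {z}] z :=
        nhdsWithin_mono z (Set.sdiff_subset_sdiff_left ball_subset_closedBall)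
      filter_upwards [h2 h1] with ω h3 h4
      exact h3 (by rw [slope_def_field, he, h4]; simp)
    · exact (tendsto_e (S := S) σ hz hz0 hz1 hz2 (hω.mono fun i hi => ⟨hi.1, hi.2.1.le⟩)
        hid 1).eventually_ne he
  · have him' : ∀ᶠ ω in discNhds z, ω.im ≠ 0 :=
      ((Complex.continuous_im.tendsto _).comp hid).eventually_ne him
    filter_upwards [hω, him'] with ω h1 h2
    refine e_one_ne_zero_of_theta_im_ne_zero σ h1.1 h1.2.1.le fun h3 => ?_
    have h4 := S.lam_im_ne_zero h1.1 h1.2.1 h2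
    rw [← (theta_spec (S := S) σ h1.1 h1.2.1.le).2.2.1, chanLam_im, h3] at h4
    simp at h4

theorem p_isChanSol (σ : C) (ω : ℂ) : S.IsChanSol σ (S.lam ω) (S.p σ ω) := fun k => by
  have h := S.offCoeff_ne_zero σ (k + 1)
  rw [p]
  field_simp
  ring

theorem tendsto_chanSol {ι : Type*} {l : Filter ι} {σ : C} {μ : ι → ℂ} {μ₀ : ℂ} {x : ι → ℕ → ℂ}
    {y : ℕ → ℂ} (hx : ∀ᶠ i in l, S.IsChanSol σ (μ i) (x i)) (hy : S.IsChanSol σ μ₀ y)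
    (hμ : Tendsto μ l (𝓝 μ₀)) (h0 : Tendsto (fun i => x i 0) l (𝓝 (y 0)))
    (h1 : Tendsto (fun i => x i 1) l (𝓝 (y 1))) (k : ℕ) :
    Tendsto (fun i => x i k) l (𝓝 (y k)) := by
  have : ∀ k, Tendsto (fun i => x i k) l (𝓝 (y k)) ∧
      Tendsto (fun i => x i (k + 1)) l (𝓝 (y (k + 1))) := by
    intro k
    induction k with
    | zero => exact ⟨h0, h1⟩
    | succ k ih =>
      refine ⟨ih.2, ?_⟩
      have h := S.offCoeff_ne_zero σ (k + 1)
      have h2 := ((((hμ.const_sub (S.diagCoeff σ (k + 1) : ℂ)).mul ih.2).sub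
        (ih.1.const_mul (S.offCoeff σ k : ℂ))).div_const (S.offCoeff σ (k + 1) : ℂ))
      have h3 : ∀ (μ : ℂ) (x : ℕ → ℂ), S.IsChanSol σ μ x → ((S.diagCoeff σ (k + 1) - μ) * x (k + 1)
          - S.offCoeff σ k * x k) / S.offCoeff σ (k + 1) = x (k + 1 + 1) := fun μ x hx => by
        rw [div_eq_iff h]
        linear_combination hx k
      rw [h3 _ _ hy] at h2
      exact h2.congr' (hx.mono fun i hi => h3 _ _ hi)
  exact (this k).1

/-- Continuing `x` from the index `K` on by a multiple of `e` creates a source at `K`. -/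
theorem chan_glue {σ : C} {μ : ℂ} {x e v : ℕ → ℂ} (hx : S.IsChanSol σ μ x)
    (he : S.IsChanSol σ μ e) {K : ℕ} (hK : 1 ≤ K) (heK : e K ≠ 0) (hv : ∀ k ≤ K, v k = x k)
    (hv' : ∀ k, K ≤ k → v k = x K / e K * e k) (k : ℕ) :
    -(S.offCoeff σ k : ℂ) * v k + (S.diagCoeff σ (k + 1) : ℂ) * v (k + 1)
      - (S.offCoeff σ (k + 1) : ℂ) * v (k + 2) =
    μ * v (k + 1) + if k + 1 = K then S.wronskian σ x e 0 / e K else 0 := by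
  rcases lt_trichotomy (k + 1) K with h | h | h
  · rw [hv k (by omega), hv (k + 1) (by omega), hv (k + 2) (by omega), hx k, if_neg h.ne, add_zero]
  · rw [hv k (by omega), hv (k + 1) (by omega), hv' (k + 2) (by omega), if_pos h,
      ← wronskian_const hx he (k + 1)]
    subst h
    rw [wronskian]
    field_simp
    linear_combination e (k + 1) * hx k
  · rw [hv' k (by omega), hv' (k + 1) (by omega), hv' (k + 2) (by omega), if_neg h.ne', add_zero]
    linear_combination (x K / e K) * he k

end

/-! ### The matrices T and U, and their columns as outgoing solutions. -/

section

variable {A C : Type*} {S : WebSystem A C}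

variable (S) in
/-- `μ` is not an eigenvalue of the truncation of `L` to the central part. -/
def CentralRegular (μ : ℂ) : Prop :=
  ∀ (f : S.central → ℂ) (α : S.central), ∑ β : S.central, (S.L α β : ℂ) *
    (S.centralResolvent μ).mulVec f β = μ * (S.centralResolvent μ).mulVec f α + f α

/-- λ(z) itself may be an eigenvalue of the central truncation. Its spectrum is finite, and λ(ω) ≠
λ(z) near `z` because λ'(z) ≠ 0. -/
theorem eventually_centralRegular {z : ℂ} (hz0 : z ≠ 0) (hz1 : z ≠ 1) (hz2 : z ≠ -1) :
    ∀ᶠ ω in discNhds z, S.CentralRegular (S.lam ω) := by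
  classical
  set M : Matrix S.central S.central ℂ := Matrix.of (fun α β : S.central => (S.L α β : ℂ))
  have hfin : (spectrum ℂ M).Finite := M.finite_spectrum
  have hid := tendsto_id_discNhds z
  have hlam := tendsto_lam (S := S) hz0 hid
  have h1 : ∀ᶠ ω in discNhds z, S.lam ω ∉ spectrum ℂ M \ {S.lam z} := by
    have hc : IsClosed (spectrum ℂ M \ {S.lam z}) := (hfin.subset Set.sdiff_subset).isClosed
    exact hlam.eventually (hc.isOpen_compl.mem_nhds fun h => h.2 rfl)
  have h2 : ∀ᶠ ω in discNhds z, S.lam ω ≠ S.lam z := by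
    have h1 := (tendsto_lam_slope (S := S) hz0 ((eventually_discNhds hz0).mono
      fun i hi => hi.2.2) hid).eventually_ne (S.lamDeriv_ne_zero hz1 hz2)
    filter_upwards [h1] with ω hi h0
    simp [h0] at hi
  filter_upwards [h1, h2] with ω h3 h4
  have h5 : S.lam ω ∉ spectrum ℂ M := fun h => h3 ⟨h, h4⟩
  rw [spectrum.notMem_iff, Algebra.algebraMap_eq_smul_one] at h5
  have h6 : IsUnit (M - S.lam ω • (1 : Matrix S.central S.central ℂ)) := by
    have := h5.neg
    rwa [neg_sub] at this
  rw [Matrix.isUnit_iff_isUnit_det] at h6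
  have hR : S.centralResolvent (S.lam ω) = (M - S.lam ω • 1)⁻¹ := by
    rw [centralResolvent]
  intro f α
  have h7 := congrFun (congrArg (fun N => Matrix.mulVec N f) (Matrix.mul_nonsing_inv _ h6)) α
  rw [← hR] at h7
  simp only [← Matrix.mulVec_mulVec, Matrix.one_mulVec, Matrix.sub_mulVec, Pi.sub_apply,
    Matrix.smul_mulVec, Pi.smul_apply, smul_eq_mul] at h7
  rw [← h7]
  simp only [M, Matrix.mulVec, dotProduct, Matrix.of_apply]
  ring

variable [Fintype C]

/-- Functions on the channels extend to the central part as solutions, under a compatibility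
condition at the attachment points. -/
theorem exists_extension {μ : ℂ} (hμ : S.CentralRegular μ) {u : C → ℕ → ℂ}
    (hu : ∀ σ, ∑ γ, S.centralResolvent μ (S.attach σ) (S.attach γ) *
      (S.offCoeff γ 0 : ℂ) * u γ 1 = u σ 0) :
    ∃ x : A → ℂ, (∀ σ k, x (S.pt σ k) = u σ k) ∧
      (∀ α : S.central, x α = ∑ γ, S.centralResolvent μ α (S.attach γ) *
        (S.offCoeff γ 0 : ℂ) * u γ 1) ∧
      ∀ α : S.central, S.apply x α = μ * x α := by
  classical
  set c : S.central → ℂ := fun α => ∑ γ, S.centralResolvent μ α (S.attach γ) *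
        (S.offCoeff γ 0 : ℂ) * u γ 1 with hc
  set x : A → ℂ := Function.extend Subtype.val c
    (Function.extend (fun p : C × ℕ => S.pt p.1 p.2) (fun p => u p.1 p.2) 0) with hx
  have hxc : ∀ α : S.central, x α = c α := fun α => Subtype.val_injective.extend_apply _ _ α
  have hxp : ∀ σ k, x (S.pt σ k) = u σ k := by
    intro σ k
    cases k with
    | zero => exact (hxc (S.attach σ)).trans (hu σ)
    | succ k =>
      rw [hx, Function.extend_apply' _ _ _ (by
        rintro ⟨α, hα⟩
        exact S.pt_succ_notMem_central σ k (hα ▸ α.2))]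
      exact S.pt_injective.extend_apply _ _ (σ, k + 1)
  refine ⟨x, hxp, hxc, fun α => ?_⟩
  -- `f` is the force exerted on the attachment points by the first particles of the channels; `c`
  -- is the response of the central resolvent to it.
  set f : S.central → ℂ := fun α => ∑ γ, if α = S.attach γ then S.offCoeff γ 0 * u γ 1 else 0
    with hf
  have hcf : c = (S.centralResolvent μ).mulVec f := by
    funext α
    simp only [hc, hf, Matrix.mulVec, dotProduct, Finset.mul_sum]
    rw [Finset.sum_comm]
    refine Finset.sum_congr rfl fun γ _ => ?_
    simp [mul_assoc]
  have h := hμ f α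
  rw [← hcf] at h
  rw [apply_central, hxc]
  simp only [hxc, hxp]
  rw [h, hf]
  ring

variable [DecidableEq C]

theorem T_apply (ω : ℂ) (σ γ : C) : S.T ω σ γ = (if σ = γ then S.e σ 0 ω else 0) -
    S.centralResolvent (S.lam ω) (S.attach σ) (S.attach γ) * S.offCoeff γ 0 * S.e γ 1 ω := by
  simp only [T, R, B0, E, Matrix.sub_apply, Matrix.mul_diagonal, Matrix.diagonal_apply,
    Matrix.submatrix_apply]

theorem sum_T_mul (ω : ℂ) (σ : C) (v : C → ℂ) : ∑ γ, S.T ω σ γ * v γ = S.e σ 0 ω * v σ -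
    ∑ γ, S.centralResolvent (S.lam ω) (S.attach σ) (S.attach γ) * S.offCoeff γ 0 *
      (S.e γ 1 ω * v γ) := by
  simp only [T_apply, sub_mul, Finset.sum_sub_distrib, ite_mul, zero_mul, Finset.sum_ite_eq,
    Finset.mem_univ, if_true, mul_assoc]

theorem eventually_isUnit_T {K : ℕ} (hK : S.JostNonvanishing K) {z : ℂ} (hz : ‖z‖ ≤ 1)
    (hz0 : z ≠ 0) (hz1 : z ≠ 1) (hz2 : z ≠ -1) : ∀ᶠ ω in discNhds z, IsUnit (S.T ω).det := by
  classical
  -- Any channel will do: `apriori` asks for the place of a source, and the source used here is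
  -- zero.
  obtain ⟨x, hx⟩ := S.connected.nonempty
  obtain ⟨ν, -⟩ := Set.mem_iUnion.1 hx
  obtain ⟨c, hc, hap⟩ := apriori hK hz hz0 hz1 hz2 (S.pt ν K)
  filter_upwards [hap, eventually_discNhds hz0, eventually_centralRegular (S := S) hz0 hz1 hz2]
    with ω h1 h2 h3
  rw [isUnit_iff_ne_zero]
  intro hdet
  obtain ⟨v, hv, hTv⟩ := Matrix.exists_mulVec_eq_zero_iff.2 hdet
  -- T v = 0 is exactly the compatibility condition at the attachment points for multiples of the
  -- Jost solutions. The resulting source-free outgoing solution vanishes by `apriori`.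
  obtain ⟨x, hxp, -, hxs⟩ := exists_extension h3 (u := fun σ k => S.e σ k ω * v σ) fun σ => by
    have := congrFun hTv σ
    rw [Matrix.mulVec, dotProduct, sum_T_mul, Pi.zero_apply, sub_eq_zero] at this
    exact this.symm
  have hout : S.IsOutgoing K ω x := fun σ k _ => by rw [hxp, hxp]; ring
  have hsol : ∀ α, S.apply x α = S.lam ω * x α + if α = S.pt ν K then (0 : ℂ) else 0 := by
    intro α
    rw [ite_self, add_zero]
    rcases S.mem_central_or α with hα | ⟨σ, k, rfl⟩
    · exact hxs ⟨α, hα⟩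
    · rw [apply_pt_succ, hxp, hxp, hxp]
      linear_combination v σ * e_isChanSol (S := S) σ h2.1 h2.2.1.le k
  refine hv (funext fun σ => ?_)
  have h4 := h1 x 0 hout hsol (S.pt σ K) (.inr ⟨σ, K, le_rfl, rfl⟩)
  rw [norm_zero, mul_zero, hxp, norm_mul] at h4
  have h5 : 0 < ‖ω - z‖ := norm_pos_iff.2 (sub_ne_zero.2 h2.2.2)
  have h6 : 0 < ‖S.e σ K ω‖ := norm_pos_iff.2 (hK.e_ne_zero σ h2.1 h2.2.1.le le_rfl)
  by_contra h7
  have h8 : 0 < ‖v σ‖ := norm_pos_iff.2 h7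
  have : 0 < ‖ω - z‖ * (‖S.e σ K ω‖ * ‖v σ‖) := by positivity
  linarith

variable (S) in
/-- The points `ω` of the disc at which the matrix `U(k, ω)` is given by regular expressions. -/
structure IsRegular (ω : ℂ) : Prop where
  ne_zero : ω ≠ 0
  norm_lt : ‖ω‖ < 1
  central : S.CentralRegular (S.lam ω)
  isUnit_T : IsUnit (S.T ω).det
  e_one_ne_zero : ∀ γ, S.e γ 1 ω ≠ 0

theorem eventually_isRegular {z : ℂ} (hz : ‖z‖ ≤ 1)
    (hz0 : z ≠ 0) (hz1 : z ≠ 1) (hz2 : z ≠ -1) : ∀ᶠ ω in discNhds z, S.IsRegular ω := by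
  obtain ⟨K, -, hK⟩ := exists_jost_ne_zero (S := S)
  filter_upwards [eventually_discNhds hz0, eventually_centralRegular (S := S) hz0 hz1 hz2,
    eventually_isUnit_T (S := S) hK hz hz0 hz1 hz2,
    eventually_all.2 fun γ => eventually_e_one_ne_zero (S := S) γ hz hz0 hz1 hz2] with ω h1 h2 h3 h4
  exact ⟨h1.1, h1.2.1, h2, h3, h4⟩

theorem inv_diagonal_of_ne_zero {v : C → ℂ} (hv : ∀ γ, v γ ≠ 0) :
    (Matrix.diagonal v)⁻¹ = Matrix.diagonal fun γ => (v γ)⁻¹ := by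
  refine Matrix.inv_eq_right_inv ?_
  rw [Matrix.diagonal_mul_diagonal, ← Matrix.diagonal_one]
  congr 1
  funext γ
  exact mul_inv_cancel₀ (hv γ)

variable (S) in
/-- The normalizing factor of the column `ν` of `U`. -/
noncomputable def colFactor (ν : C) (ω : ℂ) : ℂ :=
  S.bInf ν * (S.offCoeff ν 0 : ℂ)⁻¹ * ((S.theta ν ω)⁻¹ - S.theta ν ω) * (S.e ν 1 ω)⁻¹

theorem IsRegular.U_apply {ω : ℂ} (h : S.IsRegular ω) (k : ℕ) (σ ν : C) :
    S.U k ω σ ν = (-(if σ = ν then S.p σ ω k else 0) + S.e σ k ω * (S.T ω)⁻¹ σ ν) *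
      S.colFactor ν ω := by
  have h1 : (S.E 1 ω)⁻¹ = Matrix.diagonal fun γ => (S.e γ 1 ω)⁻¹ :=
    inv_diagonal_of_ne_zero h.e_one_ne_zero
  have h2 : S.B0⁻¹ = Matrix.diagonal fun γ => (S.offCoeff γ 0 : ℂ)⁻¹ :=
    inv_diagonal_of_ne_zero (S.offCoeff_ne_zero · 0)
  simp only [U, h1, h2]
  simp only [E, B, D, P, colFactor, Matrix.mul_diagonal, Matrix.diagonal_mul,
    Matrix.add_apply, Matrix.neg_apply, Matrix.diagonal_apply]
  ring

theorem IsRegular.isChanSol_U {ω : ℂ} (h : S.IsRegular ω) (σ ν : C) :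
    S.IsChanSol σ (S.lam ω) fun k => S.U k ω σ ν := fun k => by
  have h1 := p_isChanSol (S := S) σ ω k
  have h2 := e_isChanSol (S := S) σ h.ne_zero h.norm_lt.le k
  simp only [h.U_apply]
  split_ifs
  · linear_combination (-S.colFactor ν ω) * h1 + (S.T ω)⁻¹ σ ν * S.colFactor ν ω * h2
  · linear_combination (S.T ω)⁻¹ σ ν * S.colFactor ν ω * h2

theorem IsRegular.U_one {ω : ℂ} (h : S.IsRegular ω) (σ ν : C) :
    S.U 1 ω σ ν = S.e σ 1 ω * (S.T ω)⁻¹ σ ν * S.colFactor ν ω := by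
  rw [h.U_apply]; simp [p]

/-- This is T T⁻¹ = 1 times the column factor: since p(0) = 1 and p(1) = 0, the term -P supplies the
identity matrix at index 0 and nothing at index 1. -/
theorem IsRegular.sum_resolvent_U {ω : ℂ} (h : S.IsRegular ω) (σ ν : C) :
    ∑ γ, S.centralResolvent (S.lam ω) (S.attach σ) (S.attach γ) * (S.offCoeff γ 0 : ℂ) *
      S.U 1 ω γ ν = S.U 0 ω σ ν := by
  have h1 := congrFun (congrFun (Matrix.mul_nonsing_inv _ h.isUnit_T) σ) ν
  rw [Matrix.mul_apply, sum_T_mul, Matrix.one_apply] at h1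
  simp only [h.U_one, ← mul_assoc, ← Finset.sum_mul] at h1 ⊢
  rw [h.U_apply, p]
  linear_combination (-S.colFactor ν ω) * h1

/-- The column `ν` of `U(·, ω)`, cut at the `K`-th particle of the channel `ν`, is an outgoing
solution with a source. -/
theorem IsRegular.exists_outgoing {ω : ℂ} (h : S.IsRegular ω) [DecidableEq A] {K : ℕ} (hK1 : 1 ≤ K)
    (hK : S.JostNonvanishing K) (ν : C) : ∃ g : A → ℂ, S.IsOutgoing K ω g ∧
      (∀ α, S.apply g α = S.lam ω * g α + if α = S.pt ν K then
        S.bInf ν * ((S.theta ν ω)⁻¹ - S.theta ν ω) / S.e ν K ω else 0) ∧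
      (∀ α : S.central, g α = S.centralColumn ν ω α) ∧
      ∀ σ k, k ≤ K → g (S.pt σ k) = S.U k ω σ ν := by
  have hsolU := h.isChanSol_U (ν := ν)
  have hsole := fun σ => e_isChanSol (S := S) σ h.ne_zero h.norm_lt.le
  have heK := fun σ => hK.e_ne_zero (S := S) σ h.ne_zero h.norm_lt.le le_rfl
  -- On channels other than `ν` the column is already a multiple of the Jost solution. On `ν` it
  -- contains -p, which need not decay, and is therefore continued by the Jost solution beyond `K`.
  set u : C → ℕ → ℂ := fun σ k => if k ≤ K then S.U k ω σ ν else
    S.U K ω σ ν / S.e σ K ω * S.e σ k ω with hu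
  have hu1 : ∀ σ k, k ≤ K → u σ k = S.U k ω σ ν := fun σ k hk => if_pos hk
  have hu2 : ∀ σ k, K ≤ k → u σ k = S.U K ω σ ν / S.e σ K ω * S.e σ k ω := fun σ k hk => by
    rcases hk.eq_or_lt with rfl | hk
    · rw [hu1 _ _ le_rfl, div_mul_cancel₀ _ (heK σ)]
    · exact if_neg (not_le.2 hk)
  obtain ⟨g, hgp, hgc, hgs⟩ := exists_extension h.central (u := u) fun σ => by
    rw [hu1 σ 0 (Nat.zero_le _), ← h.sum_resolvent_U]
    exact Finset.sum_congr rfl fun γ _ => by rw [hu1 γ 1 hK1]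
  refine ⟨g, fun σ k hk => ?_, fun α => ?_, fun α => ?_, fun σ k hk => ?_⟩
  · rw [hgp, hgp, hu2 σ k hk, hu2 σ K le_rfl]; ring
  · rcases S.mem_central_or α with hα | ⟨σ, k, rfl⟩
    · rw [if_neg, add_zero]
      · exact hgs ⟨α, hα⟩
      · rintro rfl
        obtain ⟨m, rfl⟩ : ∃ m, K = m + 1 := ⟨K - 1, by omega⟩
        exact S.pt_succ_notMem_central ν m hα
    · rw [apply_pt_succ, hgp, hgp, hgp,
        chan_glue (hsolU σ) (hsole σ) hK1 (heK σ) (hu1 σ) (hu2 σ) k]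
      congr 1
      -- Only -p contributes to the Wronskian with the Jost solution, and the column factor cancels
      -- `e_ν(1)` and `𝔟_ν(0)`. The source thus stays regular even where `e_ν(1)` vanishes.
      have hW : S.wronskian σ (fun k => S.U k ω σ ν) (fun k => S.e σ k ω) 0 =
          if σ = ν then S.bInf ν * ((S.theta ν ω)⁻¹ - S.theta ν ω) else 0 := by
        rw [wronskian, zero_add, h.U_one, h.U_apply, p]
        split_ifs with hσ
        · subst hσ
          rw [colFactor]
          have h1 := h.e_one_ne_zero σ
          have h2 := S.offCoeff_ne_zero σ 0
          field_simp
          ring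
        · ring
      rw [hW]
      by_cases hσ : σ = ν
      · subst hσ
        simp [S.pt_inj]
      · simp [S.pt_inj, hσ]
  · rw [hgc, centralColumn]
    exact Finset.sum_congr rfl fun γ _ => by rw [hu1 γ 1 hK1]
  · rw [hgp, hu1 σ k hk]

/-- The residue of the column `ν` of `U(·, ω)` at `z` is a bound state. -/
theorem exists_column_residue {K : ℕ} (hK1 : 1 ≤ K) (hK : S.JostNonvanishing K) {z : ℂ}
    (hz : ‖z‖ ≤ 1) (hz0 : z ≠ 0) (hz1 : z ≠ 1) (hz2 : z ≠ -1) (ν : C) :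
    ∃ φ : A → ℂ, S.IsBoundState K z φ ∧
      (∀ α : S.central, Tendsto (fun ω => (ω - z) * S.centralColumn ν ω α) (discNhds z)
        (𝓝 (φ α))) ∧
      (∀ σ k, Tendsto (fun ω => (ω - z) * S.U k ω σ ν) (discNhds z) (𝓝 (φ (S.pt σ k)))) ∧
      ∑' α, φ α * starRingEnd ℂ (φ α) =
        -(S.bInf ν * ((S.theta ν z)⁻¹ - S.theta ν z) / S.e ν K z *
          starRingEnd ℂ (φ (S.pt ν K)) / S.lamDeriv z) := by
  classical
  have hreg := eventually_isRegular (S := S) hz hz0 hz1 hz2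
  have hid := tendsto_id_discNhds z
  have hω' : ∀ᶠ ω in discNhds z, id ω ≠ 0 ∧ ‖id ω‖ ≤ 1 :=
    (eventually_discNhds hz0).mono fun i hi => ⟨hi.1, hi.2.1.le⟩
  have hth := tendsto_theta (S := S) ν hz hz0 hz1 hz2 hω' hid
  have hs := theta_spec (S := S) ν hz0 hz
  choose! g hg using fun ω (h : S.IsRegular ω) => h.exists_outgoing hK1 hK ν
  obtain ⟨φ, hφ, hb, hn⟩ := exists_residue hK hz hz0 hz1 hz2 (g := g)
    (hreg.mono fun ω h => (hg ω h).1) (hreg.mono fun ω h => (hg ω h).2.1)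
    ((((hth.inv₀ hs.1).sub hth).const_mul (S.bInf ν : ℂ)).div
      (tendsto_e (S := S) ν hz hz0 hz1 hz2 hω' hid K) (hK.e_ne_zero ν hz0 hz le_rfl))
  refine ⟨φ, hb, fun α => ?_, fun σ k => ?_, hn⟩
  · refine (hφ α).congr' ?_
    filter_upwards [hreg] with ω h
    rw [(hg ω h).2.2.1]
  · have h1 : ∀ k ≤ K, Tendsto (fun ω => (ω - z) * S.U k ω σ ν) (discNhds z)
        (𝓝 (φ (S.pt σ k))) := fun k hk => by
      refine (hφ _).congr' ?_
      filter_upwards [hreg] with ω h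
      rw [(hg ω h).2.2.2 σ k hk]
    -- Beyond `K` the column of `U` and its cut version differ, so convergence there is propagated
    -- by the recurrence from the indices 0 and 1.
    refine tendsto_chanSol (σ := σ) (μ := S.lam) (x := fun ω k => (ω - z) * S.U k ω σ ν)
      (y := fun k => φ (S.pt σ k)) ?_ (S.isChanSol_of_apply fun k => hb.apply_eq _)
      (tendsto_lam hz0 hid) (h1 0 (Nat.zero_le _)) (h1 1 hK1) k
    filter_upwards [hreg] with ω h
    have := (h.isChanSol_U σ ν).mul_const (ω - z)
    simpa only [mul_comm] using this

end

/-! ### Identification of m, the normalization, and poles. -/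

section

variable {A C : Type*} {S : WebSystem A C}

theorem tendsto_p {ι : Type*} {l : Filter ι} {ω : ι → ℂ} {z : ℂ} (hz0 : z ≠ 0)
    (h : Tendsto ω l (𝓝 z)) (σ : C) (k : ℕ) :
    Tendsto (fun i => S.p σ (ω i) k) l (𝓝 (S.p σ z k)) :=
  tendsto_chanSol (.of_forall fun i => p_isChanSol σ (ω i)) (p_isChanSol σ z)
    (tendsto_lam hz0 h) (by simp [p, tendsto_const_nhds]) (by simp [p, tendsto_const_nhds]) k

/-- Where e_σ(1) vanishes, p and the Jost solution are proportional. This turns the residue of the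
term -P into the correction in m. -/
theorem p_mul_e_zero (σ : C) {z : ℂ} (hz0 : z ≠ 0) (hz : ‖z‖ ≤ 1) (h : S.e σ 1 z = 0) (k : ℕ) :
    S.p σ z k * S.e σ 0 z = S.e σ k z :=
  congrFun (((p_isChanSol σ z).mul_const (S.e σ 0 z)).ext_two (e_isChanSol (S := S) σ hz0 hz)
    (K := 0) (by simp [p]) (by simp [p, h])) k

theorem uniqueDiffWithinAt_closedBall {z : ℂ} (hz : ‖z‖ ≤ 1) :
    UniqueDiffWithinAt ℂ (closedBall (0 : ℂ) 1) z := by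
  refine uniqueDiffWithinAt_iff_accPt.2 ?_
  rw [accPt_principal_iff_nhdsWithin]
  exact NeBot.mono (discNhds_neBot hz)
    (nhdsWithin_mono z (Set.sdiff_subset_sdiff_left ball_subset_closedBall))

theorem theta_inv_eq_of_norm_eq_one {σ : C} {z : ℂ} (h : ‖S.theta σ z‖ = 1)
    (him : (S.theta σ z).im = 0) : (S.theta σ z)⁻¹ = S.theta σ z := by
  rw [inv_eq_conj h, Complex.conj_eq_iff_im.2 him]

/-- Two consecutive values determine a solution, so proportionality to the Jost solution beyond `K`
extends down to 0, where the Jost solution may vanish. -/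
theorem IsBoundState.eq_e_mul {K : ℕ} (hK : S.JostNonvanishing K) {z : ℂ}
    (hz : ‖z‖ ≤ 1) (hz0 : z ≠ 0) {φ : A → ℂ} (h : S.IsBoundState K z φ) (σ : C) (k : ℕ) :
    φ (S.pt σ k) = S.e σ k z * (φ (S.pt σ K) / S.e σ K z) := by
  have h1 := S.isChanSol_of_apply (σ := σ) fun k => h.apply_eq (S.pt σ (k + 1))
  have h2 := (e_isChanSol (S := S) σ hz0 hz).mul_const (φ (S.pt σ K) / S.e σ K z)
  have h3 := fun k (hk : K ≤ k) => h.outgoing.eq_div hK hz0 hz σ hk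
  exact congrFun (h1.ext_two h2 (K := K) ((h3 K le_rfl).trans (mul_comm _ _))
    ((h3 (K + 1) (Nat.le_succ K)).trans (mul_comm _ _))) k

section

variable [Fintype C]

/-- Either λ(z) is nonreal and there are no bound states, or the channel is open and a bound state
cannot live on it. -/
theorem IsBoundState.eq_zero_of_theta_im_ne_zero {K : ℕ} (hK : S.JostNonvanishing K) {z : ℂ}
    (hz : ‖z‖ ≤ 1) (hz0 : z ≠ 0) {φ : A → ℂ} (h : S.IsBoundState K z φ) {ν : C}
    (hν : (S.theta ν z).im ≠ 0) : φ (S.pt ν K) = 0 := by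
  by_cases hlam : (S.lam z).im = 0
  · have := (S.theta_real_or_norm_eq_one (theta_spec ν hz0 hz) hlam).resolve_left hν
    exact (h.closed ν).resolve_right this.not_lt
  · rw [h.outgoing.eq_zero_of_lam_im_ne_zero hz hz0 hK hlam h.apply_eq]; rfl

theorem IsBoundState.memℓp {K : ℕ} (hK : S.JostNonvanishing K) {z : ℂ}
    (hz : ‖z‖ ≤ 1) (hz0 : z ≠ 0) {φ : A → ℂ} (h : S.IsBoundState K z φ) : Memℓp φ 2 := by
  refine memℓp_gen ?_
  simpa using summable_norm_sq (h.summable hK h hz0 hz)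

end

theorem norm_sq_lp (φ : lp (fun _ : A => ℂ) 2) :
    ((‖φ‖ ^ 2 : ℝ) : ℂ) = ∑' α, φ α * starRingEnd ℂ (φ α) := by
  rw [tsum_mul_conj]
  have := lp.norm_rpow_eq_tsum (p := 2) (by norm_num) φ
  simp at this
  rw [this]

theorem conj_lamDeriv (z : ℂ) : starRingEnd ℂ (S.lamDeriv z) =
    -(S.b * (1 - (starRingEnd ℂ z ^ 2)⁻¹)) := by
  simp [lamDeriv]

/-- `X` is a squared norm, hence real. Conjugating the pairing identity turns conj m into m and
λ'(z) into its conjugate, which is how the conjugate of `z` enters the normalization. -/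
theorem norm_formula {bν : ℝ} {θ m w X : ℂ} (hθ : θ ≠ 0) (hX : starRingEnd ℂ X = X)
    (him : θ.im = 0) (h : X = -(bν * (θ⁻¹ - θ) * starRingEnd ℂ m / w)) :
    X = bν * (1 - (θ ^ 2)⁻¹) / starRingEnd ℂ w * θ * m := by
  have hc := congrArg (starRingEnd ℂ) h
  rw [hX] at hc
  simp only [map_neg, map_div₀, map_mul, map_sub, map_inv₀, Complex.conj_conj, Complex.conj_ofReal,
    Complex.conj_eq_iff_im.2 him] at hc
  rw [hc]
  field_simp
  ring

theorem eq_one_of_normSq_mul_eq {c X : ℂ} (hc : c ≠ 0) (hX : X ≠ 0)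
    (h : ((‖c‖ ^ 2 : ℝ) : ℂ) * X = c * X) : c = 1 := by
  have h1 := mul_right_cancel₀ hX h
  have h2 := congrArg norm h1
  rw [Complex.norm_real, Real.norm_eq_abs, abs_of_nonneg (sq_nonneg _), sq] at h2
  have h3 : ‖c‖ = 1 := by
    have := norm_pos_iff.2 hc
    exact mul_right_cancel₀ this.ne' (h2.trans (one_mul _).symm)
  rw [← h1, h3]; simp

/-- The order n is at most -1, so |(ω - z) f| = |ω - z|^(n + 1) |g| ≥ |g| near `z`, with g(z) ≠ 0.
-/
theorem not_tendsto_zero_of_pole {f : ℂ → ℂ} {z : ℂ} (hz : ‖z‖ ≤ 1) (hf : MeromorphicAt f z)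
    (ho : meromorphicOrderAt f z < 0) :
    ¬ Tendsto (fun ω => (ω - z) * f ω) (discNhds z) (𝓝 0) := by
  intro h
  have := discNhds_neBot hz
  obtain ⟨n, hn⟩ := WithTop.ne_top_iff_exists.1 (ne_top_of_lt ho)
  rw [← hn] at ho
  have hn0 : n < 0 := by exact_mod_cast ho
  obtain ⟨g, hg, hgz, hgf⟩ := (meromorphicOrderAt_eq_int_iff hf).1 hn.symm
  have hid := tendsto_id_discNhds z
  have hle : discNhds z ≤ 𝓝[≠] z := nhdsWithin_mono z fun ω hω => hω.2
  have hgl : Tendsto (fun ω => ‖g ω‖) (discNhds z) (𝓝 ‖g z‖) :=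
    (hg.continuousAt.tendsto.comp hid).norm
  have hsub : Tendsto (fun ω => ‖ω - z‖) (discNhds z) (𝓝 0) := by
    simpa using (hid.sub_const z).norm
  refine hgz (norm_le_zero_iff.1 (le_of_tendsto_of_tendsto hgl (norm_zero (E := ℂ) ▸ h.norm) ?_))
  filter_upwards [hle hgf, hle self_mem_nhdsWithin, hsub.eventually_le_const one_pos]
    with ω h1 h2 h3
  have h4 : ω - z ≠ 0 := sub_ne_zero.2 h2
  rw [h1, smul_eq_mul, ← mul_assoc, ← zpow_one_add₀ h4, norm_mul, norm_zpow]
  refine le_mul_of_one_le_left (norm_nonneg _) ?_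
  exact one_le_zpow_of_nonpos₀ (norm_pos_iff.2 h4) h3 (by omega)

variable [Fintype C] [DecidableEq C]

/-- The limits `h_{σν}(z)`. -/
theorem exists_tendsto_h {K : ℕ} (hK : S.JostNonvanishing K) {z : ℂ}
    (hz : ‖z‖ ≤ 1) (hz0 : z ≠ 0) (hz1 : z ≠ 1) (hz2 : z ≠ -1) (σ ν : C) {φ : A → ℂ}
    (hφ : S.IsBoundState K z φ)
    (hU : Tendsto (fun ω => (ω - z) * S.U K ω σ ν) (discNhds z) (𝓝 (φ (S.pt σ K))))
    (hn : ∑' α, φ α * starRingEnd ℂ (φ α) =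
        -(S.bInf ν * ((S.theta ν z)⁻¹ - S.theta ν z) / S.e ν K z *
          starRingEnd ℂ (φ (S.pt ν K)) / S.lamDeriv z)) :
    ∃ l, Tendsto (S.h z σ ν) (discNhds z) (𝓝 l) ∧
      φ (S.pt σ K) / S.e σ K z = l + S.correction z σ ν := by
  have hreg := eventually_isRegular (S := S) hz hz0 hz1 hz2
  have hid := tendsto_id_discNhds z
  have hω' : ∀ᶠ ω in discNhds z, id ω ≠ 0 ∧ ‖id ω‖ ≤ 1 :=
    (eventually_discNhds hz0).mono fun i hi => ⟨hi.1, hi.2.1.le⟩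
  have hth := tendsto_theta (S := S) ν hz hz0 hz1 hz2 hω' hid
  have hs := theta_spec (S := S) ν hz0 hz
  -- If channel `ν` is at a threshold, the source vanishes in the limit, so φ = 0, while h is
  -- identically zero.
  by_cases hD : (S.theta ν z)⁻¹ - S.theta ν z = 0
  · have hD' : S.theta ν z - (S.theta ν z)⁻¹ = 0 := by rw [← neg_sub, hD, neg_zero]
    rw [hD, mul_zero, zero_div, zero_mul, zero_div, neg_zero] at hn
    have h0 := eq_zero_of_tsum_mul_conj (hφ.summable hK hφ hz0 hz) hn
    refine ⟨0, ?_, ?_⟩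
    · refine tendsto_const_nhds.congr fun ω => ?_
      rw [h, hD']; ring
    · rw [h0, correction, hD']; simp
  have hDlim := (hth.inv₀ hs.1).sub hth
  have heK := hK.e_ne_zero σ hz0 hz le_rfl
  have heKlim := tendsto_e (S := S) σ hz hz0 hz1 hz2 hω' hid K
  -- h carries the factor θ_ν - θ_ν⁻¹ frozen at `z`, whereas `U` has it at `ω`; the quotient of the
  -- two tends to 1.
  have hfirst := ((tendsto_const_nhds (x := (S.theta ν z)⁻¹ - S.theta ν z)).div hDlim hD).mul
    (hU.div heKlim heK)
  rw [div_self hD, one_mul] at hfirst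
  -- the behaviour of `(ω - z) / e_ν(1, ω)`
  obtain ⟨r, hr, hrc⟩ : ∃ r, Tendsto (fun ω => (ω - z) / S.e ν 1 ω) (discNhds z) (𝓝 r) ∧
      (if σ = ν then S.p σ z K * S.bInf ν * (S.offCoeff ν 0 : ℂ)⁻¹ *
        ((S.theta ν z)⁻¹ - S.theta ν z) * r / S.e σ K z else 0) = -S.correction z σ ν := by
    by_cases he : S.e ν 1 z = 0
    · have him : (S.theta ν z).im = 0 := by
        by_contra h0
        exact e_one_ne_zero_of_theta_im_ne_zero ν hz0 hz h0 he
      have hlt : ‖S.theta ν z‖ < 1 := lt_of_le_of_ne hs.2.1 fun h1 => hD (by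
        rw [theta_inv_eq_of_norm_eq_one h1 him, sub_self])
      obtain ⟨d, hd, hder⟩ := exists_hasDerivWithinAt_e_one ν hz hz0 hz1 hz2 hlt him he
      have hdot : S.eDot ν 1 z = d := hder.derivWithin (uniqueDiffWithinAt_closedBall hz)
      refine ⟨d⁻¹, ?_, ?_⟩
      · have h1 := (hasDerivWithinAt_iff_tendsto_slope.1 hder).mono_left
          (nhdsWithin_mono z (Set.sdiff_subset_sdiff_left ball_subset_closedBall))
        refine (h1.inv₀ hd).congr fun ω => ?_
        rw [slope_def_field, he, sub_zero, inv_div]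
      · rw [correction, hdot]
        by_cases hσ : σ = ν
        · subst hσ
          rw [if_pos rfl, if_pos ⟨rfl, he⟩, he, ← p_mul_e_zero σ hz0 hz he K]
          have h1 := e_zero_ne_zero σ hz0 hz he
          have h2 : S.p σ z K ≠ 0 := fun h0 => heK (by
            rw [← p_mul_e_zero σ hz0 hz he K, h0, zero_mul])
          have h3 := S.offCoeff_ne_zero σ 0
          have h4 := hs.1
          field_simp
          ring
        · simp [hσ]
    · refine ⟨0, ?_, ?_⟩
      · have h1 : Tendsto (fun ω => ω - z) (discNhds z) (𝓝 0) := by simpa using hid.sub_const z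
        have h2 := h1.div (tendsto_e (S := S) ν hz hz0 hz1 hz2 hω' hid 1) he
        rwa [zero_div] at h2
      · simp [correction, he]
  -- The contribution of -P to `U` at index `K`, moved to the other side to leave h alone.
  have hsecond : Tendsto (fun ω => if σ = ν then S.p σ ω K * S.bInf ν * (S.offCoeff ν 0 : ℂ)⁻¹ *
        ((S.theta ν z)⁻¹ - S.theta ν z) * ((ω - z) / S.e ν 1 ω) / S.e σ K ω else 0) (discNhds z)
      (𝓝 (-S.correction z σ ν)) := by
    rw [← hrc]
    split_ifs
    · exact (((((tendsto_p hz0 hid σ K).mul_const _).mul_const _).mul_const _).mul hr).div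
        heKlim heK
    · exact tendsto_const_nhds
  refine ⟨φ (S.pt σ K) / S.e σ K z + -S.correction z σ ν, ?_, by ring⟩
  refine (hfirst.add hsecond).congr' ?_
  filter_upwards [hreg, hDlim.eventually_ne hD] with ω h1 h2
  have h3 := hK.e_ne_zero σ h1.ne_zero h1.norm_lt.le le_rfl
  have h4 := h1.e_one_ne_zero ν
  have h5 := S.offCoeff_ne_zero ν 0
  simp only [id] at h2
  simp only [Pi.div_apply, id]
  rw [h1.U_apply, h, colFactor]
  set δ := (S.theta ν ω)⁻¹ - S.theta ν ω
  set δ' := (S.theta ν z)⁻¹ - S.theta ν z with hδ'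
  rw [show S.theta ν z - (S.theta ν z)⁻¹ = -δ' by rw [hδ', neg_sub]]
  split_ifs
  · field_simp
    ring
  · field_simp
    ring

end

end WebSystem

/-! ### Assembly of the lemma. -/

theorem mainTheorem8 {A C : Type*} [Fintype C] [DecidableEq C] (S : WebSystem A C)
    (z : ℂ) (hz : ‖z‖ ≤ 1) (hz0 : z ≠ 0) (hz1 : z ≠ 1) (hz2 : z ≠ -1) :
    ∃ (m : Matrix C C ℂ) (φ : C → lp (fun _ : A => ℂ) 2),
      S.IsCoeffMatrix z m ∧
      -- the residue of `U(k, ·)` at `z` (which is at most a simple pole)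
      (∀ k, Tendsto (fun ω => (ω - z) • S.U k ω) (WebSystem.discNhds z) (𝓝 (S.E k z * m))) ∧
      -- the eigenvectors, on the channels and on the central part
      (∀ ν σ k, φ ν (S.pt σ k) = S.e σ k z * m σ ν) ∧
      (∀ ν (α : S.central), Tendsto (fun ω => (ω - z) * S.centralColumn ν ω α)
        (WebSystem.discNhds z) (𝓝 (φ ν α))) ∧
      (∀ ν α, S.apply (φ ν) α = S.lam z * φ ν α) ∧
      (z ∈ S.Omega → ∃ ν, φ ν ≠ 0) ∧
      -- the normalization formula, and the uniqueness of the normalization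
      (∀ ν, ((‖φ ν‖ ^ 2 : ℝ) : ℂ) =
        -((S.bInf ν * (1 - (S.theta ν z ^ 2)⁻¹)) /
            (S.b * (1 - ((starRingEnd ℂ) z ^ 2)⁻¹))) * S.theta ν z * m ν ν) ∧
      (∀ ν (c : ℂ), φ ν ≠ 0 → c ≠ 0 →
        ((‖c • φ ν‖ ^ 2 : ℝ) : ℂ) =
          -((S.bInf ν * (1 - (S.theta ν z ^ 2)⁻¹)) /
              (S.b * (1 - ((starRingEnd ℂ) z ^ 2)⁻¹))) * S.theta ν z * (c * m ν ν) →
        c = 1) := by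
  obtain ⟨K, hK1, hK⟩ := WebSystem.exists_jost_ne_zero (S := S)
  choose φ hb hcen hU hn using WebSystem.exists_column_residue (S := S) hK1 hK hz hz0 hz1 hz2
  have hchan : ∀ ν σ k, φ ν (S.pt σ k) = S.e σ k z * (φ ν (S.pt σ K) / S.e σ K z) :=
    fun ν σ k => (hb ν).eq_e_mul hK hz hz0 σ k
  have hnorm : ∀ ν, ∑' α, φ ν α * starRingEnd ℂ (φ ν α) =
      -((S.bInf ν * (1 - (S.theta ν z ^ 2)⁻¹)) /
        (S.b * (1 - ((starRingEnd ℂ) z ^ 2)⁻¹))) * S.theta ν z *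
          (φ ν (S.pt ν K) / S.e ν K z) := by
    intro ν
    -- For nonreal θ_ν(z) the bound state vanishes on channel `ν` and both sides are 0. Otherwise
    -- e_ν(K, z) is real, so it cancels against its conjugate in the pairing identity.
    by_cases him : (S.theta ν z).im = 0
    · have h1 := WebSystem.norm_formula (bν := S.bInf ν) (m := φ ν (S.pt ν K) / S.e ν K z)
        (w := S.lamDeriv z) (WebSystem.theta_spec (S := S) ν hz0 hz).1
        (X := ∑' α, φ ν α * starRingEnd ℂ (φ ν α))
        (by rw [WebSystem.tsum_mul_conj, Complex.conj_ofReal]) him (by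
          rw [hn, map_div₀, WebSystem.conj_e_of_im_eq_zero ν hz0 hz him]; ring)
      rw [h1, WebSystem.conj_lamDeriv, div_neg]
    · rw [hn, (hb ν).eq_zero_of_theta_im_ne_zero hK hz hz0 him]; simp
  refine ⟨Matrix.of fun σ ν => φ ν (S.pt σ K) / S.e σ K z, fun ν => ⟨φ ν, (hb ν).memℓp hK hz hz0⟩,
    fun σ ν => WebSystem.exists_tendsto_h hK hz hz0 hz1 hz2 σ ν (hb ν) (hU ν σ K) (hn ν),
    fun k => ?_, hchan, hcen, fun ν => (hb ν).apply_eq, fun hΩ => ?_, fun ν => ?_,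
    fun ν c hφ hc h => ?_⟩
  · refine tendsto_pi_nhds.2 fun σ => tendsto_pi_nhds.2 fun ν => ?_
    have h1 : (S.E k z * Matrix.of fun σ ν => φ ν (S.pt σ K) / S.e σ K z) σ ν =
        φ ν (S.pt σ k) := by
      rw [hchan, WebSystem.E]
      exact Matrix.diagonal_mul _ _ _ _
    exact h1 ▸ hU ν σ k
  · obtain ⟨-, -, k, σ, ν, f, hf, ho, hUf⟩ := hΩ
    refine ⟨ν, fun h0 => WebSystem.not_tendsto_zero_of_pole hz hf ho ?_⟩
    have h1 : φ ν (S.pt σ k) = 0 := congrFun (congrArg Subtype.val h0) (S.pt σ k)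
    have h2 := hU ν σ k
    rw [h1] at h2
    exact h2.congr' (hUf.mono fun ω hω => by rw [hω])
  · rw [WebSystem.norm_sq_lp]
    exact hnorm ν
  · have h0 : ((‖(⟨φ ν, (hb ν).memℓp hK hz hz0⟩ : lp (fun _ : A => ℂ) 2)‖ ^ 2 : ℝ) : ℂ) ≠ 0 := by
      have := norm_pos_iff.2 hφ
      exact Complex.ofReal_ne_zero.2 (by positivity)
    refine WebSystem.eq_one_of_normSq_mul_eq hc h0 ?_
    rw [norm_smul, mul_pow, Complex.ofReal_mul] at h
    rw [h, WebSystem.norm_sq_lp]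
    change _ = c * ∑' α, φ ν α * starRingEnd ℂ (φ ν α)
    rw [hnorm, Matrix.of_apply]
    ring
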